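/- Let $U_s\in C^3([0,\infty))$ be bounded with $U_s''<0$, $\sup_y\langle y\rangle^6|U_s''|<\infty$, $\sup_y|U_s'''/U_s''|<\infty$, $U_s(0)=0$, $\lim_{y\to\infty}U_s(y)=1$, and put $V_s(y)=y+U_s(y)$. Write $$\mathcal U[f]=\int_0^\infty f,\qquad \mathcal V_y[f]=\int_0^y\int_\infty^{y'}f,\qquad \mathcal V[f]=\int_0^\infty\int_\infty^{y}f .$$ All solutions below are functions $f:[0,\infty)\to\mathbb C$ with $(1+y)^3f\in L^2(\mathbb R_+)$, differentiable with locally absolutely continuous derivative, satisfying the equation almost everywhere. For $k\in\mathbb R$, $\lambda\in\mathbb C$ let $$\mathcal L f=(\lambda+ikV_s)f-ikU_s''\,\mathcal V_y[f]-\partial_y^2f .$$ There are positive constants $k_0,K_*,C$, depending only on $U_s$, such that for all real $k$ and complex $\lambda$ with $|k|\ge k_0$ and $\operatorname{Re}\lambda\ge K_*|k|^{2/3}$ the following holds. (1) The problem $(\lambda+ikV_s)\Omega_{BL}-\partial_y^2\Omega_{BL}=0$, $\mathcal U[\Omega_{BL}]=1$ has a unique solution $\Omega_{BL}$, and the problem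 $\mathcal L\omega_H^{(0)}=ikU_s''y$, $\partial_y\omega_H^{(0)}|_{y=0}=0$ has a unique solution $\omega_H^{(0)}$. (2) There are profiles $\omega_{BL}^{(j)}$ ($j\ge0$) and $\omega_H^{(j)}$ ($j\ge1$) with $$(\lambda+ikV_s)\omega_{BL}^{(j)}-\partial_y^2\omega_{BL}^{(j)}=0,\quad \mathcal U[\omega_{BL}^{(j)}]=\lambda_j\quad (j\ge 0),$$ $$\mathcal L\omega_H^{(j)}=ikU_s''\,\mathcal V_y[\omega_{BL}^{(j-1)}],\quad \partial_y\omega_H^{(j)}|_{y=0}=0\quad (j\ge1),$$ where $\lambda_0=1-\mathcal U[\omega_H^{(0)}]$ and $\lambda_j=-\mathcal U[\omega_H^{(j)}]$ for $j\ge1$. The series $\lambda_*=\sum_{j\ge0}\lambda_j$ converges; on $[0,\infty)$ the series $\omega_H^{(tail)}=\sum_{j\ge1}\omega_H^{(j)}$ and $\sum_{j\ge0}\omega_{BL}^{(j)}=\lambda_*\Omega_{BL}$ converge pointwise; and $(1+y)^3\omega_H^{(tail)}\in L^2(\mathbb R_+)$. (3) For every $\hat\omega_{init}$ with $(1+y)^3\hat\omega_{init}\in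 L^2(\mathbb R_+)$ the problem $\mathcal L\omega_{inhom}=\hat\omega_{init}$, $\mathcal U[\omega_{inhom}]=0$ has a unique solution $\omega_{inhom}$, and for every constant $\hat A\in\mathbb C$ the vorticity equation with mean constraint $$\mathcal L\hat\omega=ikU_s''\,y\,\hat A+\hat\omega_{init},\qquad \mathcal U[\hat\omega]=\hat A,$$ has a unique solution $\hat\omega[\hat A]$, namely $$\hat\omega[\hat A]=\hat A\lambda_*\Omega_{BL}+\hat A\,\omega_H^{(0)}+\hat A\,\omega_H^{(tail)}+\omega_{inhom}.$$ (4) The following bounds hold: $$|\lambda_*|\le C\Big(1+\frac{|k|}{\operatorname{Re}\lambda}\Big),\qquad \big|\mathcal V[|\Omega_{BL}|]\big|\le \frac{C}{|\lambda|^{1/2}},\qquad \big|\mathcal V[|\omega_H^{(0)}|]\big|\le C\frac{|k|}{\operatorname{Re}\lambda},$$ $$\big|\mathcal V[|\omega_H^{(tail)}|]\big|\le C\frac{|k|}{\operatorname{Re}\lambda\,|\lambda|^{1/2}}\Big(1+\frac{|k|}{\operatorname{Re}\lambda}\Big),\qquad \big|\mathcal V[|\omega_{inhom}|]\big|\le \frac{C}{\operatorname{Re}\lambda}|k|^{1/3}\,\|(1+y)^3\hat\omega_{init}\|_{L^2(\mathbb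 R_+)} .$$ -/

import Mathlib

open MeasureTheory Set Filter Topology

noncomputable section

namespace TripleDeck

/-- `U[f] = ∫_0^∞ f`. -/
def calU {E : Type*} [NormedAddCommGroup E] [NormedSpace ℝ E] (f : ℝ → E) : E :=
  ∫ y in Ioi (0 : ℝ), f y

/-- `V[f] = ∫_0^∞ ∫_∞^y f`, where `∫_∞^y f = - ∫_y^∞ f`. -/
def calV {E : Type*} [NormedAddCommGroup E] [NormedSpace ℝ E] (f : ℝ → E) : E :=
  ∫ y in Ioi (0 : ℝ), -∫ z in Ioi y, f z

/-- `V_y[f] = ∫_0^y ∫_∞^{y'} f`, used for `y ≥ 0`. -/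
def calVy {E : Type*} [NormedAddCommGroup E] [NormedSpace ℝ E] (f : ℝ → E) (y : ℝ) : E :=
  ∫ y' in (0 : ℝ)..y, -∫ z in Ioi y', f z

/-- `U_s''` on the closed half line. -/
def D2 (Us : ℝ → ℝ) (y : ℝ) : ℝ := iteratedDerivWithin 2 Us (Ici 0) y

/-- `U_s'''` on the closed half line. -/
def D3 (Us : ℝ → ℝ) (y : ℝ) : ℝ := iteratedDerivWithin 3 Us (Ici 0) y

/-- The standing assumptions on `U_s` (the shear flow being `V_s(y) = y + U_s(y)`). -/
structure ConcaveShear (Us : ℝ → ℝ) : Prop where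
  contDiff : ContDiffOn ℝ 3 Us (Ici 0)
  bounded : ∃ M : ℝ, ∀ y : ℝ, 0 ≤ y → |Us y| ≤ M
  concave : ∀ y : ℝ, 0 ≤ y → D2 Us y < 0
  /-- `⟨y⟩^6 |U_s''|` is bounded, with `⟨y⟩ = (1 + y^2)^{1/2}`. -/
  decay : ∃ M : ℝ, ∀ y : ℝ, 0 ≤ y → (1 + y ^ 2) ^ 3 * |D2 Us y| ≤ M
  ratio : ∃ M : ℝ, ∀ y : ℝ, 0 ≤ y → |D3 Us y / D2 Us y| ≤ M
  zero : Us 0 = 0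
  limit : Tendsto Us atTop (𝓝 1)

/-- `(1 + y)^3 f ∈ L^2(ℝ_+)`. -/
def WeightedL2 (f : ℝ → ℂ) : Prop :=
  MemLp (fun y : ℝ => (((1 + y) ^ 3 : ℝ) : ℂ) * f y) 2 (volume.restrict (Ioi 0))

/-- `‖(1 + y)^3 f‖_{L^2(ℝ_+)}`. -/
def weightedNorm (f : ℝ → ℂ) : ℝ :=
  (eLpNorm (fun y : ℝ => (((1 + y) ^ 3 : ℝ) : ℂ) * f y) 2 (volume.restrict (Ioi 0))).toReal

/-- On `[0, ∞)`, `f` is differentiable with derivative `f1` (one-sided at `0`), and `f1` is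
locally absolutely continuous with almost everywhere derivative `f2`. -/
structure HasTwoDerivs (f f1 f2 : ℝ → ℂ) : Prop where
  first : ∀ y : ℝ, 0 ≤ y → HasDerivWithinAt f (f1 y) (Ici 0) y
  integrable : ∀ y : ℝ, 0 ≤ y → IntervalIntegrable f2 volume 0 y
  second : ∀ y : ℝ, 0 ≤ y → f1 y = f1 0 + ∫ t in (0 : ℝ)..y, f2 t

/-- `f` is a strong solution, with `(1 + y)^3 f ∈ L^2(ℝ_+)`, of
`(λ + i k V_s) f - i k U_s'' V_y[f] - ∂_y^2 f = R` on the half line. -/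
def SolvesVorticity (Us : ℝ → ℝ) (k : ℝ) (lam : ℂ) (R f : ℝ → ℂ) : Prop :=
  WeightedL2 f ∧ ∃ f1 f2 : ℝ → ℂ, HasTwoDerivs f f1 f2 ∧
    ∀ᵐ y ∂(volume.restrict (Ioi (0 : ℝ))),
      (lam + Complex.I * (k : ℂ) * ((y + Us y : ℝ) : ℂ)) * f y
        - Complex.I * (k : ℂ) * (D2 Us y : ℂ) * calVy f y - f2 y = R y

/-- The vorticity equation with right-hand side `R` and mean constraint `U[f] = m`. -/
def MeanProblem (Us : ℝ → ℝ) (k : ℝ) (lam : ℂ) (R : ℝ → ℂ) (m : ℂ) (f : ℝ → ℂ) : Prop :=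
  SolvesVorticity Us k lam R f ∧ calU f = m

/-- The hydrostatic problem: the vorticity equation with right-hand side `R` and the homogeneous
Neumann condition `∂_y f = 0` at `y = 0`. -/
def HydroProblem (Us : ℝ → ℝ) (k : ℝ) (lam : ℂ) (R f : ℝ → ℂ) : Prop :=
  SolvesVorticity Us k lam R f ∧ HasDerivWithinAt f 0 (Ici 0) 0

/-- The boundary layer problem: `(λ + i k V_s) f - ∂_y^2 f = 0` and `U[f] = m`. -/
def BLProblem (Us : ℝ → ℝ) (k : ℝ) (lam : ℂ) (m : ℂ) (f : ℝ → ℂ) : Prop :=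
  (WeightedL2 f ∧ ∃ f1 f2 : ℝ → ℂ, HasTwoDerivs f f1 f2 ∧
    ∀ᵐ y ∂(volume.restrict (Ioi (0 : ℝ))),
      (lam + Complex.I * (k : ℂ) * ((y + Us y : ℝ) : ℂ)) * f y - f2 y = 0) ∧
  calU f = m

/-- The forcing `i k U_s''(y) y`. -/
def shearForcing (Us : ℝ → ℝ) (k : ℝ) (y : ℝ) : ℂ :=
  Complex.I * (k : ℂ) * (D2 Us y : ℂ) * (y : ℂ)

/-- `wH j` and `wBL j` are the hydrostatic profiles `ω_H^{(j)}` and the boundary layer profiles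
`ω_BL^{(j)}` of the iteration. -/
structure IsIteration (Us : ℝ → ℝ) (k : ℝ) (lam : ℂ) (wH wBL : ℕ → ℝ → ℂ) : Prop where
  hydro_zero : HydroProblem Us k lam (shearForcing Us k) (wH 0)
  layer_zero : BLProblem Us k lam (1 - calU (wH 0)) (wBL 0)
  hydro_succ : ∀ j : ℕ, HydroProblem Us k lam
    (fun y => Complex.I * (k : ℂ) * (D2 Us y : ℂ) * calVy (wBL j) y) (wH (j + 1))
  layer_succ : ∀ j : ℕ, BLProblem Us k lam (-calU (wH (j + 1))) (wBL (j + 1))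

/-- `λ_0 = 1 - U[ω_H^{(0)}]` and `λ_j = -U[ω_H^{(j)}]` for `j ≥ 1`. -/
def lamSeq (wH : ℕ → ℝ → ℂ) (j : ℕ) : ℂ :=
  if j = 0 then 1 - calU (wH 0) else -calU (wH j)

/-- `f` satisfies `P`, and it is the only such function on `[0, ∞)`. -/
def IsTheSolution (P : (ℝ → ℂ) → Prop) (f : ℝ → ℂ) : Prop :=
  P f ∧ ∀ g : ℝ → ℂ, P g → EqOn g f (Ici 0)

end TripleDeck

end

/-! Two mechanisms carry the theorem: the size of `Re λ` factorizes the local operator `z - ∂²`,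
with `z = λ + ikV_s`, and concavity neutralizes the nonlocal term.

Local part. The principal square root `Q` of `z` has `Re Q ≥ √(Re λ)`, and `Q'` is of size `|k|/√(Re
λ)`, which is small against `Re λ` once `Re λ` is a large multiple of `|k|^(2/3)`. A contraction
then gives a solution `q` of `q' = q² - z` near `Q` (`exists_riccati`), so that `z - ∂² = (q - ∂)(q
+ ∂)`. Solving the first factor from infinity and the second from the wall gives the Neumann
solution operator `neumannOp`, and `exp(-∫q)` is the boundary layer, whose mean and moments are
compared with those of `exp(-∫Q)` (`layer_bounds`).

Nonlocal part. After multiplication by the conjugate of `f` over `|U_s''|`, the nonlocal term has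
real part `Re(ik V_y[f] f̄)` up to sign. Since `f` is the second derivative of `V_y[f]` and `ik` is
imaginary, this is an exact derivative and costs nothing. Hence `energy` bounds the weighted norm of
`f` by `|k|/Re λ` times the size of the source relative to `U_s''`, uniformly when the nonlocal term
is multiplied by a real `t`. The weight `1/|U_s''|` grows at infinity, so the boundary terms there
are killed by the pointwise decay of `Riccati.decay`. The uniform bound feeds the method of
continuity (`exists_sub_apply_eq`) for the unknown `p = V_y[f]` in the bounded continuous functions.

Iteration. By linearity only three profiles are needed: the layer `Ω` of mean one, the hydrostatic
profile `H = ω_H^(0)`, and the Neumann corrector `h` with `L h = ikU_s'' V_y[Ω]`. With `ρ = -U[h]`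
all later profiles are `λ_0 ρ^j Ω` and `λ_0 ρ^j h`, the series are geometric, and `λ_* = λ_0/(1 -
ρ)`; the choice of `K_*` forces `|ρ| ≤ 1/2`. Moreover `Ω + h` solves the homogeneous equation with
nonzero slope at the wall and mean `1 - ρ ≠ 0`. Adding a multiple of it adjusts any mean, and it
spans the freedom left without a wall condition, which gives uniqueness
(`ShearData.Admissible.eqOn_of_calU_eq`). -/

noncomputable section

namespace TripleDeck

/-! ### Extension of the shear flow to the whole line -/

/-- A shear profile extended to the whole line: `v` is the extension of `V_s`, `b` its derivative,
and `d` the extension of `-U_s''`, with derivative `d1` on `(0, ∞)`. -/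
structure ShearData where
  v : ℝ → ℝ
  b : ℝ → ℝ
  d : ℝ → ℝ
  d1 : ℝ → ℝ
  bM : ℝ
  κ : ℝ
  M : ℝ
  bM_pos : 0 < bM
  κ_nonneg : 0 ≤ κ
  M_pos : 0 < M
  hasDerivAt_v : ∀ y, HasDerivAt v (b y) y
  v_zero : v 0 = 0
  continuous_b : Continuous b
  abs_b_le : ∀ y, |b y| ≤ bM
  continuous_d : Continuous d
  d_pos : ∀ y, 0 < d y
  hasDerivAt_d : ∀ y, 0 < y → HasDerivAt d (d1 y) y
  abs_d1_le : ∀ y, 0 < y → |d1 y| ≤ κ * d y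
  d_le_exp : ∀ x y, d x ≤ d y * Real.exp (κ * |x - y|)
  decay : ∀ y, 0 ≤ y → (1 + y) ^ 6 * d y ≤ M

lemma continuous_max_zero : Continuous fun y : ℝ => max y 0 := by fun_prop

/-- The extension by the value at `0` of a continuous function on the closed half line. -/
lemma ContinuousOn.comp_max_zero {E : Type*} [TopologicalSpace E] {f : ℝ → E}
    (hf : ContinuousOn f (Ici 0)) : Continuous fun y => f (max y 0) :=
  hf.comp_continuous continuous_max_zero fun y => le_max_right y 0

section Shear

variable {Us : ℝ → ℝ}

lemma ConcaveShear.hasDerivWithinAt_zero (h : ConcaveShear Us) {y : ℝ} (hy : 0 ≤ y) :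
    HasDerivWithinAt Us (derivWithin Us (Ici 0) y) (Ici 0) y :=
  ((h.contDiff.differentiableOn (by norm_num)) y hy).hasDerivWithinAt

lemma ConcaveShear.contDiffOn_one (h : ConcaveShear Us) :
    ContDiffOn ℝ 2 (derivWithin Us (Ici 0)) (Ici 0) :=
  h.contDiff.derivWithin (uniqueDiffOn_Ici 0) (by norm_num)

lemma D2_eq : D2 Us = derivWithin (derivWithin Us (Ici 0)) (Ici 0) := by
  funext y
  rw [D2, iteratedDerivWithin_succ]
  congr 1
  funext x
  rw [iteratedDerivWithin_one]

lemma ConcaveShear.hasDerivWithinAt_one (h : ConcaveShear Us) {y : ℝ} (hy : 0 ≤ y) :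
    HasDerivWithinAt (derivWithin Us (Ici 0)) (D2 Us y) (Ici 0) y := by
  rw [D2_eq]
  exact ((h.contDiffOn_one.differentiableOn (by norm_num)) y hy).hasDerivWithinAt

lemma ConcaveShear.contDiffOn_two (h : ConcaveShear Us) :
    ContDiffOn ℝ 1 (D2 Us) (Ici 0) := by
  rw [D2_eq]
  exact h.contDiffOn_one.derivWithin (uniqueDiffOn_Ici 0) (by norm_num)

lemma ConcaveShear.hasDerivWithinAt_two (h : ConcaveShear Us) {y : ℝ} (hy : 0 ≤ y) :
    HasDerivWithinAt (D2 Us) (D3 Us y) (Ici 0) y := by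
  have h3 : D3 Us y = derivWithin (D2 Us) (Ici 0) y := by
    rw [D3, iteratedDerivWithin_succ]; rfl
  rw [h3]
  exact ((h.contDiffOn_two.differentiableOn (by norm_num)) y hy).hasDerivWithinAt

/-- The decay of `U_s''` gives `|U_s''| ≤ M/(1 + y²)`, so `M arctan ± U_s'` are both nondecreasing,
and `arctan` is bounded. -/
lemma ConcaveShear.abs_deriv_le (h : ConcaveShear Us) :
    ∃ C : ℝ, ∀ y, 0 ≤ y → |derivWithin Us (Ici 0) y| ≤ C := by
  obtain ⟨M, hM⟩ := h.decay
  have hM0 : 0 ≤ M := (mul_nonneg (by positivity) (abs_nonneg _)).trans (hM 0 le_rfl)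
  have hb : ∀ y, 0 ≤ y → |D2 Us y| ≤ M * (1 / (1 + y ^ 2)) := by
    intro y hy
    have h1 := hM y hy
    rw [mul_one_div, le_div_iff₀ (by positivity)]
    have : (1 + y ^ 2) ≤ (1 + y ^ 2) ^ 3 := le_self_pow₀ (by nlinarith [sq_nonneg y]) (by norm_num)
    nlinarith [abs_nonneg (D2 Us y)]
  have key : ∀ s : ℝ, |s| = 1 → MonotoneOn
      (fun y => M * Real.arctan y + s * derivWithin Us (Ici 0) y) (Ici 0) := by
    intro s hs
    refine monotoneOn_of_hasDerivWithinAt_nonneg (convex_Ici 0) (f' := fun y =>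
      M * (1 / (1 + y ^ 2)) + s * D2 Us y) ?_ ?_ ?_
    · exact (Real.continuous_arctan.continuousOn.const_mul M).add
        (fun y hy => ((h.hasDerivWithinAt_one hy).continuousWithinAt).const_mul s)
    · intro y hy
      have hy' : y ∈ Ici (0 : ℝ) := interior_subset hy
      exact ((Real.hasDerivAt_arctan y).const_mul M).hasDerivWithinAt.add
        (((h.hasDerivWithinAt_one hy').mono interior_subset).const_mul s)
    · intro y hy
      have h1 := hb y (interior_subset hy)
      have h2 : |s * D2 Us y| = |D2 Us y| := by rw [abs_mul, hs, one_mul]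
      have := neg_abs_le (s * D2 Us y)
      linarith
  refine ⟨|derivWithin Us (Ici 0) 0| + M * (Real.pi / 2), fun y hy => ?_⟩
  have h1 := key 1 (by simp) (mem_Ici.2 le_rfl) (mem_Ici.2 hy) hy
  have h2 := key (-1) (by simp) (mem_Ici.2 le_rfl) (mem_Ici.2 hy) hy
  simp only [Real.arctan_zero] at h1 h2
  have h3 := Real.arctan_lt_pi_div_two y
  have h4 : M * Real.arctan y ≤ M * (Real.pi / 2) := mul_le_mul_of_nonneg_left h3.le hM0
  rw [abs_le]
  constructor <;>
  linarith [neg_abs_le (derivWithin Us (Ici 0) 0), le_abs_self (derivWithin Us (Ici 0) 0)]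

lemma ConcaveShear.exists_ratio (h : ConcaveShear Us) :
    ∃ κ : ℝ, 0 ≤ κ ∧ ∀ y, 0 ≤ y → |D3 Us y| ≤ κ * -D2 Us y := by
  obtain ⟨M, hM⟩ := h.ratio
  refine ⟨M, (abs_nonneg _).trans (hM 0 le_rfl), fun y hy => ?_⟩
  have h1 := hM y hy
  have h2 := h.concave y hy
  rwa [abs_div, abs_of_neg h2, div_le_iff₀ (by linarith)] at h1

/-- The logarithm of `-U_s''` is Lipschitz. -/
lemma ConcaveShear.neg_D2_le_exp (h : ConcaveShear Us) {κ : ℝ}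
    (hκ : ∀ y, 0 ≤ y → |D3 Us y| ≤ κ * -D2 Us y) {x y : ℝ} (hx : 0 ≤ x) (hy : 0 ≤ y) :
    -D2 Us x ≤ -D2 Us y * Real.exp (κ * |x - y|) := by
  have hder : ∀ t ∈ Ici (0 : ℝ), HasDerivWithinAt (fun t => Real.log (-D2 Us t))
      (-D3 Us t / -D2 Us t) (Ici 0) t := fun t ht =>
    ((h.hasDerivWithinAt_two ht).neg).log (by have := h.concave t ht; simp; linarith)
  have hl := Convex.norm_image_sub_le_of_norm_hasDerivWithin_le (C := κ) hder (by
      intro t ht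
      have h1 := h.concave t ht
      have h2 := hκ t ht
      rw [Real.norm_eq_abs, neg_div_neg_eq, abs_div, abs_of_neg h1, div_le_iff₀ (by linarith)]
      exact h2) (convex_Ici 0) (mem_Ici.2 hy) (mem_Ici.2 hx)
  have h1 := h.concave x hx
  have h2 := h.concave y hy
  rw [Real.norm_eq_abs, Real.norm_eq_abs] at hl
  have h3 := (le_abs_self _).trans hl
  have h4 : Real.log (-D2 Us x) ≤ Real.log (-D2 Us y * Real.exp (κ * |x - y|)) := by
    rw [Real.log_mul (by linarith) (Real.exp_ne_zero _), Real.log_exp]; linarith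
  exact (Real.log_le_log_iff (by linarith) (mul_pos (by linarith) (Real.exp_pos _))).1 h4

/-- To the left of the wall, `V_s'` and `U_s''` are frozen at their values at `0`, and `V_s` is
continued as a primitive. The global bounds and two-sided derivatives let the Riccati equation be
solved on all of `ℝ`, without a boundary condition. -/
theorem ConcaveShear.exists_shearData (h : ConcaveShear Us) :
    ∃ S : ShearData, (∀ y, 0 ≤ y → S.v y = y + Us y) ∧ ∀ y, 0 ≤ y → D2 Us y = -S.d y := by
  obtain ⟨C, hC⟩ := h.abs_deriv_le
  obtain ⟨κ, hκ0, hκ⟩ := h.exists_ratio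
  obtain ⟨M, hM⟩ := h.decay
  have hM0 : 0 ≤ M := (mul_nonneg (by positivity) (abs_nonneg _)).trans (hM 0 le_rfl)
  have hC0 : 0 ≤ C := (abs_nonneg _).trans (hC 0 le_rfl)
  set b : ℝ → ℝ := fun t => 1 + derivWithin Us (Ici 0) (max t 0) with hbdef
  have hbc : Continuous b := continuous_const.add
    (ContinuousOn.comp_max_zero h.contDiffOn_one.continuousOn)
  refine ⟨{ v := fun y => ∫ t in (0:ℝ)..y, b t
            b := b
            d := fun y => -D2 Us (max y 0)
            d1 := fun y => -D3 Us y
            bM := 1 + C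
            κ := κ
            M := 8 * M + 1
            bM_pos := by positivity
            κ_nonneg := hκ0
            M_pos := by positivity
            hasDerivAt_v := fun y => intervalIntegral.integral_hasDerivAt_right
              (hbc.intervalIntegrable _ _) (hbc.stronglyMeasurableAtFilter _ _) hbc.continuousAt
            v_zero := by simp
            continuous_b := hbc
            abs_b_le := ?_
            continuous_d := (ContinuousOn.comp_max_zero h.contDiffOn_two.continuousOn).neg
            d_pos := fun y => neg_pos.2 (h.concave _ (le_max_right _ _))
            hasDerivAt_d := ?_
            abs_d1_le := ?_
            d_le_exp := ?_
            decay := ?_ }, ?_, ?_⟩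
  · intro y
    have := hC _ (le_max_right y 0)
    calc |b y| ≤ |1| + |derivWithin Us (Ici 0) (max y 0)| := abs_add_le _ _
      _ ≤ 1 + C := by rw [abs_one]; linarith
  · intro y hy
    have h1 := ((h.hasDerivWithinAt_two hy.le).hasDerivAt (Ici_mem_nhds hy)).neg
    refine h1.congr_of_eventuallyEq ?_
    filter_upwards [Ioi_mem_nhds hy] with x hx
    simp [max_eq_left (le_of_lt (mem_Ioi.1 hx))]
  · intro y hy
    rw [abs_neg, max_eq_left hy.le]
    exact hκ y hy.le
  · intro x y
    refine (h.neg_D2_le_exp hκ (le_max_right x 0) (le_max_right y 0)).trans ?_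
    have := h.concave _ (le_max_right y 0)
    have h2 : |max x 0 - max y 0| ≤ |x - y| := abs_max_sub_max_le_abs x y 0
    gcongr
    linarith
  · intro y hy
    rw [max_eq_left hy]
    have h1 := hM y hy
    rw [abs_of_neg (h.concave y hy)] at h1
    -- The factor `8 = 2³` converts the weight `⟨y⟩^6` into `(1 + y)^6`; the extra `1` in the
    -- constant only makes it positive.
    have h2 : (1 + y) ^ 6 ≤ 8 * (1 + y ^ 2) ^ 3 := by
      have : (1 + y) ^ 2 ≤ 2 * (1 + y ^ 2) := by nlinarith [sq_nonneg (1 - y)]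
      calc (1 + y) ^ 6 = ((1 + y) ^ 2) ^ 3 := by ring
        _ ≤ (2 * (1 + y ^ 2)) ^ 3 := by gcongr
        _ = 8 * (1 + y ^ 2) ^ 3 := by ring
    have h3 := h.concave y hy
    nlinarith
  · intro y hy
    show ∫ t in (0:ℝ)..y, b t = y + Us y
    have h1 : ∀ t ∈ Ioo 0 y, HasDerivAt (fun t => t + Us t) (b t) t := by
      intro t ht
      have := ((h.hasDerivWithinAt_zero ht.1.le).hasDerivAt (Ici_mem_nhds ht.1))
      rw [hbdef]
      simp only [max_eq_left ht.1.le]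
      exact (hasDerivAt_id t).add this
    have hc : ContinuousOn (fun t => t + Us t) (Icc 0 y) :=
      continuousOn_id.add (h.contDiff.continuousOn.mono Icc_subset_Ici_self)
    rw [intervalIntegral.integral_eq_sub_of_hasDerivAt_of_le hy hc h1 (hbc.intervalIntegrable _ _)]
    simp [h.zero]
  · intro y hy
    simp [max_eq_left hy]

end Shear

/-! ### Primitives of integrable functions -/

lemma absolutelyContinuousOnInterval_integral {h : ℝ → ℂ}
    (hh : ∀ a b, IntervalIntegrable h volume a b) (a b : ℝ) :
    AbsolutelyContinuousOnInterval (fun x => ∫ t in a..x, h t) a b := by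
  have hre : ∀ a b, IntervalIntegrable (fun t => (h t).re) volume a b :=
    fun a b => ⟨(hh a b).1.re, (hh a b).2.re⟩
  have him : ∀ a b, IntervalIntegrable (fun t => (h t).im) volume a b :=
    fun a b => ⟨(hh a b).1.im, (hh a b).2.im⟩
  have hc : ∀ c : ℂ, AbsolutelyContinuousOnInterval (fun _ : ℝ => c) a b := fun c =>
    ContDiffOn.absolutelyContinuousOnInterval contDiffOn_const
  convert! (((hre a b).absolutelyContinuousOnInterval_intervalIntegral (c := a) (by simp)).smul
    (hc 1)).add (((him a b).absolutelyContinuousOnInterval_intervalIntegral (c := a) (by simp)).smul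
    (hc Complex.I)) using 1
  funext x
  have h1 : (∫ t in a..x, h t).re = ∫ t in a..x, (h t).re := by
    simpa using (Complex.reCLM.intervalIntegral_comp_comm (hh a x)).symm
  have h2 : (∫ t in a..x, h t).im = ∫ t in a..x, (h t).im := by
    simpa using (Complex.imCLM.intervalIntegral_comp_comm (hh a x)).symm
  simp only [Pi.add_apply, Pi.smul_apply', ← h1, ← h2]
  simp [Complex.re_add_im]

/-- The product rule, in integrated form, for a `C^1` function and an indefinite integral. -/
lemma mul_intervalIntegral_eq {E E' h : ℝ → ℂ} {y : ℝ} (hE : ∀ t, HasDerivAt E (E' t) t)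
    (hE' : Continuous E') (hh : ∀ a b, IntervalIntegrable h volume a b) :
    E y * ∫ t in (0:ℝ)..y, h t =
      ∫ t in (0:ℝ)..y, (E t * h t + E' t * ∫ s in (0:ℝ)..t, h s) := by
  have hEc : Continuous E := continuous_iff_continuousAt.2 fun t => (hE t).continuousAt
  have hH := absolutelyContinuousOnInterval_integral hh 0 y
  have hint : ∀ a b, IntervalIntegrable
      (fun t => E t * h t + E' t * ∫ s in (0:ℝ)..t, h s) volume a b := fun a b =>
    ((hh a b).continuousOn_mul hEc.continuousOn).add
      ((hE'.mul (intervalIntegral.continuous_primitive hh 0)).intervalIntegrable a b)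
  have hEA : AbsolutelyContinuousOnInterval E 0 y := by
    refine ContDiffOn.absolutelyContinuousOnInterval (ContDiff.contDiffOn ?_)
    rw [contDiff_one_iff_deriv]
    refine ⟨fun t => (hE t).differentiableAt, ?_⟩
    rwa [show deriv E = E' from funext fun t => (hE t).deriv]
  -- The difference of the two sides is absolutely continuous with derivative zero almost
  -- everywhere, hence constant, and it vanishes at `0`.
  have hAC := (hEA.smul hH).sub (absolutelyContinuousOnInterval_integral hint 0 y)
  obtain ⟨C, hC⟩ := hAC.const_of_ae_hasDerivAt_zero (by
    filter_upwards [(hh 0 y).ae_hasDerivAt_integral, (hint 0 y).ae_hasDerivAt_integral] with x h1 h2 hx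
    have h3 := ((hE x).mul (h1 hx 0 (by simp))).sub (h2 hx 0 (by simp))
    convert! h3 using 1
    ring)
  have h0 := hC 0 (by simp)
  have hy := hC y (by simp)
  simp at h0 hy
  rw [← h0] at hy
  exact sub_eq_zero.1 hy

/-! ### First-order linear equations -/

section FirstOrder

variable {q : ℝ → ℂ}

/-- The integrating factor `exp(∫_0^y q)`. -/
def intFac (q : ℝ → ℂ) (y : ℝ) : ℂ := Complex.exp (∫ t in (0:ℝ)..y, q t)

/-- The solution of `u' = q u - s` that decays at infinity. -/
def backSol (q s : ℝ → ℂ) (y : ℝ) : ℂ := intFac q y * ∫ z in Ioi y, s z * (intFac q z)⁻¹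

/-- The solution of `u' = g - q u` with `u 0 = a`. -/
def fwdSol (q g : ℝ → ℂ) (a : ℂ) (y : ℝ) : ℂ :=
  (intFac q y)⁻¹ * (a + ∫ t in (0:ℝ)..y, intFac q t * g t)

lemma intFac_ne_zero (y : ℝ) : intFac q y ≠ 0 := Complex.exp_ne_zero _

@[simp] lemma intFac_zero : intFac q 0 = 1 := by simp [intFac]

lemma hasDerivAt_intFac (hq : Continuous q) (y : ℝ) :
    HasDerivAt (intFac q) (intFac q y * q y) y :=
  (intervalIntegral.integral_hasDerivAt_right (hq.intervalIntegrable _ _)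
    (hq.stronglyMeasurableAtFilter _ _) hq.continuousAt).cexp

lemma continuous_intFac (hq : Continuous q) : Continuous (intFac q) :=
  continuous_iff_continuousAt.2 fun y => (hasDerivAt_intFac hq y).continuousAt

lemma hasDerivAt_intFac_inv (hq : Continuous q) (y : ℝ) :
    HasDerivAt (fun y => (intFac q y)⁻¹) (-q y * (intFac q y)⁻¹) y := by
  convert! (hasDerivAt_intFac hq y).inv (intFac_ne_zero y) using 1
  field_simp [intFac_ne_zero (q := q) y]

lemma continuous_intFac_inv (hq : Continuous q) : Continuous fun y => (intFac q y)⁻¹ :=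
  (continuous_intFac hq).inv₀ fun y => intFac_ne_zero y

/-- The quotient is `exp(-∫_y^z q)`, so the lower bound on `Re q` becomes exponential decay of the
kernel of `backSol` and `fwdSol`. -/
lemma norm_intFac_mul_inv_le (hq : Continuous q) {c : ℝ} (hc : ∀ y, c ≤ (q y).re) {y z : ℝ}
    (hyz : y ≤ z) : ‖intFac q y * (intFac q z)⁻¹‖ ≤ Real.exp (-(c * (z - y))) := by
  have h1 : intFac q y * (intFac q z)⁻¹ = Complex.exp (-∫ t in y..z, q t) := by
    rw [intFac, intFac, ← Complex.exp_neg, ← Complex.exp_add,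
      ← intervalIntegral.integral_add_adjacent_intervals (hq.intervalIntegrable 0 y)
      (hq.intervalIntegrable y z)]
    ring_nf
  rw [h1, Complex.norm_exp, Complex.neg_re]
  gcongr
  have h2 : (∫ t in y..z, q t).re = ∫ t in y..z, (q t).re := by
    simpa using (Complex.reCLM.intervalIntegral_comp_comm (hq.intervalIntegrable y z)).symm
  rw [h2]
  have h3 := intervalIntegral.integral_mono_on hyz (intervalIntegrable_const (μ := volume) (c := c))
    ((Complex.continuous_re.comp hq).intervalIntegrable y z) (fun t _ => hc t)
  simpa [mul_comm] using h3

lemma norm_intFac_inv_le (hq : Continuous q) {c : ℝ} (hc : ∀ y, c ≤ (q y).re) {z : ℝ}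
    (hz : 0 ≤ z) : ‖(intFac q z)⁻¹‖ ≤ Real.exp (-(c * z)) := by
  simpa using norm_intFac_mul_inv_le hq hc hz

lemma hasDerivAt_fwdSol (hq : Continuous q) {g : ℝ → ℂ} (hg : Continuous g) (a : ℂ) (y : ℝ) :
    HasDerivAt (fwdSol q g a) (g y - q y * fwdSol q g a y) y := by
  have hEg : Continuous fun t => intFac q t * g t := (continuous_intFac hq).mul hg
  have h1 := (hasDerivAt_intFac_inv hq y).mul
    ((intervalIntegral.integral_hasDerivAt_right (hEg.intervalIntegrable 0 y)
      (hEg.stronglyMeasurableAtFilter _ _) hEg.continuousAt).const_add a)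
  convert! h1 using 1
  rw [fwdSol]
  field_simp [intFac_ne_zero (q := q) y]
  ring

@[simp] lemma fwdSol_zero {g : ℝ → ℂ} (a : ℂ) : fwdSol q g a 0 = a := by simp [fwdSol]

variable {s : ℝ → ℂ}

lemma backSol_eq (hs : ∀ y, IntegrableOn (fun z => s z * (intFac q z)⁻¹) (Ioi y)) (y : ℝ) :
    backSol q s y = intFac q y *
      ((∫ z in Ioi 0, s z * (intFac q z)⁻¹) - ∫ z in (0:ℝ)..y, s z * (intFac q z)⁻¹) := by
  rw [backSol, intervalIntegral.integral_Ioi_sub_Ioi' (hs 0) (hs y) |>.symm, sub_sub_cancel]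

lemma intervalIntegrable_of_Ioi {E : Type*} [NormedAddCommGroup E] {h : ℝ → E}
    (hs : ∀ y, IntegrableOn h (Ioi y)) (a b : ℝ) : IntervalIntegrable h volume a b :=
  ⟨(hs a).mono_set Ioc_subset_Ioi_self, (hs b).mono_set Ioc_subset_Ioi_self⟩

lemma continuous_backSol (hq : Continuous q)
    (hs : ∀ y, IntegrableOn (fun z => s z * (intFac q z)⁻¹) (Ioi y)) :
    Continuous (backSol q s) := by
  rw [show backSol q s = _ from funext (backSol_eq hs)]
  exact (continuous_intFac hq).mul (continuous_const.sub
    (intervalIntegral.continuous_primitive (intervalIntegrable_of_Ioi hs) 0))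

lemma hasDerivAt_backSol (hq : Continuous q)
    (hs : ∀ y, IntegrableOn (fun z => s z * (intFac q z)⁻¹) (Ioi y)) (hsc : Continuous s) (y : ℝ) :
    HasDerivAt (backSol q s) (q y * backSol q s y - s y) y := by
  have hc : Continuous fun z => s z * (intFac q z)⁻¹ := hsc.mul (continuous_intFac_inv hq)
  have h1 := (hasDerivAt_intFac hq y).mul
    ((intervalIntegral.integral_hasDerivAt_right (hc.intervalIntegrable 0 y)
      (hc.stronglyMeasurableAtFilter _ _) hc.continuousAt).const_sub
      (∫ z in Ioi 0, s z * (intFac q z)⁻¹))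
  rw [show backSol q s = _ from funext (backSol_eq hs)]
  convert! h1 using 1
  field_simp [intFac_ne_zero (q := q) y]
  ring

/-- For a source that is merely integrable the equation `u' = q u - s` holds only in integrated
form; this is the product rule for the integrating factor and the primitive of the source. -/
lemma backSol_eq_integral (hq : Continuous q)
    (hs : ∀ y, IntegrableOn (fun z => s z * (intFac q z)⁻¹) (Ioi y)) (y : ℝ) :
    backSol q s y = backSol q s 0 + ∫ t in (0:ℝ)..y, (q t * backSol q s t - s t) := by
  have hi := intervalIntegrable_of_Ioi hs 0 y
  have h1 := mul_intervalIntegral_eq (fun t => hasDerivAt_intFac hq t)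
    ((continuous_intFac hq).mul hq) (y := y) (intervalIntegrable_of_Ioi hs)
  have hE : ∫ t in (0:ℝ)..y, intFac q t * q t = intFac q y - 1 := by
    rw [intervalIntegral.integral_eq_sub_of_hasDerivAt (fun t _ => hasDerivAt_intFac hq t)
      (((continuous_intFac hq).mul hq).intervalIntegrable _ _), intFac_zero]
  have h2 : ∀ t, q t * backSol q s t - s t =
      (∫ z in Ioi 0, s z * (intFac q z)⁻¹) * (intFac q t * q t) -
      (intFac q t * (s t * (intFac q t)⁻¹) +
        intFac q t * q t * ∫ z in (0:ℝ)..t, s z * (intFac q z)⁻¹) := by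
    intro t
    rw [backSol_eq hs t]
    field_simp [intFac_ne_zero (q := q) t]
    ring
  rw [intervalIntegral.integral_congr (fun t _ => h2 t), intervalIntegral.integral_sub,
    intervalIntegral.integral_const_mul, hE, ← h1, backSol_eq hs y, backSol_eq hs 0]
  · simp; ring
  · exact (((continuous_intFac hq).mul hq).intervalIntegrable _ _).const_mul _
  · exact (hi.continuousOn_mul (continuous_intFac hq).continuousOn).add
      ((((continuous_intFac hq).mul hq).mul
      (intervalIntegral.continuous_primitive (intervalIntegrable_of_Ioi hs) 0)).intervalIntegrable
        _ _)

lemma norm_backSol_le (hq : Continuous q) {c : ℝ} (hc : ∀ y, c ≤ (q y).re) {y : ℝ} {F : ℝ → ℝ}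
    (hF : IntegrableOn (fun z => Real.exp (-(c * (z - y))) * F z) (Ioi y))
    (hsF : ∀ᵐ z ∂volume.restrict (Ioi y), ‖s z‖ ≤ F z) :
    ‖backSol q s y‖ ≤ ∫ z in Ioi y, Real.exp (-(c * (z - y))) * F z := by
  rw [backSol, ← integral_const_mul]
  refine norm_integral_le_of_norm_le hF ?_
  filter_upwards [hsF, ae_restrict_mem measurableSet_Ioi] with z hz hyz
  rw [mul_left_comm, norm_mul, mul_comm]
  gcongr
  exact norm_intFac_mul_inv_le hq hc (le_of_lt hyz)

end FirstOrder

/-! ### Integrals on the half line -/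

/-- A nonnegative function whose integrals over `[0, Y]` are bounded is integrable. -/
lemma integrableOn_Ioi_of_bounded {u : ℝ → ℝ} {B : ℝ} (hu : ContinuousOn u (Ici 0))
    (h0 : ∀ y, 0 ≤ y → 0 ≤ u y) (hB : ∀ Y, 0 ≤ Y → ∫ y in (0:ℝ)..Y, u y ≤ B) :
    IntegrableOn u (Ioi 0) ∧ ∫ y in Ioi 0, u y ≤ B := by
  have hloc : ∀ Y : ℝ, 0 ≤ Y → IntervalIntegrable u volume 0 Y := fun Y hY =>
    (hu.mono (by rw [uIcc_of_le hY]; exact Icc_subset_Ici_self)).intervalIntegrable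
  have hint : IntegrableOn u (Ioi 0) := by
    refine integrableOn_Ioi_of_intervalIntegral_norm_bounded (l := atTop) (b := id) B 0
      (fun Y => ?_) tendsto_id ?_
    · rcases le_total 0 Y with hY | hY
      · exact (hloc Y hY).1
      · simp [Ioc_eq_empty (not_lt.2 hY)]
    · filter_upwards [eventually_ge_atTop 0] with Y hY
      refine (le_of_eq ?_).trans (hB Y hY)
      refine intervalIntegral.integral_congr fun y hy => ?_
      rw [id, uIcc_of_le hY] at hy
      exact Real.norm_of_nonneg (h0 y hy.1)
  refine ⟨hint, le_of_tendsto (intervalIntegral_tendsto_integral_Ioi 0 hint tendsto_id) ?_⟩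
  filter_upwards [eventually_ge_atTop 0] with Y hY using hB Y hY

/-- The Cauchy-Schwarz inequality with a weight. -/
lemma sq_integral_mul_norm_le {α : Type*} [MeasurableSpace α] {ν : Measure α} {ρ w : α → ℝ}
    (hρ0 : ∀ᵐ x ∂ν, 0 ≤ ρ x) (hρ : Integrable ρ ν) (hw : AEStronglyMeasurable w ν)
    (hρw : Integrable (fun x => ρ x * w x ^ 2) ν) :
    Integrable (fun x => ρ x * w x) ν ∧
      (∫ x, ρ x * w x ∂ν) ^ 2 ≤ (∫ x, ρ x ∂ν) * ∫ x, ρ x * w x ^ 2 ∂ν := by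
  have h1 : Integrable (fun x => ρ x * w x) ν := by
    refine (hρ.add hρw).mono' (hρ.1.mul hw) ?_
    filter_upwards [hρ0] with x hx
    rw [Real.norm_eq_abs, abs_mul, abs_of_nonneg hx, Pi.add_apply]
    have : |w x| ≤ 1 + w x ^ 2 := by
      rw [← sq_abs]; nlinarith [sq_nonneg (|w x| - 1), abs_nonneg (w x)]
    nlinarith
  refine ⟨h1, ?_⟩
  -- The quadratic `t ↦ ∫ ρ (w - t)²` is nonnegative, so its discriminant is nonpositive.
  have h2 : ∀ t : ℝ, 0 ≤ (∫ x, ρ x ∂ν) * (t * t) + (-2 * ∫ x, ρ x * w x ∂ν) * t +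
      ∫ x, ρ x * w x ^ 2 ∂ν := by
    intro t
    have h3 : 0 ≤ ∫ x, ρ x * (w x - t) ^ 2 ∂ν := by
      refine integral_nonneg_of_ae ?_
      filter_upwards [hρ0] with x hx
      exact mul_nonneg hx (sq_nonneg _)
    have h4 : ∫ x, ρ x * (w x - t) ^ 2 ∂ν = ∫ x, (ρ x * w x ^ 2 - 2 * t * (ρ x * w x)) +
        t ^ 2 * ρ x ∂ν := by
      congr 1; funext x; ring
    rw [h4, integral_add (f := fun x => ρ x * w x ^ 2 - 2 * t * (ρ x * w x))
      (hρw.sub (h1.const_mul _)) (hρ.const_mul _),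
      integral_sub hρw (h1.const_mul _), integral_const_mul, integral_const_mul] at h3
    linarith
  have := discrim_le_zero h2
  rw [discrim] at this
  nlinarith

lemma hasDerivAt_neg_inv_one_add {y : ℝ} (hy : 0 ≤ y) :
    HasDerivAt (fun y : ℝ => -(1 + y)⁻¹) (((1 + y) ^ 2)⁻¹) y := by
  have h : (1 + y) ≠ 0 := by positivity
  convert! ((((hasDerivAt_id y).const_add 1).inv h).neg) using 1
  simp [div_eq_mul_inv]

lemma tendsto_neg_inv_one_add : Tendsto (fun y : ℝ => -(1 + y)⁻¹) atTop (𝓝 0) := by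
  have := (tendsto_inv_atTop_zero.comp (tendsto_atTop_add_const_left atTop (1:ℝ) tendsto_id)).neg
  simpa using this

lemma integrableOn_inv_one_add_sq :
    IntegrableOn (fun y : ℝ => ((1 + y) ^ 2)⁻¹) (Ioi 0) :=
  integrableOn_Ioi_deriv_of_nonneg' (fun _ hy => hasDerivAt_neg_inv_one_add hy)
    (fun y _ => by positivity) tendsto_neg_inv_one_add

lemma integral_inv_one_add_sq : ∫ y in Ioi (0:ℝ), ((1 + y) ^ 2)⁻¹ = 1 := by
  rw [integral_Ioi_of_hasDerivAt_of_nonneg' (fun _ hy => hasDerivAt_neg_inv_one_add hy)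
    (fun y _ => by positivity) tendsto_neg_inv_one_add]
  simp

/-! ### The weighted space -/

/-- The square of the weighted norm. -/
def wsq (f : ℝ → ℂ) : ℝ := ∫ y in Ioi (0:ℝ), (1 + y) ^ 6 * ‖f y‖ ^ 2

lemma wsq_nonneg (f : ℝ → ℂ) : 0 ≤ wsq f :=
  setIntegral_nonneg measurableSet_Ioi fun y hy => by
    have : 0 < y := hy
    positivity

lemma norm_weight_mul_sq (f : ℝ → ℂ) (y : ℝ) :
    ‖(((1 + y) ^ 3 : ℝ) : ℂ) * f y‖ ^ 2 = (1 + y) ^ 6 * ‖f y‖ ^ 2 := by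
  rw [norm_mul, mul_pow, Complex.norm_real, Real.norm_eq_abs, sq_abs]; ring

lemma continuous_weight : Continuous fun y : ℝ => (((1 + y) ^ 3 : ℝ) : ℂ) := by fun_prop

variable {f g : ℝ → ℂ}

lemma weightedL2_iff : WeightedL2 f ↔ AEStronglyMeasurable f (volume.restrict (Ioi 0)) ∧
    IntegrableOn (fun y => (1 + y) ^ 6 * ‖f y‖ ^ 2) (Ioi 0) := by
  have hm : AEStronglyMeasurable (fun y : ℝ => (((1 + y) ^ 3 : ℝ) : ℂ) * f y)
      (volume.restrict (Ioi 0)) ↔ AEStronglyMeasurable f (volume.restrict (Ioi 0)) := by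
    refine ⟨fun h => ?_, fun h => continuous_weight.aestronglyMeasurable.mul h⟩
    have h1 : AEStronglyMeasurable (fun y : ℝ => (((1 + y) ^ 3 : ℝ) : ℂ)⁻¹)
      (volume.restrict (Ioi 0)) := continuous_weight.measurable.inv.aestronglyMeasurable
    refine (h1.mul h).congr ?_
    filter_upwards [ae_restrict_mem measurableSet_Ioi] with y hy
    have : (0:ℝ) < y := hy
    have h2 : (((1 + y) ^ 3 : ℝ) : ℂ) ≠ 0 := by
      rw [Complex.ofReal_ne_zero]; positivity
    simp only [Pi.mul_apply]
    rw [inv_mul_cancel_left₀ h2]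
  have h2 : ∀ h : AEStronglyMeasurable f (volume.restrict (Ioi 0)), WeightedL2 f ↔
      IntegrableOn (fun y => (1 + y) ^ 6 * ‖f y‖ ^ 2) (Ioi 0) := by
    intro h
    rw [WeightedL2, memLp_two_iff_integrable_sq_norm (hm.2 h), IntegrableOn]
    simp_rw [norm_weight_mul_sq]
  constructor
  · intro h
    have := hm.1 h.1
    exact ⟨this, (h2 this).1 h⟩
  · rintro ⟨h, h'⟩
    exact (h2 h).2 h'

lemma weightedNorm_sq (hf : WeightedL2 f) : weightedNorm f ^ 2 = wsq f := by
  have h := hf.eLpNorm_eq_integral_rpow_norm (by norm_num) (by norm_num)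
  rw [weightedNorm, h, ENNReal.toReal_ofReal (by positivity), ← Real.rpow_natCast,
    ← Real.rpow_mul (by positivity)]
  simp only [ENNReal.toReal_ofNat, Real.rpow_two, norm_weight_mul_sq]
  norm_num [wsq]

lemma weightedNorm_nonneg (f : ℝ → ℂ) : 0 ≤ weightedNorm f := ENNReal.toReal_nonneg

lemma WeightedL2.integrableOn (hf : WeightedL2 f) :
    IntegrableOn (fun y => (1 + y) ^ 6 * ‖f y‖ ^ 2) (Ioi 0) := (weightedL2_iff.1 hf).2

lemma WeightedL2.aestronglyMeasurable (hf : WeightedL2 f) :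
    AEStronglyMeasurable f (volume.restrict (Ioi 0)) := (weightedL2_iff.1 hf).1

lemma WeightedL2.add (hf : WeightedL2 f) (hg : WeightedL2 g) :
    WeightedL2 fun y => f y + g y := by
  have := MemLp.add hf hg
  refine this.congr_norm ?_ (Eventually.of_forall fun y => ?_) |> fun h => h
  · exact continuous_weight.aestronglyMeasurable.mul
      (hf.aestronglyMeasurable.add hg.aestronglyMeasurable)
  · simp [mul_add]

lemma WeightedL2.const_mul (hf : WeightedL2 f) (a : ℂ) : WeightedL2 fun y => a * f y := by
  have := MemLp.const_mul hf a
  unfold WeightedL2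
  convert! this using 2
  ring

lemma wsq_congr (h : EqOn f g (Ioi 0)) : wsq f = wsq g :=
  setIntegral_congr_fun measurableSet_Ioi fun y hy => by simp only [h hy]

/-- Tails of functions in the weighted space. -/
lemma WeightedL2.tail (hf : WeightedL2 f) {N : ℝ} (hN : 0 ≤ N) (hfN : wsq f ≤ N ^ 2) {y : ℝ}
    (hy : 0 ≤ y) : IntegrableOn f (Ioi y) ∧ ∫ z in Ioi y, ‖f z‖ ≤ N * ((1 + y) ^ 2)⁻¹ := by
  have hsub : Ioi y ⊆ Ioi (0:ℝ) := Ioi_subset_Ioi hy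
  -- Cauchy-Schwarz is used against `(1 + z)^(-6)`. Its tail is at most `(1 + y)^(-4)`, whose square
  -- root `(1 + y)^(-2)` has integral one on the half line; thus one bound `N` controls both the
  -- mean and the double integral.
  have hρ : IntegrableOn (fun z : ℝ => ((1 + z) ^ 6)⁻¹) (Ioi y) ∧
      ∫ z in Ioi y, ((1 + z) ^ 6)⁻¹ ≤ ((1 + y) ^ 4)⁻¹ := by
    have hb : ∀ z ∈ Ioi y, ((1 + z) ^ 6)⁻¹ ≤ ((1 + y) ^ 4)⁻¹ * ((1 + z) ^ 2)⁻¹ := by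
      intro z hz
      have hz' : y < z := hz
      have hz0 : 0 < z := hsub hz
      rw [← mul_inv]
      refine inv_anti₀ (by positivity) ?_
      calc (1 + y) ^ 4 * (1 + z) ^ 2 ≤ (1 + z) ^ 4 * (1 + z) ^ 2 := by gcongr
        _ = (1 + z) ^ 6 := by ring
    have hi : IntegrableOn (fun z : ℝ => ((1 + y) ^ 4)⁻¹ * ((1 + z) ^ 2)⁻¹) (Ioi y) :=
      (integrableOn_inv_one_add_sq.mono_set hsub).const_mul _
    have hint : IntegrableOn (fun z : ℝ => ((1 + z) ^ 6)⁻¹) (Ioi y) := by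
      refine hi.mono' (by fun_prop) ?_
      filter_upwards [ae_restrict_mem measurableSet_Ioi] with z hz
      have : 0 < z := hsub hz
      rw [Real.norm_of_nonneg (by positivity)]
      exact hb z hz
    refine ⟨hint, (setIntegral_mono_on hint hi measurableSet_Ioi hb).trans ?_⟩
    rw [integral_const_mul]
    refine mul_le_of_le_one_right (by positivity) ?_
    exact (setIntegral_mono_set integrableOn_inv_one_add_sq
      (Eventually.of_forall fun z => by simp; positivity) hsub.eventuallyLE).trans
      integral_inv_one_add_sq.le
  have heq : ∀ z ∈ Ioi y, ((1 + z) ^ 6)⁻¹ * ((1 + z) ^ 6 * ‖f z‖) ^ 2 =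
      (1 + z) ^ 6 * ‖f z‖ ^ 2 := by
    intro z hz
    have : 0 < z := hsub hz
    field_simp
  have hm := hf.aestronglyMeasurable.mono_measure (Measure.restrict_mono hsub le_rfl)
  have hcs := sq_integral_mul_norm_le (ν := volume.restrict (Ioi y))
    (ρ := fun z => ((1 + z) ^ 6)⁻¹) (w := fun z => (1 + z) ^ 6 * ‖f z‖)
    (by
      filter_upwards [ae_restrict_mem measurableSet_Ioi] with z hz
      have : 0 < z := hsub hz
      positivity) hρ.1
    ((by fun_prop : Continuous fun z : ℝ => (1 + z) ^ 6).aestronglyMeasurable.mul hm.norm)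
    ((integrableOn_congr_fun heq measurableSet_Ioi).2 (hf.integrableOn.mono_set hsub))
  rw [setIntegral_congr_fun measurableSet_Ioi heq] at hcs
  have heq2 : ∀ z ∈ Ioi y, ((1 + z) ^ 6)⁻¹ * ((1 + z) ^ 6 * ‖f z‖) = ‖f z‖ := by
    intro z hz
    have : 0 < z := hsub hz
    field_simp
  rw [setIntegral_congr_fun measurableSet_Ioi heq2] at hcs
  have hfi : IntegrableOn (fun z => ‖f z‖) (Ioi y) :=
    (integrableOn_congr_fun heq2 measurableSet_Ioi).1 hcs.1
  refine ⟨(integrable_norm_iff hm).1 hfi, ?_⟩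
  have h1 : ∫ z in Ioi y, (1 + z) ^ 6 * ‖f z‖ ^ 2 ≤ N ^ 2 := by
    refine (setIntegral_mono_set hf.integrableOn ?_ hsub.eventuallyLE).trans hfN
    filter_upwards [ae_restrict_mem measurableSet_Ioi] with z hz
    have : (0:ℝ) < z := hz
    simp only [Pi.zero_apply]; positivity
  have h2 : (∫ z in Ioi y, ‖f z‖) ^ 2 ≤ (N * ((1 + y) ^ 2)⁻¹) ^ 2 := by
    refine hcs.2.trans ?_
    have h3 : 0 ≤ ∫ z in Ioi y, (1 + z) ^ 6 * ‖f z‖ ^ 2 :=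
      setIntegral_nonneg measurableSet_Ioi fun z hz => by
        have : 0 < z := hsub hz
        positivity
    calc _ ≤ ((1 + y) ^ 4)⁻¹ * N ^ 2 := mul_le_mul hρ.2 h1 h3 (by positivity)
      _ = _ := by rw [mul_pow, inv_pow, ← pow_mul]; ring
  exact le_of_sq_le_sq h2 (by positivity)

lemma WeightedL2.integrableOn_Ioi (hf : WeightedL2 f) : IntegrableOn f (Ioi 0) :=
  (hf.tail (Real.sqrt_nonneg _) (Real.sq_sqrt (wsq_nonneg f)).ge le_rfl).1

lemma norm_calU_le (hf : WeightedL2 f) {N : ℝ} (hN : 0 ≤ N) (hfN : wsq f ≤ N ^ 2) :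
    ‖calU f‖ ≤ N := by
  have := (hf.tail hN hfN le_rfl).2
  simp only [add_zero, one_pow, inv_one, mul_one] at this
  exact (norm_integral_le_integral_norm _).trans this

lemma calU_add (hf : IntegrableOn f (Ioi 0)) (hg : IntegrableOn g (Ioi 0)) :
    calU (fun y => f y + g y) = calU f + calU g := integral_add hf hg

lemma calU_const_mul (f : ℝ → ℂ) (a : ℂ) : calU (fun y => a * f y) = a * calU f :=
  integral_const_mul _ _

lemma calU_congr (h : EqOn f g (Ioi 0)) : calU f = calU g :=
  setIntegral_congr_fun measurableSet_Ioi h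

lemma abs_calV_norm_le_of_tail {T : ℝ → ℝ} {B : ℝ} (hT : IntegrableOn T (Ioi 0))
    (hTB : ∫ y in Ioi 0, T y ≤ B)
    (h : ∀ y, 0 < y → ∫ z in Ioi y, ‖f z‖ ≤ T y) : |calV fun y => ‖f y‖| ≤ B := by
  rw [calV, ← Real.norm_eq_abs]
  refine (norm_integral_le_of_norm_le hT ?_).trans hTB
  filter_upwards [ae_restrict_mem measurableSet_Ioi] with y hy
  rw [norm_neg, Real.norm_of_nonneg (integral_nonneg fun z => norm_nonneg _)]
  exact h y hy

lemma abs_calV_norm_le (hf : WeightedL2 f) {N : ℝ} (hN : 0 ≤ N) (hfN : wsq f ≤ N ^ 2) :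
    |calV fun y => ‖f y‖| ≤ N :=
  abs_calV_norm_le_of_tail (integrableOn_inv_one_add_sq.const_mul N)
    (by rw [integral_const_mul, integral_inv_one_add_sq, mul_one])
    fun y hy => (hf.tail hN hfN hy.le).2

/-- The tail integral `∫_y^∞ f`. -/
def tailInt (f : ℝ → ℂ) (y : ℝ) : ℂ := ∫ z in Ioi y, f z

lemma calVy_eq (f : ℝ → ℂ) (y : ℝ) : calVy f y = ∫ t in (0:ℝ)..y, -tailInt f t := rfl

lemma tailInt_eq (hf : IntegrableOn f (Ioi 0)) {y : ℝ} (hy : 0 ≤ y) :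
    tailInt f y = tailInt f 0 - ∫ z in (0:ℝ)..y, f z := by
  rw [tailInt, tailInt, ← intervalIntegral.integral_Ioi_sub_Ioi' hf
    (hf.mono_set (Ioi_subset_Ioi hy)), sub_sub_cancel]

lemma intervalIntegrable_of_integrableOn_Ioi (hf : IntegrableOn f (Ioi 0)) {a b : ℝ} (ha : 0 ≤ a)
    (hb : 0 ≤ b) : IntervalIntegrable f volume a b :=
  ⟨hf.mono_set (Ioc_subset_Ioi_self.trans (Ioi_subset_Ioi ha)),
    hf.mono_set (Ioc_subset_Ioi_self.trans (Ioi_subset_Ioi hb))⟩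

lemma continuousOn_tailInt (hf : IntegrableOn f (Ioi 0)) : ContinuousOn (tailInt f) (Ici 0) := by
  have h1 : ContinuousOn (fun y => ∫ z in (0:ℝ)..y, indicator (Ioi 0) f z) (Ici 0) :=
    (intervalIntegral.continuous_primitive
      (fun a b => ((integrable_indicator_iff measurableSet_Ioi).2 hf).intervalIntegrable)
      0).continuousOn
  refine (continuousOn_const (c := tailInt f 0) |>.sub h1).congr fun y hy => ?_
  have hy' : (0:ℝ) ≤ y := hy
  rw [tailInt_eq hf hy]
  congr 1
  refine intervalIntegral.integral_congr_ae (Eventually.of_forall fun z hz => ?_)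
  rw [uIoc_of_le hy'] at hz
  exact (indicator_of_mem (mem_Ioi.2 hz.1) f).symm

lemma hasDerivAt_tailInt (hf : IntegrableOn f (Ioi 0)) (hc : ContinuousOn f (Ici 0)) {y : ℝ}
    (hy : 0 < y) : HasDerivAt (tailInt f) (-f y) y := by
  have hcy : ContinuousAt f y := hc.continuousAt (Ici_mem_nhds hy)
  have hm : StronglyMeasurableAtFilter f (𝓝 y) volume :=
    ⟨Ioi 0, Ioi_mem_nhds hy, hf.aestronglyMeasurable⟩
  have h1 := (intervalIntegral.integral_hasDerivAt_right
    (intervalIntegrable_of_integrableOn_Ioi hf le_rfl hy.le) hm hcy).const_sub (tailInt f 0)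
  refine h1.congr_of_eventuallyEq ?_
  filter_upwards [Ioi_mem_nhds hy] with x hx using tailInt_eq hf (le_of_lt hx)

lemma hasDerivWithinAt_calVy (hf : IntegrableOn f (Ioi 0)) {y : ℝ} (hy : 0 ≤ y) :
    HasDerivWithinAt (calVy f) (-tailInt f y) (Ici 0) y := by
  have hc := ContinuousOn.comp_max_zero (continuousOn_tailInt hf)
  have h1 : HasDerivAt (fun y => ∫ t in (0:ℝ)..y, -tailInt f (max t 0)) (-tailInt f (max y 0)) y :=
    intervalIntegral.integral_hasDerivAt_right (hc.neg.intervalIntegrable _ _)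
      (hc.neg.stronglyMeasurableAtFilter _ _) hc.neg.continuousAt
  rw [max_eq_left hy] at h1
  have heq : ∀ x ∈ Ici (0:ℝ), calVy f x = ∫ t in (0:ℝ)..x, -tailInt f (max t 0) := by
    intro x hx
    refine intervalIntegral.integral_congr fun t ht => ?_
    rw [uIcc_of_le hx] at ht
    simp only [max_eq_left ht.1]; rfl
  exact h1.hasDerivWithinAt.congr heq (heq y hy)

lemma continuousOn_calVy (hf : IntegrableOn f (Ioi 0)) : ContinuousOn (calVy f) (Ici 0) :=
  fun _ hy => (hasDerivWithinAt_calVy hf hy).continuousWithinAt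

@[simp] lemma calVy_zero (f : ℝ → ℂ) : calVy f 0 = 0 := by simp [calVy]

lemma tailInt_add (hf : IntegrableOn f (Ioi 0)) (hg : IntegrableOn g (Ioi 0)) {y : ℝ}
    (hy : 0 ≤ y) : tailInt (fun y => f y + g y) y = tailInt f y + tailInt g y :=
  integral_add (hf.mono_set (Ioi_subset_Ioi hy)) (hg.mono_set (Ioi_subset_Ioi hy))

lemma intervalIntegrable_tailInt (hf : IntegrableOn f (Ioi 0)) {y : ℝ} (hy : 0 ≤ y) :
    IntervalIntegrable (fun t => -tailInt f t) volume 0 y :=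
  ((continuousOn_tailInt hf).neg.mono
    (by rw [uIcc_of_le hy]; exact Icc_subset_Ici_self)).intervalIntegrable

lemma calVy_add (hf : IntegrableOn f (Ioi 0)) (hg : IntegrableOn g (Ioi 0)) {y : ℝ}
    (hy : 0 ≤ y) : calVy (fun y => f y + g y) y = calVy f y + calVy g y := by
  rw [calVy_eq, calVy_eq, calVy_eq, ← intervalIntegral.integral_add
    (intervalIntegrable_tailInt hf hy) (intervalIntegrable_tailInt hg hy)]
  refine intervalIntegral.integral_congr fun t ht => ?_
  rw [uIcc_of_le hy] at ht
  simp only [tailInt_add hf hg ht.1]; ring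

lemma calVy_const_mul (f : ℝ → ℂ) (a : ℂ) (y : ℝ) :
    calVy (fun y => a * f y) y = a * calVy f y := by
  rw [calVy, calVy, ← intervalIntegral.integral_const_mul]
  congr 1; funext t
  rw [integral_const_mul]; ring

lemma calVy_congr (h : EqOn f g (Ioi 0)) {y : ℝ} (hy : 0 ≤ y) : calVy f y = calVy g y := by
  refine intervalIntegral.integral_congr fun t ht => ?_
  rw [uIcc_of_le hy] at ht
  rw [setIntegral_congr_fun measurableSet_Ioi (h.mono (Ioi_subset_Ioi ht.1))]

lemma norm_calVy_le_of_tail {T : ℝ → ℝ} {B : ℝ} (hT : IntegrableOn T (Ioi 0))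
    (hT0 : ∀ y, 0 < y → 0 ≤ T y) (hTB : ∫ y in Ioi 0, T y ≤ B)
    (h : ∀ y, 0 < y → ‖tailInt f y‖ ≤ T y) {y : ℝ} (hy : 0 ≤ y) : ‖calVy f y‖ ≤ B := by
  rw [calVy_eq, intervalIntegral.integral_of_le hy]
  refine (norm_integral_le_of_norm_le (hT.mono_set Ioc_subset_Ioi_self) ?_).trans
    ((setIntegral_mono_set hT ?_ Ioc_subset_Ioi_self.eventuallyLE).trans hTB)
  · filter_upwards [ae_restrict_mem measurableSet_Ioc] with t ht
    rw [norm_neg]; exact h t ht.1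
  · filter_upwards [ae_restrict_mem measurableSet_Ioi] with t ht using hT0 t ht

lemma norm_calVy_le (hf : WeightedL2 f) {N : ℝ} (hN : 0 ≤ N) (hfN : wsq f ≤ N ^ 2) {y : ℝ}
    (hy : 0 ≤ y) : ‖calVy f y‖ ≤ N :=
  norm_calVy_le_of_tail (integrableOn_inv_one_add_sq.const_mul N) (fun y _ => by positivity)
    (by rw [integral_const_mul, integral_inv_one_add_sq, mul_one])
    (fun y hy => (norm_integral_le_integral_norm _).trans (hf.tail hN hfN hy.le).2) hy

/-! ### First-order solution operators on the weighted space -/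

variable {q : ℝ → ℂ} {c : ℝ}

lemma integrableOn_exp_neg_mul_sub (hc : 0 < c) (y : ℝ) :
    IntegrableOn (fun z => Real.exp (-(c * (z - y)))) (Ioi y) := by
  have h := (exp_neg_integrableOn_Ioi y hc).const_mul (Real.exp (c * y))
  refine h.congr (Eventually.of_forall fun z => ?_)
  simp only [← Real.exp_add]; ring_nf

lemma integral_exp_neg_mul_sub (hc : 0 < c) (y : ℝ) :
    ∫ z in Ioi y, Real.exp (-(c * (z - y))) = 1 / c := by
  have h1 : ∀ z, Real.exp (-(c * (z - y))) = Real.exp (c * y) * Real.exp (-c * z) := by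
    intro z; rw [← Real.exp_add]; ring_nf
  simp_rw [h1]
  rw [integral_const_mul, integral_exp_mul_Ioi (by linarith)]
  rw [neg_div_neg_eq, ← mul_div_assoc, ← Real.exp_add]
  simp

/-- Restriction to the open half line. -/
def restr (w : ℝ → ℂ) : ℝ → ℂ := indicator (Ioi 0) w

lemma WeightedL2.integrableOn_sq {w : ℝ → ℂ} (hw : WeightedL2 w) :
    IntegrableOn (fun y => ‖w y‖ ^ 2) (Ioi 0) := by
  refine hw.integrableOn.mono' (hw.aestronglyMeasurable.norm.pow 2) ?_
  filter_upwards [ae_restrict_mem measurableSet_Ioi] with y hy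
  have : (0:ℝ) < y := hy
  rw [Real.norm_of_nonneg (by positivity)]
  exact le_mul_of_one_le_left (by positivity) (one_le_pow₀ (by linarith))

lemma WeightedL2.integrable_mul_intFac_inv (hq : Continuous q) (hc : ∀ y, c ≤ (q y).re)
    (hc0 : 0 < c) {w : ℝ → ℂ} (hw : WeightedL2 w) (y : ℝ) :
    IntegrableOn (fun z => restr w z * (intFac q z)⁻¹) (Ioi y) := by
  have h1 : IntegrableOn (fun z => w z * (intFac q z)⁻¹) (Ioi 0) := by
    refine hw.integrableOn_Ioi.norm.mono' (hw.aestronglyMeasurable.mul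
      (continuous_intFac_inv hq).aestronglyMeasurable) ?_
    filter_upwards [ae_restrict_mem measurableSet_Ioi] with z hz
    have hz' : (0:ℝ) < z := hz
    rw [norm_mul]
    refine mul_le_of_le_one_right (norm_nonneg _) ((norm_intFac_inv_le hq hc hz'.le).trans ?_)
    rw [Real.exp_le_one_iff]
    have : 0 < c * z := by positivity
    linarith
  have h2 : (fun z => restr w z * (intFac q z)⁻¹) =
      indicator (Ioi 0) fun z => w z * (intFac q z)⁻¹ := by
    funext z; simp only [restr, indicator]; split_ifs <;> simp
  rw [h2]
  exact ((integrable_indicator_iff measurableSet_Ioi).2 h1).integrableOn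

/-- Cauchy-Schwarz against the kernel `exp(-c(z - y))`, of total mass `1/c`. -/
lemma WeightedL2.norm_backSol_sq_le (hq : Continuous q) (hc : ∀ y, c ≤ (q y).re)
    (hc0 : 0 < c) {w : ℝ → ℂ} (hw : WeightedL2 w) {y : ℝ} (hy : 0 ≤ y) :
    ‖backSol q (restr w) y‖ ^ 2 ≤
      1 / c * ∫ z in Ioi y, Real.exp (-(c * (z - y))) * ‖w z‖ ^ 2 := by
  have hsub : Ioi y ⊆ Ioi (0:ℝ) := Ioi_subset_Ioi hy
  have hexp : ∀ z ∈ Ioi y, Real.exp (-(c * (z - y))) ≤ 1 := by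
    intro z hz
    rw [Real.exp_le_one_iff, neg_nonpos]
    exact mul_nonneg hc0.le (sub_nonneg.2 (le_of_lt hz))
  have hm : AEStronglyMeasurable w (volume.restrict (Ioi y)) :=
    hw.aestronglyMeasurable.mono_measure (Measure.restrict_mono hsub le_rfl)
  have hec : Continuous fun z => Real.exp (-(c * (z - y))) := by fun_prop
  have h2 : IntegrableOn (fun z => Real.exp (-(c * (z - y))) * ‖w z‖ ^ 2) (Ioi y) := by
    refine (hw.integrableOn_sq.mono_set hsub).mono' (hec.aestronglyMeasurable.mul (hm.norm.pow 2)) ?_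
    filter_upwards [ae_restrict_mem measurableSet_Ioi] with z hz
    rw [Real.norm_of_nonneg (by positivity)]
    exact mul_le_of_le_one_left (by positivity) (hexp z hz)
  have hcs := sq_integral_mul_norm_le (ν := volume.restrict (Ioi y))
    (ρ := fun z => Real.exp (-(c * (z - y)))) (w := fun z => ‖w z‖)
    (Eventually.of_forall fun z => (Real.exp_pos _).le) (integrableOn_exp_neg_mul_sub hc0 y)
    hm.norm h2
  rw [integral_exp_neg_mul_sub hc0] at hcs
  refine le_trans ?_ hcs.2
  have h3 := norm_backSol_le (s := restr w) (F := fun z => ‖w z‖) hq hc hcs.1 (by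
    filter_upwards [ae_restrict_mem measurableSet_Ioi] with z hz
    rw [restr, indicator_of_mem (hsub hz)])
  gcongr

/-- The `L^1` bound for the exponentially weighted tail. -/
lemma integral_expTail_le (hc0 : 0 < c) {F : ℝ → ℝ} (hF : IntegrableOn F (Ioi 0))
    (hF0 : ∀ y, 0 < y → 0 ≤ F y) :
    ∃ u : ℝ → ℝ, (∀ y, 0 ≤ y → u y = ∫ z in Ioi y, Real.exp (-(c * (z - y))) * F z) ∧
      ContinuousOn u (Ici 0) ∧ ∀ Y, 0 ≤ Y → ∫ y in (0:ℝ)..Y, u y ≤ 1 / c * ∫ y in Ioi 0, F y := by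
  -- The exponential tail `u` of `F` is the decaying solution of `u' = c u - F`, that is, `backSol`
  -- with a constant coefficient.
  set q : ℝ → ℂ := fun _ => (c : ℂ)
  have hq : Continuous q := continuous_const
  have hint : ∀ y : ℝ, intFac q y = Complex.exp ((c * y : ℝ) : ℂ) := by
    intro y; simp [intFac, q, mul_comm]
  have hinv : ∀ y : ℝ, (intFac q y)⁻¹ = ((Real.exp (-(c * y)) : ℝ) : ℂ) := by
    intro y; rw [hint, ← Complex.exp_neg]; push_cast; rfl
  set s : ℝ → ℂ := indicator (Ioi 0) fun z => (F z : ℂ)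
  have hs : Integrable s := (integrable_indicator_iff measurableSet_Ioi).2 hF.ofReal
  have hs' : ∀ y, IntegrableOn (fun z => s z * (intFac q z)⁻¹) (Ioi y) := by
    intro y
    have : Integrable (fun z => s z * (intFac q z)⁻¹) := by
      refine hs.norm.mono' (hs.1.mul (continuous_intFac_inv hq).aestronglyMeasurable)
        (Eventually.of_forall fun z => ?_)
      rw [norm_mul]
      by_cases hz : z ∈ Ioi (0:ℝ)
      · refine mul_le_of_le_one_right (norm_nonneg _) ?_
        rw [hinv, Complex.norm_real, Real.norm_of_nonneg (Real.exp_pos _).le, Real.exp_le_one_iff,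
          neg_nonpos]
        exact mul_nonneg hc0.le (le_of_lt hz)
      · simp [s, indicator_of_notMem hz]
    exact this.integrableOn
  have hcont := continuous_backSol hq hs'
  have hval : ∀ y, 0 ≤ y → backSol q s y =
      ((∫ z in Ioi y, Real.exp (-(c * (z - y))) * F z : ℝ) : ℂ) := by
    intro y hy
    rw [backSol, ← integral_const_mul, ← integral_complex_ofReal]
    refine setIntegral_congr_fun measurableSet_Ioi fun z hz => ?_
    have hz' : z ∈ Ioi (0:ℝ) := mem_Ioi.2 (hy.trans_lt hz)
    simp only [s, indicator_of_mem hz', hinv]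
    rw [hint, ← Complex.ofReal_exp, mul_left_comm, ← Complex.ofReal_mul, ← Real.exp_add,
      ← Complex.ofReal_mul]
    ring_nf
  refine ⟨fun y => (backSol q s y).re, fun y hy => by simp only [hval y hy, Complex.ofReal_re],
    (Complex.continuous_re.comp hcont).continuousOn, fun Y hY => ?_⟩
  -- Integrating the equation gives `c ∫_0^Y u = u(Y) - u(0) + ∫_0^Y F`; here `u(0) ≥ 0` and `u(Y)`
  -- is at most the tail of `F` beyond `Y`, so no interchange of integrals is needed.
  have h1 := congrArg Complex.re (backSol_eq_integral hq hs' Y)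
  have hi1 : IntervalIntegrable (backSol q s) volume 0 Y := hcont.intervalIntegrable _ _
  have hi2 : IntervalIntegrable s volume 0 Y := hs.intervalIntegrable
  have hre : (∫ t in (0:ℝ)..Y, backSol q s t).re = ∫ t in (0:ℝ)..Y, (backSol q s t).re := by
    simpa using (Complex.reCLM.intervalIntegral_comp_comm hi1).symm
  have hre2 : ∫ t in (0:ℝ)..Y, s t = ((∫ t in (0:ℝ)..Y, F t : ℝ) : ℂ) := by
    rw [← intervalIntegral.integral_ofReal]
    refine intervalIntegral.integral_congr_ae (Eventually.of_forall fun z hz => ?_)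
    rw [uIoc_of_le hY] at hz
    exact indicator_of_mem (mem_Ioi.2 hz.1) _
  have hqe : ∀ t, q t * backSol q s t - s t = (c : ℂ) * backSol q s t - s t := fun t => rfl
  simp only [hqe] at h1
  rw [intervalIntegral.integral_sub (hi1.const_mul _) hi2, intervalIntegral.integral_const_mul,
    hre2, Complex.add_re, Complex.sub_re, Complex.re_ofReal_mul, hre, Complex.ofReal_re] at h1
  have h0 : 0 ≤ (backSol q s 0).re := by
    rw [hval 0 le_rfl, Complex.ofReal_re]
    exact setIntegral_nonneg measurableSet_Ioi fun z hz =>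
      mul_nonneg (Real.exp_pos _).le (hF0 z hz)
  have hY' : (backSol q s Y).re ≤ ∫ z in Ioi Y, F z := by
    rw [hval Y hY, Complex.ofReal_re]
    refine integral_mono_of_nonneg ?_ (hF.mono_set (Ioi_subset_Ioi hY)) ?_
    · filter_upwards [ae_restrict_mem measurableSet_Ioi] with z hz
      exact mul_nonneg (Real.exp_pos _).le (hF0 z (hY.trans_lt hz))
    · filter_upwards [ae_restrict_mem measurableSet_Ioi] with z hz
      refine mul_le_of_le_one_left (hF0 z (hY.trans_lt hz)) ?_
      rw [Real.exp_le_one_iff, neg_nonpos]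
      exact mul_nonneg hc0.le (sub_nonneg.2 (le_of_lt hz))
  have hsplit := intervalIntegral.integral_Ioi_sub_Ioi' hF (hF.mono_set (Ioi_subset_Ioi hY))
  rw [one_div, inv_mul_eq_div, le_div_iff₀ hc0]
  linarith

/-- The decaying first order solution operator is bounded on the weighted space. -/
lemma WeightedL2.backSol (hq : Continuous q) (hc : ∀ y, c ≤ (q y).re)
    (hc0 : 0 < c) {w : ℝ → ℂ} (hw : WeightedL2 w) :
    WeightedL2 (backSol q (restr w)) ∧ wsq (backSol q (restr w)) ≤ 1 / c ^ 2 * wsq w := by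
  obtain ⟨u, hu, huc, huI⟩ := integral_expTail_le hc0 hw.integrableOn (fun y hy => by positivity)
  have hgc := continuous_backSol hq (hw.integrable_mul_intFac_inv hq hc hc0)
  have hb : ∀ y, 0 ≤ y → (1 + y) ^ 6 * ‖TripleDeck.backSol q (restr w) y‖ ^ 2 ≤ 1 / c * u y := by
    intro y hy
    have h1 := hw.norm_backSol_sq_le hq hc hc0 hy
    -- The weight is increasing and the kernel only looks to the right, so the weight may be moved
    -- under the integral.
    have h2 : (1 + y) ^ 6 * ∫ z in Ioi y, Real.exp (-(c * (z - y))) * ‖w z‖ ^ 2 ≤ u y := by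
      rw [hu y hy, ← integral_const_mul]
      refine integral_mono_of_nonneg (Eventually.of_forall fun z => by simp only [Pi.zero_apply]; positivity) ?_ ?_
      · refine (hw.integrableOn.mono_set (Ioi_subset_Ioi hy)).mono'
          ((by fun_prop : Continuous fun z => Real.exp (-(c * (z - y)))).aestronglyMeasurable.mul
          (hw.integrableOn.mono_set (Ioi_subset_Ioi hy)).1) ?_
        filter_upwards [ae_restrict_mem measurableSet_Ioi] with z hz
        have hz0 : 0 < z := hy.trans_lt hz
        rw [Real.norm_of_nonneg (by positivity)]
        refine mul_le_of_le_one_left (by positivity) ?_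
        rw [Real.exp_le_one_iff, neg_nonpos]
        exact mul_nonneg hc0.le (sub_nonneg.2 (le_of_lt hz))
      · filter_upwards [ae_restrict_mem measurableSet_Ioi] with z hz
        have hz' : y < z := hz
        have : (1 + y) ^ 6 ≤ (1 + z) ^ 6 := by gcongr
        rw [mul_left_comm]
        gcongr
    calc _ ≤ (1 + y) ^ 6 * (1 / c * ∫ z in Ioi y, Real.exp (-(c * (z - y))) * ‖w z‖ ^ 2) := by
          gcongr
      _ = 1 / c * ((1 + y) ^ 6 * ∫ z in Ioi y, Real.exp (-(c * (z - y))) * ‖w z‖ ^ 2) := by ring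
      _ ≤ _ := by gcongr
  have hP : Continuous fun y => (1 + y) ^ 6 * ‖TripleDeck.backSol q (restr w) y‖ ^ 2 := by fun_prop
  have := integrableOn_Ioi_of_bounded (B := 1 / c ^ 2 * wsq w) hP.continuousOn
    (fun y hy => by positivity) (fun Y hY => by
      have hi : IntervalIntegrable u volume 0 Y :=
        (huc.mono (by rw [uIcc_of_le hY]; exact Icc_subset_Ici_self)).intervalIntegrable
      refine (intervalIntegral.integral_mono_on hY (hP.intervalIntegrable _ _)
        (hi.const_mul (1 / c)) fun y hy => hb y hy.1).trans ?_
      rw [intervalIntegral.integral_const_mul]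
      calc _ ≤ 1 / c * (1 / c * ∫ y in Ioi 0, (1 + y) ^ 6 * ‖w y‖ ^ 2) := by
            gcongr; exact huI Y hY
        _ = _ := by rw [wsq]; ring)
  exact ⟨weightedL2_iff.2 ⟨hgc.aestronglyMeasurable, this.1⟩, this.2⟩

lemma hasDerivAt_norm_sq {f : ℝ → ℂ} {f' : ℂ} {y : ℝ} (h : HasDerivAt f f' y) :
    HasDerivAt (fun y => ‖f y‖ ^ 2) (2 * (f' * (starRingEnd ℂ) (f y)).re) y := by
  have h1 := h.norm_sq
  convert! h1 using 1

lemma hasDerivWithinAt_norm_sq {f : ℝ → ℂ} {f' : ℂ} {s : Set ℝ} {y : ℝ}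
    (h : HasDerivWithinAt f f' s y) :
    HasDerivWithinAt (fun y => ‖f y‖ ^ 2) (2 * (f' * (starRingEnd ℂ) (f y)).re) s y := by
  have h1 := h.norm_sq
  convert! h1 using 1

/-- The forward first order solution operator is bounded on the weighted space. -/
lemma WeightedL2.fwdSol (hq : Continuous q) (hc : ∀ y, c ≤ (q y).re)
    (hc0 : 12 ≤ c) {g : ℝ → ℂ} (hg : Continuous g) (hgw : WeightedL2 g) (a : ℂ) :
    WeightedL2 (fwdSol q g a) ∧
      wsq (fwdSol q g a) ≤ 1 / c * ‖a‖ ^ 2 + 2 / c ^ 2 * wsq g := by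
  set f := TripleDeck.fwdSol q g a with hf
  have hd : ∀ y, HasDerivAt f (g y - q y * f y) y := fun y => hasDerivAt_fwdSol hq hg a y
  have hfc : Continuous f := continuous_iff_continuousAt.2 fun y => (hd y).continuousAt
  have hP : Continuous fun y => (1 + y) ^ 6 * ‖f y‖ ^ 2 := by fun_prop
  have hG : Continuous fun y => (1 + y) ^ 6 * ‖g y‖ ^ 2 := by fun_prop
  -- Integrated form of the energy inequality for `(1 + Y)^6 |f|²`; bounds at a finite `Y` avoid
  -- assuming integrability of `f`.
  have hmono : MonotoneOn (fun Y => 2 / c * (∫ y in (0:ℝ)..Y, (1 + y) ^ 6 * ‖g y‖ ^ 2) -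
      (1 + Y) ^ 6 * ‖f Y‖ ^ 2 - c * ∫ y in (0:ℝ)..Y, (1 + y) ^ 6 * ‖f y‖ ^ 2) (Ici 0) := by
    have hder : ∀ y, HasDerivAt (fun Y => 2 / c * (∫ y in (0:ℝ)..Y, (1 + y) ^ 6 * ‖g y‖ ^ 2) -
      (1 + Y) ^ 6 * ‖f Y‖ ^ 2 - c * ∫ y in (0:ℝ)..Y, (1 + y) ^ 6 * ‖f y‖ ^ 2)
      (2 / c * ((1 + y) ^ 6 * ‖g y‖ ^ 2) - (6 * (1 + y) ^ 5 * ‖f y‖ ^ 2 + (1 + y) ^ 6 *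
        (2 * ((g y - q y * f y) * (starRingEnd ℂ) (f y)).re)) -
        c * ((1 + y) ^ 6 * ‖f y‖ ^ 2)) y := by
      intro y
      have hp : HasDerivAt (fun y : ℝ => (1 + y) ^ 6) (6 * (1 + y) ^ 5) y := by
        convert! ((hasDerivAt_id y).const_add 1).pow 6 using 1; simp
      refine (((intervalIntegral.integral_hasDerivAt_right (hG.intervalIntegrable _ _)
        (hG.stronglyMeasurableAtFilter _ _) hG.continuousAt).const_mul (2 / c)).sub
        (hp.mul (hasDerivAt_norm_sq (hd y)))).sub
        ((intervalIntegral.integral_hasDerivAt_right (hP.intervalIntegrable _ _)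
        (hP.stronglyMeasurableAtFilter _ _) hP.continuousAt).const_mul c)
    refine monotoneOn_of_hasDerivWithinAt_nonneg (convex_Ici 0)
      (fun y _ => (hder y).continuousAt.continuousWithinAt)
      (fun y _ => (hder y).hasDerivWithinAt) fun y hy => ?_
    have hy0 : 0 < y := by simpa using hy
    have h1 : ((g y - q y * f y) * (starRingEnd ℂ) (f y)).re ≤
        ‖g y‖ * ‖f y‖ - c * ‖f y‖ ^ 2 := by
      rw [sub_mul, Complex.sub_re, mul_assoc, Complex.mul_conj, Complex.re_mul_ofReal,
        Complex.normSq_eq_norm_sq]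
      have h2 := Complex.re_le_norm (g y * (starRingEnd ℂ) (f y))
      rw [norm_mul, Complex.norm_conj] at h2
      have := mul_le_mul_of_nonneg_right (hc y) (sq_nonneg ‖f y‖)
      linarith
    have h2 : 2 * (‖g y‖ * ‖f y‖) ≤ 2 / c * ‖g y‖ ^ 2 + c / 2 * ‖f y‖ ^ 2 := by
      have h3 : 0 ≤ (2 / c) * (‖g y‖ - c / 2 * ‖f y‖) ^ 2 := by positivity
      have h4 : (2 / c) * (‖g y‖ - c / 2 * ‖f y‖) ^ 2 = 2 / c * ‖g y‖ ^ 2 + c / 2 * ‖f y‖ ^ 2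
        - 2 * (‖g y‖ * ‖f y‖) := by field_simp; ring
      linarith
    have h5 : 6 * (1 + y) ^ 5 * ‖f y‖ ^ 2 ≤ (1 + y) ^ 6 * (6 * ‖f y‖ ^ 2) := by
      have : (1 + y) ^ 5 ≤ (1 + y) ^ 6 := pow_le_pow_right₀ (by linarith) (by norm_num)
      nlinarith [sq_nonneg ‖f y‖]
    -- The damping supplies `2c|f|²`: of it `c` is kept, `c/2` absorbs the source and `6` the
    -- derivative of the weight. This is where `c ≥ 12` is needed.
    have h6 : 0 ≤ (1 + y) ^ 6 * (2 / c * ‖g y‖ ^ 2 - 6 * ‖f y‖ ^ 2 -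
        2 * ((g y - q y * f y) * (starRingEnd ℂ) (f y)).re - c * ‖f y‖ ^ 2) := by
      refine mul_nonneg (by positivity) ?_
      nlinarith [sq_nonneg ‖f y‖]
    linarith
  have hbd : ∀ Y, 0 ≤ Y → ∫ y in (0:ℝ)..Y, (1 + y) ^ 6 * ‖f y‖ ^ 2 ≤
      1 / c * ‖a‖ ^ 2 + 2 / c ^ 2 * wsq g := by
    intro Y hY
    have h1 := hmono (mem_Ici.2 le_rfl) (mem_Ici.2 hY) hY
    have h2 : ∫ y in (0:ℝ)..Y, (1 + y) ^ 6 * ‖g y‖ ^ 2 ≤ wsq g := by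
      rw [intervalIntegral.integral_of_le hY]
      refine setIntegral_mono_set hgw.integrableOn ?_ Ioc_subset_Ioi_self.eventuallyLE
      filter_upwards [ae_restrict_mem measurableSet_Ioi] with z hz
      have : (0:ℝ) < z := hz
      simp only [Pi.zero_apply]; positivity
    have h0 : f 0 = a := fwdSol_zero a
    simp [h0] at h1
    have h3 : 0 ≤ (1 + Y) ^ 6 * ‖f Y‖ ^ 2 := by positivity
    have h4 : 2 / c * ∫ y in (0:ℝ)..Y, (1 + y) ^ 6 * ‖g y‖ ^ 2 ≤ 2 / c * wsq g := by gcongr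
    have h5 : c * ∫ y in (0:ℝ)..Y, (1 + y) ^ 6 * ‖f y‖ ^ 2 ≤ ‖a‖ ^ 2 + 2 / c * wsq g := by linarith
    calc _ = 1 / c * (c * ∫ y in (0:ℝ)..Y, (1 + y) ^ 6 * ‖f y‖ ^ 2) := by field_simp
      _ ≤ 1 / c * (‖a‖ ^ 2 + 2 / c * wsq g) := by gcongr
      _ = _ := by field_simp
  have := integrableOn_Ioi_of_bounded hP.continuousOn (fun y hy => by positivity) hbd
  exact ⟨weightedL2_iff.2 ⟨hfc.aestronglyMeasurable, this.1⟩, this.2⟩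

/-! ### Pointwise decay -/

/-- A bound `B` that varies at exponential rate at most `κ` leaves the kernel `exp(-(c - κ)(z -
y))`, of mass `1/(c - κ) ≤ 1`. -/
lemma norm_backSol_le_of_decay (hq : Continuous q) (hc : ∀ y, c ≤ (q y).re) {κ : ℝ}
    (hcκ : κ + 1 ≤ c) {B : ℝ → ℝ} (hB : ∀ x y, 0 ≤ x → 0 ≤ y → B x ≤ B y * Real.exp (κ * |x - y|))
    (hB0 : ∀ y, 0 ≤ y → 0 ≤ B y) {s : ℝ → ℂ} (hs : ∀ z, 0 < z → ‖s z‖ ≤ B z) {y : ℝ} (hy : 0 ≤ y) :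
    ‖backSol q (restr s) y‖ ≤ B y := by
  have hcκ' : 0 < c - κ := by linarith
  have heq : ∀ z ∈ Ioi y, B y * Real.exp (-((c - κ) * (z - y))) =
      Real.exp (-(c * (z - y))) * (B y * Real.exp (κ * (z - y))) := by
    intro z hz
    rw [mul_left_comm, ← Real.exp_add]; ring_nf
  have hi := ((integrableOn_exp_neg_mul_sub hcκ' y).const_mul (B y))
  refine (norm_backSol_le hq hc (F := fun z => B y * Real.exp (κ * (z - y)))
    ((integrableOn_congr_fun heq measurableSet_Ioi).1 hi) ?_).trans ?_
  · filter_upwards [ae_restrict_mem measurableSet_Ioi] with z hz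
    have hz0 : 0 < z := hy.trans_lt hz
    rw [restr, indicator_of_mem (mem_Ioi.2 hz0)]
    have := hB z y hz0.le hy
    rw [abs_of_pos (sub_pos.2 hz)] at this
    exact (hs z hz0).trans this
  · rw [← setIntegral_congr_fun measurableSet_Ioi heq, integral_const_mul,
      integral_exp_neg_mul_sub hcκ']
    refine mul_le_of_le_one_right (hB0 y hy) ?_
    rw [div_le_one hcκ']; linarith

/-- The initial value and the source each contribute at most `B y`, since the kernel outruns the
variation of `B`. -/
lemma norm_fwdSol_le_of_decay (hq : Continuous q) (hc : ∀ y, c ≤ (q y).re) {κ : ℝ}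
    (hcκ : κ + 1 ≤ c) {B : ℝ → ℝ} (hB : ∀ x y, 0 ≤ x → 0 ≤ y → B x ≤ B y * Real.exp (κ * |x - y|))
    (hB0 : ∀ y, 0 ≤ y → 0 ≤ B y) {g : ℝ → ℂ}
    (hgB : ∀ z, 0 ≤ z → ‖g z‖ ≤ B z) {a : ℂ} (ha : ‖a‖ ≤ B 0) {y : ℝ} (hy : 0 ≤ y) :
    ‖fwdSol q g a y‖ ≤ 2 * B y := by
  have hcκ' : 0 < c - κ := by linarith
  have h1 : ‖(intFac q y)⁻¹ * a‖ ≤ B y := by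
    rw [norm_mul]
    calc _ ≤ Real.exp (-(c * y)) * (B y * Real.exp (κ * |0 - y|)) :=
          mul_le_mul (norm_intFac_inv_le hq hc hy) (ha.trans (hB 0 y le_rfl hy)) (norm_nonneg _)
            (Real.exp_pos _).le
      _ = B y * Real.exp (-((c - κ) * y)) := by
          rw [zero_sub, abs_neg, abs_of_nonneg hy, mul_left_comm, ← Real.exp_add]; ring_nf
      _ ≤ B y := by
          refine mul_le_of_le_one_right (hB0 y hy) ?_
          rw [Real.exp_le_one_iff, neg_nonpos]; positivity
  have h2 : ‖(intFac q y)⁻¹ * ∫ t in (0:ℝ)..y, intFac q t * g t‖ ≤ B y := by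
    rw [← intervalIntegral.integral_const_mul]
    have hder : ∀ t, HasDerivAt (fun t => B y * (1 / (c - κ) * Real.exp ((c - κ) * (t - y))))
        (B y * Real.exp ((c - κ) * (t - y))) t := by
      intro t
      convert! (((((hasDerivAt_id t).sub_const y).const_mul (c - κ)).exp).const_mul
        (1 / (c - κ))).const_mul (B y) using 1
      simp only [id]
      field_simp
    have hcont : Continuous fun t => B y * Real.exp ((c - κ) * (t - y)) := by fun_prop
    refine (intervalIntegral.norm_integral_le_of_norm_le hy ?_ (hcont.intervalIntegrable 0 y)).trans
      ?_
    · refine Eventually.of_forall fun t ht => ?_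
      rw [← mul_assoc, norm_mul, mul_comm (intFac q y)⁻¹]
      have h3 := norm_intFac_mul_inv_le hq hc ht.2
      have h4 := (hgB t ht.1.le).trans (hB t y ht.1.le hy)
      rw [abs_sub_comm, abs_of_nonneg (sub_nonneg.2 ht.2)] at h4
      refine (mul_le_mul h3 h4 (norm_nonneg _) (Real.exp_pos _).le).trans (le_of_eq ?_)
      rw [mul_left_comm, ← Real.exp_add]; ring_nf
    · rw [intervalIntegral.integral_eq_sub_of_hasDerivAt (fun t _ => hder t)
        (hcont.intervalIntegrable 0 y)]
      have h5 : 0 ≤ B y * (1 / (c - κ) * Real.exp ((c - κ) * (0 - y))) :=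
        mul_nonneg (hB0 y hy) (by positivity)
      have h6 : B y * (1 / (c - κ) * Real.exp ((c - κ) * (y - y))) ≤ B y := by
        refine mul_le_of_le_one_right (hB0 y hy) ?_
        rw [sub_self, mul_zero, Real.exp_zero, mul_one, div_le_one hcκ']; linarith
      linarith
  rw [fwdSol, mul_add]
  exact (norm_add_le _ _).trans (by linarith)

/-! ### Strong solutions and uniqueness for the local equation -/

section TwoDerivs

variable {f f1 f2 g g1 g2 : ℝ → ℂ}

lemma HasTwoDerivs.add (hf : HasTwoDerivs f f1 f2) (hg : HasTwoDerivs g g1 g2) :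
    HasTwoDerivs (fun y => f y + g y) (fun y => f1 y + g1 y) (fun y => f2 y + g2 y) where
  first y hy := (hf.first y hy).add (hg.first y hy)
  integrable y hy := (hf.integrable y hy).add (hg.integrable y hy)
  second y hy := by
    rw [intervalIntegral.integral_add (hf.integrable y hy) (hg.integrable y hy), hf.second y hy,
      hg.second y hy]
    ring

lemma HasTwoDerivs.const_mul (hf : HasTwoDerivs f f1 f2) (a : ℂ) :
    HasTwoDerivs (fun y => a * f y) (fun y => a * f1 y) (fun y => a * f2 y) where
  first y hy := (hf.first y hy).const_mul a
  integrable y hy := (hf.integrable y hy).const_mul a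
  second y hy := by rw [intervalIntegral.integral_const_mul, hf.second y hy]; ring

lemma HasTwoDerivs.congr_ae (hf : HasTwoDerivs f f1 f2)
    (h : ∀ᵐ y ∂volume.restrict (Ioi 0), f2 y = g2 y) : HasTwoDerivs f f1 g2 := by
  have h' : ∀ y : ℝ, 0 ≤ y → ∀ᵐ t, t ∈ uIoc 0 y → f2 t = g2 t := by
    intro y hy
    filter_upwards [(ae_restrict_iff' measurableSet_Ioi).1 h] with t ht hty
    rw [uIoc_of_le hy] at hty
    exact ht hty.1
  refine ⟨hf.first, fun y hy => ?_, fun y hy => ?_⟩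
  · exact (hf.integrable y hy).congr_ae ((ae_restrict_iff' measurableSet_uIoc).2 (h' y hy))
  · rw [← intervalIntegral.integral_congr_ae (h' y hy)]
    exact hf.second y hy

lemma HasTwoDerivs.continuousOn (hf : HasTwoDerivs f f1 f2) : ContinuousOn f (Ici 0) :=
  fun y hy => (hf.first y hy).continuousWithinAt

lemma HasTwoDerivs.hasDerivWithinAt (hf : HasTwoDerivs f f1 f2) (h2 : ContinuousOn f2 (Ici 0))
    {y : ℝ} (hy : 0 ≤ y) : HasDerivWithinAt f1 (f2 y) (Ici 0) y := by
  have hc := ContinuousOn.comp_max_zero h2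
  have h1 := (intervalIntegral.integral_hasDerivAt_right (hc.intervalIntegrable 0 y)
    (hc.stronglyMeasurableAtFilter _ _) hc.continuousAt).const_add (f1 0)
  rw [max_eq_left hy] at h1
  have heq : ∀ x ∈ Ici (0:ℝ), f1 x = f1 0 + ∫ t in (0:ℝ)..x, f2 (max t 0) := by
    intro x hx
    rw [hf.second x hx]
    congr 1
    refine intervalIntegral.integral_congr fun t ht => ?_
    rw [uIcc_of_le hx] at ht
    simp only [max_eq_left ht.1]
  exact h1.hasDerivWithinAt.congr heq (heq y hy)

end TwoDerivs

/-- Square integrable solutions of `f'' = z f` with `Re z ≥ 0` vanish if `Re (f' \bar f)` vanishes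
at the origin, since `|f|^2` is convex. -/
lemma HasTwoDerivs.eq_zero {z f f1 : ℝ → ℂ} (hz : Continuous z) (hz0 : ∀ y, 0 ≤ (z y).re)
    (hf : HasTwoDerivs f f1 fun y => z y * f y)
    (hint : IntegrableOn (fun y => ‖f y‖ ^ 2) (Ioi 0))
    (h0 : (f1 0 * (starRingEnd ℂ) (f 0)).re = 0) {y : ℝ} (hy : 0 ≤ y) : f y = 0 := by
  have h2 := fun {y : ℝ} (hy : 0 ≤ y) =>
    hf.hasDerivWithinAt (hz.continuousOn.mul hf.continuousOn) hy
  have hm : MonotoneOn (fun y => (f1 y * (starRingEnd ℂ) (f y)).re) (Ici 0) := by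
    have hd : ∀ y ∈ Ici (0:ℝ), HasDerivWithinAt (fun y => (f1 y * (starRingEnd ℂ) (f y)).re)
        (z y * f y * (starRingEnd ℂ) (f y) + f1 y * (starRingEnd ℂ) (f1 y)).re (Ici 0) y := by
      intro y hy
      have := (h2 hy).mul (hf.first y hy).star
      exact (Complex.reCLM.hasFDerivAt.comp_hasDerivWithinAt y this)
    refine monotoneOn_of_hasDerivWithinAt_nonneg (convex_Ici 0)
      (fun y hy => (hd y hy).continuousWithinAt)
      (fun y hy => (hd y (interior_subset hy)).mono interior_subset) fun y hy => ?_
    rw [mul_assoc, Complex.mul_conj, Complex.mul_conj, Complex.add_re, Complex.re_mul_ofReal,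
      Complex.ofReal_re]
    exact add_nonneg (mul_nonneg (hz0 y) (Complex.normSq_nonneg _)) (Complex.normSq_nonneg _)
  have hN : MonotoneOn (fun y => ‖f y‖ ^ 2) (Ici 0) := by
    refine monotoneOn_of_hasDerivWithinAt_nonneg (convex_Ici 0)
      (hf.continuousOn.norm.pow 2)
      (fun y hy => (hasDerivWithinAt_norm_sq (hf.first y (interior_subset hy))).mono
        interior_subset) fun y hy => ?_
    have hy' : (0:ℝ) ≤ y := interior_subset hy
    have := hm (mem_Ici.2 le_rfl) hy' hy'
    simp only [h0] at this
    linarith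
  -- A nonzero value would keep the nondecreasing `|f|²` above a positive constant on a half line,
  -- contradicting integrability.
  by_contra hne
  have hpos : 0 < ‖f y‖ ^ 2 := by positivity
  have hc : IntegrableOn (fun _ : ℝ => ‖f y‖ ^ 2) (Ioi y) := by
    refine (hint.mono_set (Ioi_subset_Ioi hy)).mono' aestronglyMeasurable_const ?_
    filter_upwards [ae_restrict_mem measurableSet_Ioi] with x hx
    rw [Real.norm_of_nonneg hpos.le]
    exact hN hy (mem_Ici.2 (hy.trans (le_of_lt hx))) (le_of_lt hx)
  rw [integrableOn_const_iff] at hc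
  rcases hc with h | h
  · exact hpos.ne' (by simpa using h)
  · simp at h

/-- The Neumann problem `z f - f'' = w`, `f' 0 = 0` in the weighted space. -/
def NeumannSol (z w f : ℝ → ℂ) : Prop :=
  WeightedL2 f ∧ ∃ f1 : ℝ → ℂ, HasTwoDerivs f f1 (fun y => z y * f y - w y) ∧ f1 0 = 0

lemma NeumannSol.add {z w w' f f' : ℝ → ℂ} (h : NeumannSol z w f) (h' : NeumannSol z w' f') :
    NeumannSol z (fun y => w y + w' y) fun y => f y + f' y := by
  obtain ⟨hw, f1, h1, h10⟩ := h
  obtain ⟨hw', f1', h1', h10'⟩ := h'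
  refine ⟨hw.add hw', _, (h1.add h1').congr_ae (Eventually.of_forall fun y => ?_), ?_⟩
  · simp only; ring
  · simp only [h10, h10', add_zero]

lemma NeumannSol.const_mul {z w f : ℝ → ℂ} (h : NeumannSol z w f) (a : ℂ) :
    NeumannSol z (fun y => a * w y) fun y => a * f y := by
  obtain ⟨hw, f1, h1, h10⟩ := h
  refine ⟨hw.const_mul a, _, (h1.const_mul a).congr_ae (Eventually.of_forall fun y => ?_), ?_⟩
  · simp only; ring
  · simp only [h10, mul_zero]

lemma NeumannSol.eqOn {z w w' f f' : ℝ → ℂ} (hz : Continuous z) (hz0 : ∀ y, 0 ≤ (z y).re)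
    (h : NeumannSol z w f) (h' : NeumannSol z w' f')
    (hw : ∀ᵐ y ∂volume.restrict (Ioi 0), w y = w' y) : EqOn f f' (Ici 0) := by
  obtain ⟨hL, d1, hd, hd0⟩ := h.add (h'.const_mul (-1))
  intro y hy
  have h2 : HasTwoDerivs (fun y => f y + -1 * f' y) d1
      (fun y => z y * (f y + -1 * f' y)) := by
    refine hd.congr_ae ?_
    filter_upwards [hw] with y hy
    rw [hy]; ring
  have := HasTwoDerivs.eq_zero hz hz0 h2 hL.integrableOn_sq (by rw [hd0]; simp) hy
  linear_combination this

/-! ### Riccati factorization and the local Neumann problem -/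

/-- A solution `q` of the Riccati equation `q' = q^2 - z`, which factorizes `z - ∂^2`. -/
structure Riccati (z q : ℝ → ℂ) (c A : ℝ) : Prop where
  continuous_z : Continuous z
  hasDerivAt : ∀ y, HasDerivAt q (q y ^ 2 - z y) y
  le_re : ∀ y, c ≤ (q y).re
  le_c : 12 ≤ c
  re_z_nonneg : ∀ y, 0 ≤ (z y).re
  norm_le : ∀ y, 0 ≤ y → ‖q y‖ ≤ A * (1 + y)

namespace Riccati

variable {z q : ℝ → ℂ} {c A : ℝ}

lemma continuous (h : Riccati z q c A) : Continuous q :=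
  continuous_iff_continuousAt.2 fun y => (h.hasDerivAt y).continuousAt

lemma c_pos (h : Riccati z q c A) : 0 < c := by linarith [h.le_c]

lemma le_norm (h : Riccati z q c A) (y : ℝ) : c ≤ ‖q y‖ :=
  (h.le_re y).trans (Complex.re_le_norm _)

lemma ne_zero (h : Riccati z q c A) (y : ℝ) : q y ≠ 0 :=
  norm_pos_iff.1 (h.c_pos.trans_le (h.le_norm y))

end Riccati

/-- The solution operator of the Neumann problem. -/
def neumannOp (q w : ℝ → ℂ) : ℝ → ℂ :=
  fwdSol q (backSol q (restr w)) (backSol q (restr w) 0 / q 0)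

section

variable {z q : ℝ → ℂ} {c A : ℝ} {w : ℝ → ℂ}

/-- From `g' = q g - w` and `f' = g - q f`, the Riccati equation gives `f'' = z f - w`: the terms in
`g` cancel. The equation for `g` is used in integrated form because `w` need not be continuous. -/
lemma Riccati.hasTwoDerivs_neumannOp (h : Riccati z q c A) (hw : WeightedL2 w) :
    HasTwoDerivs (neumannOp q w) (fun y => backSol q (restr w) y - q y * neumannOp q w y)
      (fun y => z y * neumannOp q w y - w y) := by
  have hs := hw.integrable_mul_intFac_inv h.continuous h.le_re h.c_pos
  have hgc := continuous_backSol h.continuous hs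
  set g := backSol q (restr w) with hg
  set f := neumannOp q w with hf
  have hd : ∀ y, HasDerivAt f (g y - q y * f y) y := fun y => hasDerivAt_fwdSol h.continuous hgc _ y
  have hfc : Continuous f := continuous_iff_continuousAt.2 fun y => (hd y).continuousAt
  have hqf : ∀ y, HasDerivAt (fun y => q y * f y) (q y * g y - z y * f y) y := by
    intro y
    convert! (h.hasDerivAt y).mul (hd y) using 1
    ring
  have hcz := h.continuous_z
  have hcq := h.continuous
  have hi1 : ∀ y, IntervalIntegrable (fun y => q y * g y - z y * f y) volume 0 y := fun y =>
    ((hcq.mul hgc).sub (hcz.mul hfc)).intervalIntegrable _ _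
  have hrw : Integrable (restr w) := (integrable_indicator_iff measurableSet_Ioi).2 hw.integrableOn_Ioi
  have h2 : HasTwoDerivs f (fun y => g y - q y * f y) (fun y => z y * f y - restr w y) := by
    refine ⟨fun y _ => (hd y).hasDerivWithinAt, fun y _ =>
      ((hcz.mul hfc).intervalIntegrable _ _).sub hrw.intervalIntegrable, fun y _ => ?_⟩
    have e1 := backSol_eq_integral h.continuous hs y
    have e2 := intervalIntegral.integral_eq_sub_of_hasDerivAt (fun t _ => hqf t) (hi1 y)
    have e3 : ∀ t, z t * f t - restr w t = (q t * g t - restr w t) - (q t * g t - z t * f t) := by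
      intro t; ring
    rw [intervalIntegral.integral_congr (fun t _ => e3 t), intervalIntegral.integral_sub _ (hi1 y),
      e2]
    · rw [← hg] at e1
      linear_combination e1
    · exact ((hcq.mul hgc).intervalIntegrable _ _).sub hrw.intervalIntegrable
  refine h2.congr_ae ?_
  filter_upwards [ae_restrict_mem measurableSet_Ioi] with y hy
  rw [restr, indicator_of_mem hy]

/-- The initial value contributes `1/c · 1/c³`, with `|q 0| ≥ c` for the division, and the source
`2/c² · 1/c²`. -/
lemma Riccati.weightedL2_neumannOp (h : Riccati z q c A) (hw : WeightedL2 w) :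
    WeightedL2 (neumannOp q w) ∧ wsq (neumannOp q w) ≤ 3 / c ^ 4 * wsq w := by
  have hc := h.c_pos
  obtain ⟨hg, hgw⟩ := hw.backSol h.continuous h.le_re hc
  have hgc := continuous_backSol h.continuous (hw.integrable_mul_intFac_inv h.continuous h.le_re hc)
  obtain ⟨hf, hfw⟩ := hg.fwdSol h.continuous h.le_re h.le_c hgc (backSol q (restr w) 0 / q 0)
  refine ⟨hf, hfw.trans ?_⟩
  have h0 : ‖backSol q (restr w) 0‖ ^ 2 ≤ 1 / c * wsq w := by
    refine (hw.norm_backSol_sq_le h.continuous h.le_re hc le_rfl).trans ?_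
    gcongr
    refine integral_mono_of_nonneg (Eventually.of_forall fun y => by
      simp only [Pi.zero_apply]; positivity) hw.integrableOn ?_
    filter_upwards [ae_restrict_mem measurableSet_Ioi] with y hy
    have : (0:ℝ) < y := hy
    refine mul_le_mul_of_nonneg_right ?_ (by positivity)
    have h1 : Real.exp (-(c * (y - 0))) ≤ 1 := by
      rw [Real.exp_le_one_iff, neg_nonpos, sub_zero]; positivity
    exact h1.trans (one_le_pow₀ (by linarith))
  have ha : ‖backSol q (restr w) 0 / q 0‖ ^ 2 ≤ 1 / c ^ 3 * wsq w := by
    rw [norm_div, div_pow]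
    have : c ^ 2 ≤ ‖q 0‖ ^ 2 := by have := h.le_norm 0; gcongr
    calc _ ≤ (1 / c * wsq w) / c ^ 2 := by
          have := wsq_nonneg w
          gcongr
      _ = _ := by field_simp
  calc _ ≤ 1 / c * (1 / c ^ 3 * wsq w) + 2 / c ^ 2 * (1 / c ^ 2 * wsq w) := by gcongr
    _ = _ := by field_simp; ring

/-- The initial value `g(0)/q(0)` in `neumannOp` is the one for which `f'(0) = g(0) - q(0) f(0)`
vanishes. -/
lemma Riccati.neumannSol (h : Riccati z q c A) (hw : WeightedL2 w) :
    NeumannSol z w (neumannOp q w) := by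
  refine ⟨(h.weightedL2_neumannOp hw).1, _, h.hasTwoDerivs_neumannOp hw, ?_⟩
  have := h.ne_zero 0
  simp only [neumannOp, fwdSol_zero]
  field_simp; ring

/-- Pointwise decay of the solution of the Neumann problem and of its derivative. -/
lemma Riccati.decay (h : Riccati z q c A) {κ : ℝ} (hcκ : κ + 1 ≤ c)
    {B : ℝ → ℝ} (hB : ∀ x y, 0 ≤ x → 0 ≤ y → B x ≤ B y * Real.exp (κ * |x - y|))
    (hB0 : ∀ y, 0 ≤ y → 0 ≤ B y) (hwB : ∀ y, 0 < y → ‖w y‖ ≤ B y) {y : ℝ} (hy : 0 ≤ y) :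
    ‖neumannOp q w y‖ ≤ 2 * B y ∧
      ‖backSol q (restr w) y - q y * neumannOp q w y‖ ≤ (1 + 2 * A) * ((1 + y) * B y) := by
  have hg : ∀ y, 0 ≤ y → ‖backSol q (restr w) y‖ ≤ B y := fun y hy =>
    norm_backSol_le_of_decay h.continuous h.le_re hcκ hB hB0 hwB hy
  have ha : ‖backSol q (restr w) 0 / q 0‖ ≤ B 0 := by
    rw [norm_div]
    exact (div_le_self (norm_nonneg _) (by linarith [h.le_norm 0, h.le_c])).trans (hg 0 le_rfl)
  have hf := norm_fwdSol_le_of_decay h.continuous h.le_re hcκ hB hB0 hg ha hy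
  refine ⟨hf, (norm_sub_le _ _).trans ?_⟩
  rw [norm_mul]
  have h1 : ‖q y‖ * ‖neumannOp q w y‖ ≤ A * (1 + y) * (2 * B y) :=
    mul_le_mul (h.norm_le y hy) hf (norm_nonneg _) ((norm_nonneg _).trans (h.norm_le y hy))
  have h2 := hg y hy
  have h3 := mul_nonneg hy (hB0 y hy)
  linarith

end

/-! ### The energy estimate with weight `1/|U_s''|` -/

namespace ShearData

variable (S : ShearData) (k : ℝ) (lam : ℂ)

/-- The coefficient `λ + i k V_s`. -/
def z (y : ℝ) : ℂ := lam + Complex.I * (k : ℂ) * (S.v y : ℂ)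

/-- The source `i k U_s'' p`. -/
def src (p : ℝ → ℂ) (y : ℝ) : ℂ := -(Complex.I * (k : ℂ) * (S.d y : ℂ)) * p y

lemma continuous_v : Continuous S.v :=
  continuous_iff_continuousAt.2 fun y => (S.hasDerivAt_v y).continuousAt

lemma continuous_z : Continuous (S.z k lam) :=
  continuous_const.add (continuous_const.mul (Complex.continuous_ofReal.comp S.continuous_v))

@[simp] lemma re_z (y : ℝ) : (S.z k lam y).re = lam.re := by simp [z]

lemma z_zero : S.z k lam 0 = lam := by simp [z, S.v_zero]

lemma norm_src (p : ℝ → ℂ) (y : ℝ) : ‖S.src k p y‖ = |k| * S.d y * ‖p y‖ := by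
  simp [src, abs_of_pos (S.d_pos y)]

lemma d_nonneg (y : ℝ) : 0 ≤ S.d y := (S.d_pos y).le

/-- The pointwise decay rate of solutions whose source grows at most linearly relative
to `U_s''`. -/
def rate (y : ℝ) : ℝ := (1 + y) * S.d y

lemma rate_nonneg {y : ℝ} (hy : 0 ≤ y) : 0 ≤ S.rate y := mul_nonneg (by linarith) (S.d_nonneg y)

/-- The factor `1 + y` varies at exponential rate at most one, which raises `κ` to `κ + 1`. -/
lemma rate_le {x y : ℝ} (hy : 0 ≤ y) :
    S.rate x ≤ S.rate y * Real.exp ((S.κ + 1) * |x - y|) := by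
  have h1 : 1 + x ≤ (1 + y) * Real.exp |x - y| := by
    have h2 := Real.add_one_le_exp |x - y|
    have h3 := le_abs_self (x - y)
    have h4 := abs_nonneg (x - y)
    nlinarith
  calc S.rate x ≤ ((1 + y) * Real.exp |x - y|) * (S.d y * Real.exp (S.κ * |x - y|)) :=
        mul_le_mul h1 (S.d_le_exp x y) (S.d_nonneg x) (by positivity)
    _ = _ := by rw [rate, add_mul S.κ 1, Real.exp_add, one_mul]; ring

lemma d_le_inv {y : ℝ} (hy : 0 ≤ y) : S.d y ≤ S.M * ((1 + y) ^ 6)⁻¹ := by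
  rw [← div_eq_mul_inv, le_div_iff₀ (by positivity), mul_comm]
  exact S.decay y hy

/-- The weight `1 / |U_s''|` dominates the polynomial weight. -/
lemma weight_le {y : ℝ} (hy : 0 ≤ y) : (1 + y) ^ 6 ≤ S.M * (S.d y)⁻¹ := by
  rw [← div_eq_mul_inv, le_div_iff₀ (S.d_pos y)]
  exact S.decay y hy

/-- Sixth-order decay of `U_s''` leaves `(1 + y)^(6 - 12 + 2)` in the weighted square, so linear
growth of `p`, as in the forcing `ikU_s'' y`, is affordable. -/
lemma weightedL2_src {p : ℝ → ℂ} (hp : Continuous p) {C : ℝ}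
    (hpC : ∀ y, 0 ≤ y → ‖p y‖ ≤ C * (1 + y)) : WeightedL2 (S.src k p) := by
  have hc : Continuous (S.src k p) := by
    have := S.continuous_d
    unfold src; fun_prop
  refine weightedL2_iff.2 ⟨hc.aestronglyMeasurable, ?_⟩
  refine (integrableOn_inv_one_add_sq.const_mul ((|k| * S.M * C) ^ 2)).mono'
    (by fun_prop) ?_
  filter_upwards [ae_restrict_mem measurableSet_Ioi] with y hy
  have hy0 : (0:ℝ) < y := hy
  have hC : 0 ≤ C * (1 + y) := (norm_nonneg _).trans (hpC y hy0.le)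
  have hM := S.M_pos
  rw [Real.norm_of_nonneg (by positivity), norm_src]
  have h1 : |k| * S.d y * ‖p y‖ ≤ |k| * (S.M * ((1 + y) ^ 6)⁻¹) * (C * (1 + y)) := by
    refine mul_le_mul (mul_le_mul_of_nonneg_left (S.d_le_inv hy0.le) (abs_nonneg k))
      (hpC y hy0.le) (norm_nonneg _) (by positivity)
  have h0 : 0 ≤ |k| * S.d y * ‖p y‖ := by
    have := S.d_nonneg y
    positivity
  calc (1 + y) ^ 6 * (|k| * S.d y * ‖p y‖) ^ 2
      ≤ (1 + y) ^ 6 * (|k| * (S.M * ((1 + y) ^ 6)⁻¹) * (C * (1 + y))) ^ 2 := by gcongr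
    _ = (|k| * S.M * C) ^ 2 * ((1 + y) ^ 4)⁻¹ := by field_simp
    _ ≤ _ := by
      gcongr
      · linarith
      · norm_num

/-- The weighted energy estimate. Concavity enters through the weight `1 / |U_s''|`, for which
the nonlocal term is skew-symmetric. -/
theorem energy {f f1 p : ℝ → ℂ} {t C P : ℝ} (hf : Continuous f) (hp : Continuous p)
    (hfw : WeightedL2 f)
    (hd : HasTwoDerivs f f1 fun y => S.z k lam y * f y - S.src k (fun y => t * calVy f y + p y) y)
    (h0 : f1 0 = 0) (hμ : 0 < lam.re) (hκ : S.κ ^ 2 ≤ lam.re)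
    (hfC : ∀ y, 0 ≤ y → ‖f y‖ ≤ C * S.rate y)
    (hf1C : ∀ y, 0 ≤ y → ‖f1 y‖ ≤ C * ((1 + y) * S.rate y))
    (hP : ∀ Y, 0 ≤ Y → ∫ y in (0:ℝ)..Y, S.d y * ‖p y‖ ^ 2 ≤ P) :
    wsq f ≤ 2 * S.M * (|k| / lam.re) ^ 2 * P := by
  set μ := lam.re with hμdef
  have hM := S.M_pos
  have hfi := hfw.integrableOn_Ioi
  have hdc := S.continuous_d
  have hzc := S.continuous_z k lam
  have hφc := continuousOn_calVy hfi
  have hTc := continuousOn_tailInt hfi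
  have hf2c : ContinuousOn (fun y => S.z k lam y * f y -
      S.src k (fun y => t * calVy f y + p y) y) (Ici 0) := by
    unfold src
    refine (hzc.mul hf).continuousOn.sub (ContinuousOn.mul (by fun_prop) ?_)
    exact (continuousOn_const.mul hφc).add hp.continuousOn
  have hf1c : ContinuousOn f1 (Ici 0) := fun y hy =>
    (hd.hasDerivWithinAt hf2c hy).continuousWithinAt
  -- The first term is the flux of the weighted energy. The second is the primitive that removes the
  -- nonlocal term: with `V_y[f]' = -T` and `T' = -f`, where `T` is `tailInt f`, its derivative is
  -- `-t Re(ik V_y[f] f̄)`, because `Re(ik |T|²) = 0`.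
  set G : ℝ → ℝ := fun y => (S.d y)⁻¹ * (f1 y * (starRingEnd ℂ) (f y)).re +
    t * (Complex.I * k * (calVy f y * (starRingEnd ℂ) (tailInt f y))).re with hG
  have hGc : ContinuousOn G (Ici 0) := by
    refine ((hdc.inv₀ fun y => (S.d_pos y).ne').continuousOn.mul
      (Complex.continuous_re.comp_continuousOn (hf1c.mul
        (Complex.continuous_conj.comp hf).continuousOn))).add
      (continuousOn_const.mul (Complex.continuous_re.comp_continuousOn (continuousOn_const.mul
        (hφc.mul (Complex.continuous_conj.comp_continuousOn hTc)))))
  set g : ℝ → ℝ := fun y => -(S.d1 y) / S.d y ^ 2 * (f1 y * (starRingEnd ℂ) (f y)).re +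
    (S.d y)⁻¹ * (‖f1 y‖ ^ 2 + μ * ‖f y‖ ^ 2) +
      (Complex.I * k * (p y * (starRingEnd ℂ) (f y))).re with hg
  have hGd : ∀ y, 0 < y → HasDerivAt G (g y) y := by
    intro y hy
    have e1 := (S.hasDerivAt_d y hy).inv (S.d_pos y).ne'
    have ef1 := (hd.hasDerivWithinAt hf2c hy.le).hasDerivAt (Ici_mem_nhds hy)
    have ef := (hd.first y hy.le).hasDerivAt (Ici_mem_nhds hy)
    have eφ := (hasDerivWithinAt_calVy hfi hy.le).hasDerivAt (Ici_mem_nhds hy)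
    have eT := hasDerivAt_tailInt hfi hf.continuousOn hy
    have e2 := Complex.reCLM.hasFDerivAt.comp_hasDerivAt y (ef1.mul ef.star)
    have e3 := Complex.reCLM.hasFDerivAt.comp_hasDerivAt y
      ((eφ.mul eT.star).const_mul (Complex.I * k))
    have e4 := (e1.mul e2).add (e3.const_mul t)
    convert! e4 using 1
    have hdne : S.d y ≠ 0 := (S.d_pos y).ne'
    simp only [hg, Complex.reCLM_apply, Function.comp_apply, src, z, hμdef,
      ← Complex.normSq_eq_norm_sq, Complex.normSq_apply, Complex.add_re, Complex.sub_re,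
      Complex.mul_re, Complex.add_im, Complex.sub_im, Complex.mul_im, Complex.conj_re,
      Complex.conj_im, Complex.neg_re, Complex.neg_im, Complex.I_re, Complex.I_im,
      Complex.ofReal_re, Complex.ofReal_im, Complex.star_def, star_neg, Pi.mul_apply,
      Pi.inv_apply]
    field_simp
    ring
  -- Of the dissipation `μ|f|²/d`, one quarter, together with `|f'|²/d`, absorbs the derivative of
  -- the weight (by `κ² ≤ μ`), one quarter absorbs the source, and the remaining half dominates `(1
  -- + y)^6 |f|²` through `1/d ≥ (1 + y)^6/M`.
  have hpt : ∀ y, 0 < y → μ / (2 * S.M) * ((1 + y) ^ 6 * ‖f y‖ ^ 2) -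
      k ^ 2 / μ * (S.d y * ‖p y‖ ^ 2) ≤ g y := by
    intro y hy
    have hdp := S.d_pos y
    have hκ0 := S.κ_nonneg
    have b1 : |(f1 y * (starRingEnd ℂ) (f y)).re| ≤ ‖f1 y‖ * ‖f y‖ := by
      refine (Complex.abs_re_le_norm _).trans (le_of_eq ?_)
      rw [norm_mul, Complex.norm_conj]
    have b2 : |(Complex.I * k * (p y * (starRingEnd ℂ) (f y))).re| ≤ |k| * (‖p y‖ * ‖f y‖) := by
      refine (Complex.abs_re_le_norm _).trans (le_of_eq ?_)
      simp
    have b3 : |-(S.d1 y) / S.d y ^ 2 * (f1 y * (starRingEnd ℂ) (f y)).re| ≤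
        (S.d y)⁻¹ * (S.κ * (‖f1 y‖ * ‖f y‖)) := by
      rw [abs_mul, abs_div, abs_neg, abs_of_pos (by positivity : 0 < S.d y ^ 2)]
      calc _ ≤ (S.κ * S.d y) / S.d y ^ 2 * (‖f1 y‖ * ‖f y‖) := by
            gcongr; exact S.abs_d1_le y hy
        _ = _ := by field_simp
    have b4 : S.κ * (‖f1 y‖ * ‖f y‖) ≤ ‖f1 y‖ ^ 2 + μ / 4 * ‖f y‖ ^ 2 := by
      nlinarith [sq_nonneg (‖f1 y‖ - S.κ / 2 * ‖f y‖), sq_nonneg ‖f y‖]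
    have b5 : |k| * (‖p y‖ * ‖f y‖) ≤
        μ / 4 * ((S.d y)⁻¹ * ‖f y‖ ^ 2) + k ^ 2 / μ * (S.d y * ‖p y‖ ^ 2) := by
      have e : μ / 4 * ((S.d y)⁻¹ * ‖f y‖ ^ 2) + k ^ 2 / μ * (S.d y * ‖p y‖ ^ 2) -
          |k| * (‖p y‖ * ‖f y‖) =
          μ * (S.d y)⁻¹ * (‖f y‖ / 2 - |k| * S.d y / μ * ‖p y‖) ^ 2 := by
        rw [← sq_abs k]; field_simp; ring
      have : 0 ≤ μ * (S.d y)⁻¹ * (‖f y‖ / 2 - |k| * S.d y / μ * ‖p y‖) ^ 2 := by positivity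
      linarith
    have b6 : μ / (2 * S.M) * ((1 + y) ^ 6 * ‖f y‖ ^ 2) ≤ μ / 2 * ((S.d y)⁻¹ * ‖f y‖ ^ 2) := by
      calc _ ≤ μ / (2 * S.M) * ((S.M * (S.d y)⁻¹) * ‖f y‖ ^ 2) := by
            gcongr; exact S.weight_le hy.le
        _ = _ := by field_simp
    have b7 : (S.d y)⁻¹ * (S.κ * (‖f1 y‖ * ‖f y‖)) ≤
        (S.d y)⁻¹ * (‖f1 y‖ ^ 2 + μ / 4 * ‖f y‖ ^ 2) := by gcongr
    have c1 := (abs_le.1 b2).1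
    have c2 := (abs_le.1 b3).1
    simp only [hg]
    linarith
  have hωc : Continuous fun y => (1 + y) ^ 6 * ‖f y‖ ^ 2 := by fun_prop
  have hpc : Continuous fun y => S.d y * ‖p y‖ ^ 2 := by fun_prop
  have hmono : MonotoneOn (fun Y => G Y + k ^ 2 / μ * (∫ y in (0:ℝ)..Y, S.d y * ‖p y‖ ^ 2) -
      μ / (2 * S.M) * ∫ y in (0:ℝ)..Y, (1 + y) ^ 6 * ‖f y‖ ^ 2) (Ici 0) := by
    have i1 : ∀ Y, HasDerivAt (fun Y => k ^ 2 / μ * ∫ y in (0:ℝ)..Y, S.d y * ‖p y‖ ^ 2)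
        (k ^ 2 / μ * (S.d Y * ‖p Y‖ ^ 2)) Y := fun Y =>
      (intervalIntegral.integral_hasDerivAt_right (hpc.intervalIntegrable _ _)
        (hpc.stronglyMeasurableAtFilter _ _) hpc.continuousAt).const_mul _
    have i2 : ∀ Y, HasDerivAt (fun Y => μ / (2 * S.M) * ∫ y in (0:ℝ)..Y, (1 + y) ^ 6 * ‖f y‖ ^ 2)
        (μ / (2 * S.M) * ((1 + Y) ^ 6 * ‖f Y‖ ^ 2)) Y := fun Y =>
      (intervalIntegral.integral_hasDerivAt_right (hωc.intervalIntegrable _ _)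
        (hωc.stronglyMeasurableAtFilter _ _) hωc.continuousAt).const_mul _
    refine monotoneOn_of_hasDerivWithinAt_nonneg (convex_Ici 0)
      ((hGc.add fun Y _ => (i1 Y).continuousAt.continuousWithinAt).sub
        fun Y _ => (i2 Y).continuousAt.continuousWithinAt)
      (f' := fun Y => g Y + k ^ 2 / μ * (S.d Y * ‖p Y‖ ^ 2) -
        μ / (2 * S.M) * ((1 + Y) ^ 6 * ‖f Y‖ ^ 2)) (fun Y hY => ?_) fun Y hY => ?_
    · have hY' : 0 < Y := by simpa using hY
      exact (((hGd Y hY').add (i1 Y)).sub (i2 Y)).hasDerivWithinAt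
    · have hY' : 0 < Y := by simpa using hY
      have := hpt Y hY'
      linarith
  have hG0 : G 0 = 0 := by simp [hG, h0]
  -- The pointwise bounds give a flux of order `(1 + y)^3 d`, which still decays like `(1 +
  -- y)^(-3)`; the second part of `G` decays with the tail of `f`.
  have hGlim : Tendsto G atTop (𝓝 0) := by
    set N := Real.sqrt (wsq f)
    have hN := Real.sqrt_nonneg (wsq f)
    have hNsq : wsq f ≤ N ^ 2 := (Real.sq_sqrt (wsq_nonneg f)).ge
    have hbd : ∀ y, 0 ≤ y → ‖G y‖ ≤ (C ^ 2 * S.M + |t| * |k| * N ^ 2) * (1 + y)⁻¹ := by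
      intro y hy
      have hdp := S.d_pos y
      have a1 : ‖(S.d y)⁻¹ * (f1 y * (starRingEnd ℂ) (f y)).re‖ ≤ C ^ 2 * S.M * (1 + y)⁻¹ := by
        rw [norm_mul, norm_inv, Real.norm_of_nonneg hdp.le, Real.norm_eq_abs]
        calc _ ≤ (S.d y)⁻¹ * ((C * ((1 + y) * S.rate y)) * (C * S.rate y)) := by
              gcongr
              refine (Complex.abs_re_le_norm _).trans ?_
              rw [norm_mul, Complex.norm_conj]
              exact mul_le_mul (hf1C y hy) (hfC y hy) (norm_nonneg _)
                ((norm_nonneg _).trans (hf1C y hy))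
          _ = C ^ 2 * ((1 + y) ^ 3 * S.d y) := by rw [rate]; field_simp
          _ ≤ C ^ 2 * ((1 + y) ^ 3 * (S.M * ((1 + y) ^ 6)⁻¹)) := by
              gcongr; exact S.d_le_inv hy
          _ = C ^ 2 * S.M * ((1 + y) ^ 3)⁻¹ := by field_simp
          _ ≤ _ := by
              gcongr
              exact le_self_pow₀ (by linarith) (by norm_num)
      have a2 : ‖t * (Complex.I * k * (calVy f y * (starRingEnd ℂ) (tailInt f y))).re‖ ≤
          |t| * |k| * N ^ 2 * (1 + y)⁻¹ := by
        rw [norm_mul, Real.norm_eq_abs, Real.norm_eq_abs]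
        calc _ ≤ |t| * (|k| * (N * (N * ((1 + y) ^ 2)⁻¹))) := by
              gcongr
              refine (Complex.abs_re_le_norm _).trans ?_
              simp only [norm_mul, Complex.norm_I, Complex.norm_real, one_mul, Complex.norm_conj,
                Real.norm_eq_abs]
              gcongr
              · exact norm_calVy_le hfw hN hNsq hy
              · exact (norm_integral_le_integral_norm _).trans (hfw.tail hN hNsq hy).2
          _ = |t| * |k| * N ^ 2 * ((1 + y) ^ 2)⁻¹ := by ring
          _ ≤ _ := by
              gcongr
              exact le_self_pow₀ (by linarith) (by norm_num)
      refine (norm_add_le _ _).trans ?_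
      linarith
    have hlim : Tendsto (fun y : ℝ => (C ^ 2 * S.M + |t| * |k| * N ^ 2) * (1 + y)⁻¹) atTop (𝓝 0) := by
      have := (tendsto_neg_inv_one_add.neg).const_mul (C ^ 2 * S.M + |t| * |k| * N ^ 2)
      simpa using this
    refine squeeze_zero_norm' ?_ hlim
    filter_upwards [eventually_ge_atTop 0] with y hy using hbd y hy
  have hbd : ∀ Y, 0 ≤ Y → ∫ y in (0:ℝ)..Y, (1 + y) ^ 6 * ‖f y‖ ^ 2 ≤
      2 * S.M * (|k| / μ) ^ 2 * P := by
    intro Y hY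
    -- The cutoff `Y` is held fixed while `y` tends to infinity, so that the boundary term drops
    -- out.
    have h1 : ∀ y, Y ≤ y → μ / (2 * S.M) * (∫ y in (0:ℝ)..Y, (1 + y) ^ 6 * ‖f y‖ ^ 2) -
        k ^ 2 / μ * P ≤ G y := by
      intro y hy
      have hy0 := hY.trans hy
      have h2 := hmono (mem_Ici.2 le_rfl) (mem_Ici.2 hy0) hy0
      simp only [hG0, intervalIntegral.integral_same, mul_zero, add_zero, sub_zero] at h2
      have h3 : ∫ y in (0:ℝ)..Y, (1 + y) ^ 6 * ‖f y‖ ^ 2 ≤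
          ∫ y in (0:ℝ)..y, (1 + y) ^ 6 * ‖f y‖ ^ 2 := by
        refine intervalIntegral.integral_mono_interval le_rfl hY hy ?_
          (hωc.intervalIntegrable _ _)
        filter_upwards [ae_restrict_mem measurableSet_Ioc] with x hx
        have := hx.1
        simp only [Pi.zero_apply]; positivity
      have h4 : k ^ 2 / μ * (∫ y in (0:ℝ)..y, S.d y * ‖p y‖ ^ 2) ≤ k ^ 2 / μ * P := by
        gcongr; exact hP y hy0
      have h5 : μ / (2 * S.M) * (∫ y in (0:ℝ)..Y, (1 + y) ^ 6 * ‖f y‖ ^ 2) ≤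
        μ / (2 * S.M) * ∫ y in (0:ℝ)..y, (1 + y) ^ 6 * ‖f y‖ ^ 2 := by gcongr
      linarith
    have h2 : μ / (2 * S.M) * (∫ y in (0:ℝ)..Y, (1 + y) ^ 6 * ‖f y‖ ^ 2) -
        k ^ 2 / μ * P ≤ 0 := by
      refine ge_of_tendsto hGlim ?_
      filter_upwards [eventually_ge_atTop Y] with y hy using h1 y hy
    calc _ = 2 * S.M / μ * (μ / (2 * S.M) * (∫ y in (0:ℝ)..Y, (1 + y) ^ 6 * ‖f y‖ ^ 2)) := by
          field_simp
      _ ≤ 2 * S.M / μ * (k ^ 2 / μ * P) :=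
          mul_le_mul_of_nonneg_left (by linarith) (by positivity)
      _ = _ := by rw [div_pow, sq_abs]; field_simp
  exact (integrableOn_Ioi_of_bounded hωc.continuousOn (fun y hy => by positivity) hbd).2

end ShearData

/-! ### The method of continuity -/

/-- The method of continuity: an a priori bound that is uniform along the segment from `1` to
`1 - B` makes `1 - B` surjective. -/
lemma exists_sub_apply_eq {X : Type*} [NormedAddCommGroup X] [NormedSpace ℂ X] [CompleteSpace X]
    (B : X →L[ℂ] X) {C : ℝ} (hC : 0 ≤ C)
    (h : ∀ t : ℝ, 0 ≤ t → t ≤ 1 → ∀ p : X, ‖p‖ ≤ C * ‖p - (t : ℂ) • B p‖) (b : X) :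
    ∃ p : X, p - B p = b := by
  -- The segment is cut into `N` steps, each short enough for a Neumann series around the previous
  -- inverse, whose norm is at most `C` by the a priori bound.
  obtain ⟨N, hN⟩ := exists_nat_gt (C * ‖B‖)
  have hN0 : (0:ℝ) < N := (mul_nonneg hC (norm_nonneg B)).trans_lt hN
  have hval : ∀ (u : (X →L[ℂ] X)ˣ) (x : X), (u : X →L[ℂ] X) (u.inv x) = x := fun u x =>
    congrArg (fun T : X →L[ℂ] X => T x) u.val_inv
  have key : ∀ n : ℕ, n ≤ N → IsUnit (1 - (((n / N : ℝ)) : ℂ) • B) := by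
    intro n
    induction n with
    | zero => intro _; simp
    | succ n ih =>
      intro hn
      obtain ⟨u, hu⟩ := ih (by omega)
      have hnN : (n:ℝ) / N ≤ 1 := by
        rw [div_le_one hN0]; exact_mod_cast (by omega : n ≤ N)
      have hinv : ‖u.inv‖ ≤ C := by
        refine ContinuousLinearMap.opNorm_le_bound _ hC fun x => ?_
        have h1 := h (n / N) (by positivity) hnN (u.inv x)
        have h2 := hval u x
        rw [hu] at h2
        have h3 : ∀ y : X, (1 - (((n / N : ℝ)) : ℂ) • B) y = y - (((n / N : ℝ)) : ℂ) • B y :=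
          fun y => by simp
        rw [h3] at h2
        rwa [h2] at h1
      have hsmall : ‖u.inv * (((1 / N : ℝ) : ℂ) • B)‖ < 1 := by
        refine (norm_mul_le _ _).trans_lt ?_
        rw [norm_smul, Complex.norm_real, Real.norm_of_nonneg (by positivity)]
        calc _ ≤ C * (1 / N * ‖B‖) := by gcongr
          _ = C * ‖B‖ / N := by ring
          _ < 1 := by rwa [div_lt_one hN0]
      have := u.isUnit.mul (isUnit_one_sub_of_norm_lt_one hsmall)
      convert! this using 1
      rw [mul_sub, mul_one, ← mul_assoc, Units.inv_eq_val_inv, Units.mul_inv, one_mul, hu, sub_sub, ← add_smul]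
      congr 2
      push_cast; ring
  obtain ⟨u, hu⟩ := key N le_rfl
  refine ⟨u.inv b, ?_⟩
  have h2 := hval u b
  rw [hu, div_self hN0.ne'] at h2
  simpa using h2

open BoundedContinuousFunction

lemma continuous_neumannOp {z q w : ℝ → ℂ} {c A : ℝ} (h : Riccati z q c A) (hw : WeightedL2 w) :
    Continuous (neumannOp q w) :=
  continuous_iff_continuousAt.2 fun y => (hasDerivAt_fwdSol h.continuous (continuous_backSol
    h.continuous (hw.integrable_mul_intFac_inv h.continuous h.le_re h.c_pos)) _ y).continuousAt

/-! ### Solvability of the vorticity equation with Neumann condition -/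

namespace ShearData

variable (S : ShearData) (k : ℝ) (lam : ℂ)

/-- The conditions on `λ` under which the vorticity equation is solved: the Riccati equation has
a solution, and the viscous and inertial rates dominate the profile. -/
structure Admissible (q : ℝ → ℂ) (c A : ℝ) : Prop where
  riccati : Riccati (S.z k lam) q c A
  A_nonneg : 0 ≤ A
  κ_le_c : S.κ + 2 ≤ c
  re_pos : 0 < lam.re
  κ_le_re : S.κ ^ 2 ≤ lam.re

variable {S k lam} {q : ℝ → ℂ} {c A : ℝ}

/-- The Neumann problem for the vorticity equation. -/
def _root_.TripleDeck.VorticitySol (S : ShearData) (k : ℝ) (lam : ℂ) (w f : ℝ → ℂ) : Prop :=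
  NeumannSol (S.z k lam) (fun y => w y + S.src k (calVy f) y) f

lemma src_congr {p p' : ℝ → ℂ} (h : ∀ y, 0 ≤ y → p y = p' y) :
    ∀ᵐ y ∂volume.restrict (Ioi 0), S.src k p y = S.src k p' y := by
  filter_upwards [ae_restrict_mem measurableSet_Ioi] with y hy
  rw [src, src, h y (le_of_lt hy)]

lemma _root_.TripleDeck.NeumannSol.congr_source {z w w' f : ℝ → ℂ} (h : NeumannSol z w f)
    (hw : ∀ᵐ y ∂volume.restrict (Ioi 0), w y = w' y) : NeumannSol z w' f := by
  obtain ⟨hL, f1, h1, h10⟩ := h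
  refine ⟨hL, f1, h1.congr_ae ?_, h10⟩
  filter_upwards [hw] with y hy
  rw [hy]

/-- The energy estimate for the solution operator with a source relative to `U_s''`. -/
theorem Admissible.wsq_neumannOp_src_le (h : S.Admissible k lam q c A) {p p0 : ℝ → ℂ} {t C C0 : ℝ}
    (hp : Continuous p) (hpC : ∀ y, 0 ≤ y → ‖p y‖ ≤ C * (1 + y))
    (hp0 : Continuous p0) (hp0C : ∀ y, 0 ≤ y → ‖p0 y‖ ≤ C0 * (1 + y))
    (hpp : ∀ y, 0 ≤ y → p y = t * calVy (neumannOp q (S.src k p)) y + p0 y) :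
    wsq (neumannOp q (S.src k p)) ≤ (2 * S.M * C0 * (|k| / lam.re)) ^ 2 := by
  have hw := S.weightedL2_src k hp hpC
  have hM := S.M_pos
  have hC0 : 0 ≤ C := by
    have := (norm_nonneg _).trans (hpC 0 le_rfl)
    linarith
  have hdec := fun {y : ℝ} (hy : 0 ≤ y) => h.riccati.decay (w := S.src k p) (κ := S.κ + 1)
    (B := fun y => |k| * C * S.rate y)
    (by linarith [h.κ_le_c])
    (fun x y _ hy => by
      rw [mul_assoc (|k| * C)]
      exact mul_le_mul_of_nonneg_left (S.rate_le hy) (by positivity))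
    (fun y hy => mul_nonneg (by positivity) (S.rate_nonneg hy))
    (fun y hy => by
      rw [norm_src, rate]
      calc _ ≤ |k| * S.d y * (C * (1 + y)) := by
            have := S.d_nonneg y
            have := hpC y hy.le
            gcongr
        _ = _ := by ring) hy
  -- The growth constant `C` of `p` and the constant `A` enter only the qualitative decay at
  -- infinity; the final bound sees only `C0`, through `∫ d |p0|² ≤ C0² M`.
  have hE := S.energy k lam (t := t) (p := p0) (P := C0 ^ 2 * S.M)
    (C := (2 + (1 + 2 * A)) * (|k| * C)) (continuous_neumannOp h.riccati hw) hp0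
    (h.riccati.weightedL2_neumannOp hw).1
    (f1 := fun y => backSol q (restr (S.src k p)) y - q y * neumannOp q (S.src k p) y)
    ((h.riccati.hasTwoDerivs_neumannOp hw).congr_ae (by
      filter_upwards [src_congr (S := S) (k := k) hpp] with y hy
      rw [hy]))
    (by
      have := h.riccati.ne_zero 0
      simp only [neumannOp, fwdSol_zero]
      field_simp; ring) h.re_pos h.κ_le_re
    (fun y hy => (hdec hy).1.trans (by
      have := S.rate_nonneg hy
      have hA := h.A_nonneg
      have : 0 ≤ (1 + 2 * A) * (|k| * C * S.rate y) := by positivity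
      linarith))
    (fun y hy => (hdec hy).2.trans (by
      have := S.rate_nonneg hy
      have : 0 ≤ 2 * ((1 + y) * (|k| * C * S.rate y)) := by positivity
      linarith))
    (fun Y hY => by
      have hb : ∀ y ∈ Icc 0 Y, S.d y * ‖p0 y‖ ^ 2 ≤ C0 ^ 2 * S.M * ((1 + y) ^ 2)⁻¹ := by
        intro y hy
        have hy0 := hy.1
        calc _ ≤ (S.M * ((1 + y) ^ 6)⁻¹) * (C0 * (1 + y)) ^ 2 := by
              have := S.d_le_inv hy.1
              have := hp0C y hy.1
              gcongr
          _ = C0 ^ 2 * S.M * ((1 + y) ^ 4)⁻¹ := by field_simp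
          _ ≤ _ := by
              gcongr
              · linarith
              · norm_num
      have hc := S.continuous_d
      have hi : IntegrableOn (fun y : ℝ => C0 ^ 2 * S.M * ((1 + y) ^ 2)⁻¹) (Ioi 0) :=
        integrableOn_inv_one_add_sq.const_mul _
      calc _ ≤ ∫ y in (0:ℝ)..Y, C0 ^ 2 * S.M * ((1 + y) ^ 2)⁻¹ :=
            intervalIntegral.integral_mono_on hY ((by fun_prop : Continuous fun y =>
              S.d y * ‖p0 y‖ ^ 2).intervalIntegrable _ _)
              ⟨hi.mono_set Ioc_subset_Ioi_self,
                hi.mono_set (Ioc_subset_Ioi_self.trans (Ioi_subset_Ioi hY))⟩ hb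
        _ ≤ ∫ y in Ioi (0:ℝ), C0 ^ 2 * S.M * ((1 + y) ^ 2)⁻¹ := by
            rw [intervalIntegral.integral_of_le hY]
            exact setIntegral_mono_set hi (Eventually.of_forall fun y => by
              simp only [Pi.zero_apply]; positivity) Ioc_subset_Ioi_self.eventuallyLE
        _ = C0 ^ 2 * S.M := by rw [integral_const_mul, integral_inv_one_add_sq, mul_one])
  refine hE.trans ?_
  have : 0 ≤ S.M ^ 2 * C0 ^ 2 * (|k| / lam.re) ^ 2 := by positivity
  linarith

lemma Admissible.coef_nonneg (h : S.Admissible k lam q c A) : 0 ≤ 2 * S.M * (|k| / lam.re) := by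
  have := S.M_pos
  have := h.re_pos
  positivity

lemma norm_le_linear (p : ℝ →ᵇ ℂ) : ∀ y : ℝ, 0 ≤ y → ‖p y‖ ≤ ‖p‖ * (1 + y) := fun y hy =>
  (p.norm_coe_le_norm y).trans (le_mul_of_one_le_right (norm_nonneg p) (by linarith))

/-- The operator `p ↦ V_y[A^{-1}(i k U_s'' p)]`, with values extended by constants. -/
def Admissible.nonlocalOp (h : S.Admissible k lam q c A) : (ℝ →ᵇ ℂ) →L[ℂ] (ℝ →ᵇ ℂ) :=
  have hsrc : ∀ p : ℝ →ᵇ ℂ, WeightedL2 (S.src k p) := fun p =>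
    S.weightedL2_src k p.continuous (norm_le_linear p)
  have hL : ∀ p : ℝ →ᵇ ℂ, WeightedL2 (neumannOp q (S.src k p)) := fun p =>
    (h.riccati.weightedL2_neumannOp (hsrc p)).1
  -- The case `t = 0`, `p0 = p` of the energy estimate is the boundedness of the operator.
  have hbd : ∀ (p : ℝ →ᵇ ℂ) (y : ℝ), ‖calVy (neumannOp q (S.src k p)) (max y 0)‖ ≤
      2 * S.M * (|k| / lam.re) * ‖p‖ := fun p y =>
    norm_calVy_le (hL p) (mul_nonneg h.coef_nonneg (norm_nonneg p))
      ((h.wsq_neumannOp_src_le (t := 0) p.continuous (norm_le_linear p) p.continuous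
        (norm_le_linear p) (fun y _ => by simp)).trans (le_of_eq (by ring))) (le_max_right y 0)
  LinearMap.mkContinuous
    { toFun := fun p => BoundedContinuousFunction.ofNormedAddCommGroup
        (fun y => calVy (neumannOp q (S.src k p)) (max y 0))
        (ContinuousOn.comp_max_zero (continuousOn_calVy (hL p).integrableOn_Ioi))
        (2 * S.M * (|k| / lam.re) * ‖p‖) (hbd p)
      -- Linearity comes from uniqueness for the local Neumann problem.
      map_add' := fun p p' => by
        ext y
        have heq := NeumannSol.eqOn (S.continuous_z k lam)
          (fun y => by rw [re_z]; exact h.re_pos.le) (h.riccati.neumannSol (hsrc (p + p')))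
          ((h.riccati.neumannSol (hsrc p)).add (h.riccati.neumannSol (hsrc p')))
          (Eventually.of_forall fun y => by simp [src, mul_add])
        have := calVy_congr (heq.mono Ioi_subset_Ici_self) (le_max_right y 0)
        rw [calVy_add (hL p).integrableOn_Ioi (hL p').integrableOn_Ioi (le_max_right y 0)] at this
        exact this
      map_smul' := fun a p => by
        ext y
        have heq := NeumannSol.eqOn (S.continuous_z k lam)
          (fun y => by rw [re_z]; exact h.re_pos.le) (h.riccati.neumannSol (hsrc (a • p)))
          ((h.riccati.neumannSol (hsrc p)).const_mul a)
          (Eventually.of_forall fun y => by simp [src]; ring)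
        have := calVy_congr (heq.mono Ioi_subset_Ici_self) (le_max_right y 0)
        rw [calVy_const_mul] at this
        exact this }
    (2 * S.M * (|k| / lam.re)) fun p =>
      (BoundedContinuousFunction.norm_le (mul_nonneg h.coef_nonneg (norm_nonneg p))).2 (hbd p)

lemma Admissible.nonlocalOp_apply (h : S.Admissible k lam q c A) (p : ℝ →ᵇ ℂ) {y : ℝ}
    (hy : 0 ≤ y) : h.nonlocalOp p y = calVy (neumannOp q (S.src k p)) y := by
  show calVy (neumannOp q (S.src k p)) (max y 0) = _
  rw [max_eq_left hy]

/-- Writing `p = t B p + b`, the function `neumannOp q (src p)` solves the equation with nonlocal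
coefficient `t` and source `b`. The energy estimate therefore bounds `B p` by `b` alone, uniformly
in `t`, and then `p` by the triangle inequality. -/
lemma Admissible.norm_sub_nonlocalOp (h : S.Admissible k lam q c A) (t : ℝ) (ht0 : 0 ≤ t)
    (ht1 : t ≤ 1) (p : ℝ →ᵇ ℂ) : ‖p‖ ≤
      (1 + 2 * S.M * (|k| / lam.re)) * ‖p - (t : ℂ) • h.nonlocalOp p‖ := by
  set b := p - (t : ℂ) • h.nonlocalOp p with hb
  have hp : p = (t : ℂ) • h.nonlocalOp p + b := by rw [hb]; abel
  have hw := h.wsq_neumannOp_src_le (t := t) p.continuous (norm_le_linear p) b.continuous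
    (norm_le_linear b) (fun y hy => by
      conv_lhs => rw [hp]
      rw [BoundedContinuousFunction.add_apply, BoundedContinuousFunction.smul_apply,
        h.nonlocalOp_apply p hy, smul_eq_mul])
  have hL := (h.riccati.weightedL2_neumannOp
    (S.weightedL2_src k p.continuous (norm_le_linear p))).1
  have hB : ‖h.nonlocalOp p‖ ≤ 2 * S.M * (|k| / lam.re) * ‖b‖ := by
    refine (BoundedContinuousFunction.norm_le (mul_nonneg h.coef_nonneg (norm_nonneg b))).2
      fun y => ?_
    exact norm_calVy_le hL (mul_nonneg h.coef_nonneg (norm_nonneg b))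
      (hw.trans (le_of_eq (by ring))) (le_max_right y 0)
  have h1 : ‖p‖ ≤ ‖(t : ℂ) • h.nonlocalOp p‖ + ‖b‖ := by
    conv_lhs => rw [hp]
    exact norm_add_le _ _
  rw [norm_smul, Complex.norm_real, Real.norm_of_nonneg ht0] at h1
  have h2 : t * ‖h.nonlocalOp p‖ ≤ ‖h.nonlocalOp p‖ := mul_le_of_le_one_left (norm_nonneg _) ht1
  linarith

/-- Solutions of the vorticity equation with Neumann condition exist, as a sum of a solution of
the local equation and of a solution with source relative to `U_s''`. -/
theorem Admissible.exists_vorticitySol (h : S.Admissible k lam q c A) {w : ℝ → ℂ}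
    (hw : WeightedL2 w) : ∃ p : ℝ →ᵇ ℂ,
      VorticitySol S k lam w (fun y => neumannOp q w y + neumannOp q (S.src k p) y) ∧
      ∀ y, 0 ≤ y → p y = calVy (neumannOp q (S.src k p)) y + calVy (neumannOp q w) y := by
  obtain ⟨hf0, -⟩ := h.riccati.weightedL2_neumannOp hw
  have hN := Real.sqrt_nonneg (wsq (neumannOp q w))
  set b : ℝ →ᵇ ℂ := BoundedContinuousFunction.ofNormedAddCommGroup
    (fun y => calVy (neumannOp q w) (max y 0))
    (ContinuousOn.comp_max_zero (continuousOn_calVy hf0.integrableOn_Ioi)) _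
    (fun y => norm_calVy_le hf0 hN (Real.sq_sqrt (wsq_nonneg _)).ge (le_max_right y 0))
  -- With `f` the full solution and `f0 = neumannOp q w`, the unknown `p = V_y[f]` satisfies `p - B
  -- p = V_y[f0]`.
  obtain ⟨p, hp⟩ := exists_sub_apply_eq h.nonlocalOp (add_nonneg zero_le_one h.coef_nonneg)
    h.norm_sub_nonlocalOp b
  have hpe : ∀ y, 0 ≤ y → p y = calVy (neumannOp q (S.src k p)) y + calVy (neumannOp q w) y := by
    intro y hy
    have h1 : (p - h.nonlocalOp p) y = b y := by rw [hp]
    rw [BoundedContinuousFunction.sub_apply, h.nonlocalOp_apply p hy] at h1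
    have h2 : b y = calVy (neumannOp q w) y := by
      show calVy (neumannOp q w) (max y 0) = _
      rw [max_eq_left hy]
    rw [h2] at h1
    linear_combination h1
  have hs := S.weightedL2_src k p.continuous (norm_le_linear p)
  have hL := (h.riccati.weightedL2_neumannOp hs).1
  refine ⟨p, ?_, hpe⟩
  refine ((h.riccati.neumannSol hw).add (h.riccati.neumannSol hs)).congr_source ?_
  filter_upwards [src_congr (S := S) (k := k) (p := p) (p' := calVy fun y => neumannOp q w y +
    neumannOp q (S.src k p) y) (fun y hy => by
      rw [calVy_add hf0.integrableOn_Ioi hL.integrableOn_Ioi hy, hpe y hy, add_comm])] with y hy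
  rw [hy]

lemma _root_.TripleDeck.VorticitySol.add {w w' f f' : ℝ → ℂ} (h : VorticitySol S k lam w f)
    (h' : VorticitySol S k lam w' f') :
    VorticitySol S k lam (fun y => w y + w' y) fun y => f y + f' y := by
  refine (NeumannSol.add h h').congr_source ?_
  filter_upwards [src_congr (S := S) (k := k) (fun y hy => calVy_add h.1.integrableOn_Ioi
    h'.1.integrableOn_Ioi hy)] with y hy
  rw [hy, src, src, src]
  ring

lemma _root_.TripleDeck.VorticitySol.const_mul {w f : ℝ → ℂ} (h : VorticitySol S k lam w f)
    (a : ℂ) : VorticitySol S k lam (fun y => a * w y) fun y => a * f y := by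
  refine (NeumannSol.const_mul h a).congr_source (Eventually.of_forall fun y => ?_)
  simp only [src, calVy_const_mul]
  ring

/-- With no source, the energy estimate with `t = 1` and `C0 = 0` forces `V_y[f] = 0`. The equation
then becomes local, and `HasTwoDerivs.eq_zero` applies. -/
lemma Admissible.eq_zero (h : S.Admissible k lam q c A) {w f : ℝ → ℂ}
    (hf : VorticitySol S k lam w f) (hw : ∀ᵐ y ∂volume.restrict (Ioi 0), w y = 0) {y : ℝ}
    (hy : 0 ≤ y) : f y = 0 := by
  have hfi := hf.1.integrableOn_Ioi
  have hz0 : ∀ y, 0 ≤ (S.z k lam y).re := fun y => by rw [re_z]; exact h.re_pos.le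
  set p : ℝ → ℂ := fun y => calVy f (max y 0)
  have hp : Continuous p := ContinuousOn.comp_max_zero (continuousOn_calVy hfi)
  have hpe : ∀ y, 0 ≤ y → p y = calVy f y := fun y hy => by simp only [p, max_eq_left hy]
  have hpC : ∀ y, 0 ≤ y → ‖p y‖ ≤ Real.sqrt (wsq f) * (1 + y) := fun y hy => by
    rw [hpe y hy]
    exact (norm_calVy_le hf.1 (Real.sqrt_nonneg _) (Real.sq_sqrt (wsq_nonneg _)).ge hy).trans
      (le_mul_of_one_le_right (Real.sqrt_nonneg _) (by linarith))
  have hs := S.weightedL2_src k hp hpC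
  have heq : EqOn f (neumannOp q (S.src k p)) (Ici 0) := by
    refine NeumannSol.eqOn (S.continuous_z k lam) hz0 hf (h.riccati.neumannSol hs) ?_
    filter_upwards [hw, src_congr (S := S) (k := k) hpe] with y h1 h2
    rw [h1, h2, zero_add]
  have hcv : ∀ y, 0 ≤ y → p y = calVy (neumannOp q (S.src k p)) y := fun y hy => by
    rw [hpe y hy, calVy_congr (heq.mono Ioi_subset_Ici_self) hy]
  have hw0 := h.wsq_neumannOp_src_le (t := 1) (p0 := fun _ => 0) (C0 := 0) hp hpC continuous_const
    (by simp) (fun y hy => by rw [hcv y hy]; simp)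
  have hp0 : ∀ y, 0 ≤ y → calVy f y = 0 := fun y hy => by
    rw [← hpe y hy, hcv y hy, ← norm_le_zero_iff]
    exact norm_calVy_le (h.riccati.weightedL2_neumannOp hs).1 le_rfl
      (hw0.trans (le_of_eq (by ring))) hy
  obtain ⟨hL, f1, h1, h10⟩ := hf
  refine HasTwoDerivs.eq_zero (S.continuous_z k lam) hz0 (h1.congr_ae ?_) hL.integrableOn_sq
    (by rw [h10]; simp) hy
  filter_upwards [hw, src_congr (S := S) (k := k) hp0] with y e1 e2
  rw [e1, e2, src]
  ring

lemma Admissible.eqOn (h : S.Admissible k lam q c A) {w w' f f' : ℝ → ℂ}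
    (hf : VorticitySol S k lam w f) (hf' : VorticitySol S k lam w' f')
    (hw : ∀ᵐ y ∂volume.restrict (Ioi 0), w y = w' y) : EqOn f f' (Ici 0) := by
  intro y hy
  have := h.eq_zero (hf.add (hf'.const_mul (-1))) (by
    filter_upwards [hw] with y hy
    rw [hy]; ring) hy
  linear_combination this

/-- The bound for sources relative to `U_s''`. -/
theorem Admissible.exists_sol_src (h : S.Admissible k lam q c A) {p0 : ℝ → ℂ} {C0 : ℝ}
    (hp0 : Continuous p0) (hp0C : ∀ y, 0 ≤ y → ‖p0 y‖ ≤ C0 * (1 + y)) :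
    ∃ f, VorticitySol S k lam (S.src k p0) f ∧
      wsq f ≤ (2 * S.M * C0 * (|k| / lam.re)) ^ 2 := by
  have hs0 := S.weightedL2_src k hp0 hp0C
  obtain ⟨p, hf, hp⟩ := h.exists_vorticitySol hs0
  have hs := S.weightedL2_src k p.continuous (norm_le_linear p)
  have hpc : Continuous fun y => p y + p0 y := p.continuous.add hp0
  have hpC : ∀ y, 0 ≤ y → ‖p y + p0 y‖ ≤ (‖p‖ + C0) * (1 + y) := fun y hy => by
    have := norm_add_le (p y) (p0 y)
    have := norm_le_linear p y hy
    have := hp0C y hy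
    linarith
  have hs' := S.weightedL2_src k hpc hpC
  -- The whole solution is `neumannOp` of one source relative to `U_s''`, with density `p + p0`;
  -- only in this form does the energy estimate apply to the sum.
  have heq : EqOn (fun y => neumannOp q (S.src k p0) y + neumannOp q (S.src k p) y)
      (neumannOp q (S.src k fun y => p y + p0 y)) (Ici 0) := by
    refine NeumannSol.eqOn (S.continuous_z k lam) (fun y => by rw [re_z]; exact h.re_pos.le)
      ((h.riccati.neumannSol hs0).add (h.riccati.neumannSol hs)) (h.riccati.neumannSol hs')
      (Eventually.of_forall fun y => ?_)
    simp only [src]; ring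
  refine ⟨_, hf, ?_⟩
  rw [wsq_congr (heq.mono Ioi_subset_Ici_self)]
  refine h.wsq_neumannOp_src_le (t := 1) hpc hpC hp0 hp0C fun y hy => ?_
  rw [← calVy_congr (heq.mono Ioi_subset_Ici_self) hy,
    calVy_add (h.riccati.weightedL2_neumannOp hs0).1.integrableOn_Ioi
      (h.riccati.weightedL2_neumannOp hs).1.integrableOn_Ioi hy, hp y hy]
  push_cast; ring

/-- The bound for sources in the weighted space. -/
theorem Admissible.exists_sol (h : S.Admissible k lam q c A) {w : ℝ → ℂ} (hw : WeightedL2 w) :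
    ∃ f g, VorticitySol S k lam w (fun y => f y + g y) ∧ WeightedL2 f ∧ WeightedL2 g ∧
      wsq f ≤ (2 / c ^ 2 * weightedNorm w) ^ 2 ∧
      wsq g ≤ (2 * S.M * (2 / c ^ 2 * weightedNorm w) * (|k| / lam.re)) ^ 2 := by
  obtain ⟨p, hf, hp⟩ := h.exists_vorticitySol hw
  obtain ⟨hL, hLw⟩ := h.riccati.weightedL2_neumannOp hw
  have hs := S.weightedL2_src k p.continuous (norm_le_linear p)
  have hc := h.riccati.c_pos
  have hwn := weightedNorm_nonneg w
  have hb : wsq (neumannOp q w) ≤ (2 / c ^ 2 * weightedNorm w) ^ 2 := by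
    refine hLw.trans ?_
    rw [← weightedNorm_sq hw, mul_pow, div_pow, ← pow_mul]
    gcongr
    norm_num
  have hV : ∀ y, 0 ≤ y → ‖calVy (neumannOp q w) y‖ ≤ 2 / c ^ 2 * weightedNorm w := fun y hy =>
    norm_calVy_le hL (by positivity) hb hy
  refine ⟨_, _, hf, hL, (h.riccati.weightedL2_neumannOp hs).1, hb, ?_⟩
  refine h.wsq_neumannOp_src_le (t := 1) p.continuous (norm_le_linear p)
    (p0 := fun y => calVy (neumannOp q w) (max y 0))
    (ContinuousOn.comp_max_zero (continuousOn_calVy hL.integrableOn_Ioi)) (fun y hy => ?_)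
    fun y hy => ?_
  · rw [max_eq_left hy]
    exact (hV y hy).trans (le_mul_of_one_le_right (by positivity) (by linarith))
  · rw [max_eq_left hy, hp y hy]; simp

end ShearData

/-! ### Bounded solutions of the Riccati equation -/

open BoundedContinuousFunction

section Bounded

variable {a s : ℝ → ℂ} {c K : ℝ}

lemma integrableOn_mul_intFac_inv_of_bounded (ha : Continuous a) (hc : ∀ y, c ≤ (a y).re)
    (hc0 : 0 < c) (hs : Continuous s) (hK : ∀ y, ‖s y‖ ≤ K) (y : ℝ) :
    IntegrableOn (fun z => s z * (intFac a z)⁻¹) (Ioi y) := by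
  refine (((integrableOn_exp_neg_mul_sub hc0 y).const_mul (‖(intFac a y)⁻¹‖ * K))).mono'
    (hs.mul (continuous_intFac_inv ha)).aestronglyMeasurable ?_
  filter_upwards [ae_restrict_mem measurableSet_Ioi] with z hz
  have h1 := norm_intFac_mul_inv_le ha hc (le_of_lt hz)
  have h2 : (intFac a z)⁻¹ = (intFac a y)⁻¹ * (intFac a y * (intFac a z)⁻¹) := by
    rw [inv_mul_cancel_left₀ (intFac_ne_zero y)]
  rw [h2, norm_mul, norm_mul, mul_left_comm, ← mul_assoc]
  have := hK z
  have := (norm_nonneg (s z)).trans (hK z)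
  gcongr

lemma norm_backSol_le_of_bounded (ha : Continuous a) (hc : ∀ y, c ≤ (a y).re)
    (hc0 : 0 < c) (hK : ∀ y, ‖s y‖ ≤ K) (y : ℝ) : ‖backSol a s y‖ ≤ K / c := by
  refine (norm_backSol_le ha hc (F := fun _ => K)
    ((integrableOn_exp_neg_mul_sub hc0 y).mul_const K) (Eventually.of_forall hK)).trans
    (le_of_eq ?_)
  rw [integral_mul_const, integral_exp_neg_mul_sub hc0]
  ring

lemma backSol_sub {s' : ℝ → ℂ} {y : ℝ}
    (hs : IntegrableOn (fun z => s z * (intFac a z)⁻¹) (Ioi y))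
    (hs' : IntegrableOn (fun z => s' z * (intFac a z)⁻¹) (Ioi y)) :
    backSol a s y - backSol a s' y = backSol a (fun z => s z - s' z) y := by
  rw [backSol, backSol, backSol, ← mul_sub, ← integral_sub hs hs']
  simp only [sub_mul]

end Bounded

/-- A bounded solution of `r' = 2 Q r - (Q' - r^2)`, obtained by contraction. -/
lemma exists_riccati_correction {Q Q' : ℝ → ℂ} {m β : ℝ} (hQ : Continuous Q) (hQ' : Continuous Q')
    (hm : 0 < m) (hQm : ∀ y, m ≤ (Q y).re) (hβ : ∀ y, ‖Q' y‖ ≤ β) (hβm : β ≤ m ^ 2 / 2) :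
    ∃ r : ℝ → ℂ, (∀ y, HasDerivAt r (2 * Q y * r y - (Q' y - r y ^ 2)) y) ∧
      ∀ y, ‖r y‖ ≤ β / m := by
  have hβ0 : 0 ≤ β := (norm_nonneg _).trans (hβ 0)
  have ha : Continuous fun y => 2 * Q y := by fun_prop
  have hac : ∀ y, 2 * m ≤ (2 * Q y).re := fun y => by simp; linarith [hQm y]
  have hsc : ∀ r : ℝ →ᵇ ℂ, Continuous fun y => Q' y - r y ^ 2 := fun r => by fun_prop
  have hsb : ∀ (r : ℝ →ᵇ ℂ) (y : ℝ), ‖Q' y - r y ^ 2‖ ≤ β + ‖r‖ ^ 2 := fun r y => by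
    refine (norm_sub_le _ _).trans (add_le_add (hβ y) ?_)
    rw [norm_pow]
    have := r.norm_coe_le_norm y
    gcongr
  have h2m : 0 < 2 * m := by linarith
  have hint := fun (r : ℝ →ᵇ ℂ) =>
    integrableOn_mul_intFac_inv_of_bounded ha hac h2m (hsc r) (hsb r)
  -- With `Q² = z`, the sum `Q + r` solves the Riccati equation exactly when `r' = 2Qr - (Q' - r²)`.
  -- As `Re 2Q ≥ 2m`, a bounded solution must be integrated from infinity.
  set T : (ℝ →ᵇ ℂ) → (ℝ →ᵇ ℂ) := fun r => BoundedContinuousFunction.ofNormedAddCommGroup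
    (backSol (fun y => 2 * Q y) fun y => Q' y - r y ^ 2)
    (continuous_backSol ha (hint r)) _ (norm_backSol_le_of_bounded ha hac h2m (hsb r)) with hT
  have hTapp : ∀ r y, T r y = backSol (fun y => 2 * Q y) (fun y => Q' y - r y ^ 2) y :=
    fun r y => rfl
  set B : Set (ℝ →ᵇ ℂ) := Metric.closedBall 0 (β / m) with hB
  have hmem : ∀ r, r ∈ B ↔ ‖r‖ ≤ β / m := fun r => by rw [hB, mem_closedBall_zero_iff]
  have hρ0 : 0 ≤ β / m := by positivity
  -- On the ball of radius `β/m` the quadratic term is at most `β/2`, so the image is bounded by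
  -- `2β/(2m)`.
  have hρ : (β / m) ^ 2 ≤ β / 2 := by
    rw [div_pow, div_le_iff₀ (by positivity)]
    nlinarith
  have hmaps : MapsTo T B B := by
    intro r hr
    rw [hmem] at hr ⊢
    refine (BoundedContinuousFunction.norm_le hρ0).2 fun y => ?_
    refine (norm_backSol_le_of_bounded ha hac h2m (hsb r) y).trans ?_
    have : ‖r‖ ^ 2 ≤ (β / m) ^ 2 := by gcongr
    calc (β + ‖r‖ ^ 2) / (2 * m) ≤ (2 * β) / (2 * m) := by gcongr; linarith
      _ = β / m := by field_simp
  have hlip : ∀ r ∈ B, ∀ r' ∈ B, dist (T r) (T r') ≤ 1 / 2 * dist r r' := by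
    intro r hr r' hr'
    rw [hmem] at hr hr'
    rw [dist_eq_norm, dist_eq_norm]
    refine (BoundedContinuousFunction.norm_le (by positivity)).2 fun y => ?_
    rw [BoundedContinuousFunction.sub_apply, hTapp, hTapp, backSol_sub (hint r y) (hint r' y)]
    refine (norm_backSol_le_of_bounded ha hac h2m (K := 2 * (β / m) * ‖r - r'‖) (fun y => ?_) y).trans ?_
    · have e : Q' y - r y ^ 2 - (Q' y - r' y ^ 2) = -((r y + r' y) * ((r - r') y)) := by
        rw [BoundedContinuousFunction.sub_apply]; ring
      rw [e, norm_neg, norm_mul]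
      have h1 : ‖r y + r' y‖ ≤ 2 * (β / m) := by
        have := norm_add_le (r y) (r' y)
        have := r.norm_coe_le_norm y
        have := r'.norm_coe_le_norm y
        linarith
      have h2 := (r - r').norm_coe_le_norm y
      gcongr
    · have h3 : 2 * (β / m) / (2 * m) ≤ 1 / 2 := by
        rw [div_le_iff₀ h2m]
        have : β / m ≤ m / 2 := by rw [div_le_iff₀ hm]; nlinarith
        linarith
      calc _ = 2 * (β / m) / (2 * m) * ‖r - r'‖ := by ring
        _ ≤ _ := by gcongr
  have hcontr : ContractingWith (1 / 2) (hmaps.restrict T B B) := by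
    refine ⟨by rw [← NNReal.coe_lt_coe]; norm_num, LipschitzWith.of_dist_le_mul fun r r' => ?_⟩
    have h1 := hlip r r.2 r' r'.2
    rw [Subtype.dist_eq, Subtype.dist_eq, MapsTo.val_restrict_apply, MapsTo.val_restrict_apply]
    simpa using h1
  obtain ⟨r, hrB, hr, -⟩ := hcontr.exists_fixedPoint' Metric.isClosed_closedBall.isComplete hmaps
    (x := 0) ((hmem 0).2 (by simpa using hρ0)) (edist_ne_top _ _)
  rw [hmem] at hrB
  refine ⟨r, fun y => ?_, fun y => (r.norm_coe_le_norm y).trans hrB⟩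
  have h1 := hasDerivAt_backSol ha (hint r) (hsc r) y
  have h2 : (r : ℝ → ℂ) = backSol (fun y => 2 * Q y) fun y => Q' y - r y ^ 2 := by
    conv_lhs => rw [← hr.eq]
    rfl
  rwa [← h2] at h1

/-- Decay of a positive function from a differential inequality. -/
lemma integral_Ioi_le_of_deriv_le {F F' u : ℝ → ℝ} (hu : Continuous u) (hu0 : ∀ y, 0 ≤ u y)
    (hF : ∀ y, HasDerivAt F (F' y) y) (hF0 : ∀ y, 0 ≤ F y) (hFu : ∀ y, 0 < y → F' y ≤ -(u y / 2))
    {y : ℝ} (hy : 0 ≤ y) : IntegrableOn u (Ioi y) ∧ ∫ t in Ioi y, u t ≤ 2 * F y := by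
  -- Since `F ≥ 0`, a decrease of `F` at rate at least `u/2` bounds the integral of `u` by twice the
  -- starting value.
  have hanti : AntitoneOn (fun Y => F Y + 1 / 2 * ∫ t in (0:ℝ)..Y, u t) (Ici 0) := by
    have hd : ∀ Y, HasDerivAt (fun Y => F Y + 1 / 2 * ∫ t in (0:ℝ)..Y, u t)
        (F' Y + 1 / 2 * u Y) Y := fun Y =>
      (hF Y).add ((intervalIntegral.integral_hasDerivAt_right (hu.intervalIntegrable _ _)
        (hu.stronglyMeasurableAtFilter _ _) hu.continuousAt).const_mul _)
    refine antitoneOn_of_hasDerivWithinAt_nonpos (convex_Ici 0)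
      (fun Y _ => (hd Y).continuousAt.continuousWithinAt)
      (fun Y _ => (hd Y).hasDerivWithinAt) fun Y hY => ?_
    have := hFu Y (by simpa using hY)
    linarith
  have hbd : ∀ x Y, 0 ≤ x → x ≤ Y → ∫ t in x..Y, u t ≤ 2 * F x := by
    intro x Y hx hxY
    have h1 := hanti (mem_Ici.2 hx) (mem_Ici.2 (hx.trans hxY)) hxY
    have h2 := intervalIntegral.integral_add_adjacent_intervals (hu.intervalIntegrable (μ := volume) 0 x)
      (hu.intervalIntegrable x Y)
    have h3 := hF0 Y
    simp only at h1
    linarith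
  have hi := (integrableOn_Ioi_of_bounded hu.continuousOn (fun y _ => hu0 y)
    (fun Y hY => hbd 0 Y le_rfl hY)).1.mono_set (Ioi_subset_Ioi hy)
  refine ⟨hi, le_of_tendsto (intervalIntegral_tendsto_integral_Ioi y hi tendsto_id) ?_⟩
  filter_upwards [eventually_ge_atTop y] with Y hY using hbd y Y hy hY

/-! ### The square root of the symbol -/

namespace ShearData

variable (S : ShearData) (k : ℝ) (lam : ℂ)

/-- The principal square root of `λ + i k V_s`. -/
def root (y : ℝ) : ℂ := Complex.exp (Complex.log (S.z k lam y) / 2)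

/-- The derivative of `root`. -/
def rootDeriv (y : ℝ) : ℂ := Complex.I * k * (S.b y : ℂ) / (2 * S.root k lam y)

variable {S k lam}

lemma z_ne_zero (hμ : 0 < lam.re) (y : ℝ) : S.z k lam y ≠ 0 := by
  intro h
  have := congrArg Complex.re h
  rw [re_z] at this
  exact hμ.ne' this

lemma root_ne_zero (y : ℝ) : S.root k lam y ≠ 0 := Complex.exp_ne_zero _

lemma root_sq (hμ : 0 < lam.re) (y : ℝ) : S.root k lam y ^ 2 = S.z k lam y := by
  rw [root, ← Complex.exp_nat_mul]
  push_cast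
  rw [mul_div_cancel₀ _ two_ne_zero, Complex.exp_log (z_ne_zero hμ y)]

lemma root_re_pos (hμ : 0 < lam.re) (y : ℝ) : 0 < (S.root k lam y).re := by
  rw [root, Complex.exp_re]
  refine mul_pos (Real.exp_pos _) (Real.cos_pos_of_mem_Ioo ?_)
  have h1 : (Complex.log (S.z k lam y) / 2).im = (S.z k lam y).arg / 2 := by
    rw [Complex.div_ofNat_im, Complex.log_im]
  have h2 : |(S.z k lam y).arg| < Real.pi / 2 :=
    Complex.abs_arg_lt_pi_div_two_iff.2 (Or.inl (by rwa [re_z]))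
  rw [abs_lt] at h2
  have := Real.pi_pos
  rw [h1]
  constructor <;> linarith

/-- Real part of `Q² = z`, where `Re z = Re λ` for every `y`. It gives both the lower bound on `Re
Q` and the comparability of `|Q|` with `Re Q`. -/
lemma root_re_sq (hμ : 0 < lam.re) (y : ℝ) :
    (S.root k lam y).re ^ 2 = lam.re + (S.root k lam y).im ^ 2 := by
  have h := congrArg Complex.re (root_sq (S := S) (k := k) hμ y)
  rw [re_z, sq, Complex.mul_re] at h
  linarith

lemma sqrt_le_root_re (hμ : 0 < lam.re) (y : ℝ) : Real.sqrt lam.re ≤ (S.root k lam y).re := by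
  rw [Real.sqrt_le_left (root_re_pos hμ y).le, root_re_sq hμ]
  nlinarith [sq_nonneg (S.root k lam y).im]

lemma norm_root_sq_le (hμ : 0 < lam.re) (y : ℝ) :
    ‖S.root k lam y‖ ^ 2 ≤ 2 * (S.root k lam y).re ^ 2 := by
  have := root_re_sq (S := S) (k := k) hμ y
  rw [← Complex.normSq_eq_norm_sq, Complex.normSq_apply]
  nlinarith

lemma sqrt_le_norm_root (hμ : 0 < lam.re) (y : ℝ) : Real.sqrt lam.re ≤ ‖S.root k lam y‖ :=
  (sqrt_le_root_re hμ y).trans (Complex.re_le_norm _)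

lemma hasDerivAt_z (y : ℝ) : HasDerivAt (S.z k lam) (Complex.I * k * (S.b y : ℂ)) y :=
  ((S.hasDerivAt_v y).ofReal_comp.const_mul _).const_add lam

lemma hasDerivAt_root (hμ : 0 < lam.re) (y : ℝ) :
    HasDerivAt (S.root k lam) (S.rootDeriv k lam y) y := by
  have h1 : S.z k lam y ∈ Complex.slitPlane := Or.inl (by rwa [re_z])
  have h2 := (((hasDerivAt_z (S := S) (k := k) (lam := lam) y).clog_real h1).div_const 2).cexp
  convert! h2 using 1
  have h3 := root_ne_zero (S := S) (k := k) (lam := lam) y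
  have h4 := root_sq (S := S) (k := k) hμ y
  change _ = S.root k lam y * _
  rw [rootDeriv, ← h4]
  field_simp

lemma continuous_root (hμ : 0 < lam.re) : Continuous (S.root k lam) :=
  continuous_iff_continuousAt.2 fun y => (hasDerivAt_root hμ y).continuousAt

lemma continuous_rootDeriv (hμ : 0 < lam.re) : Continuous (S.rootDeriv k lam) := by
  have := S.continuous_b
  have := continuous_root (S := S) (k := k) hμ
  unfold rootDeriv
  refine Continuous.div (by fun_prop) (by fun_prop) fun y => ?_
  exact mul_ne_zero two_ne_zero (root_ne_zero y)

lemma norm_rootDeriv_le (hμ : 0 < lam.re) (y : ℝ) :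
    ‖S.rootDeriv k lam y‖ ≤ |k| * S.bM / (2 * Real.sqrt lam.re) := by
  have h1 := sqrt_le_norm_root (S := S) (k := k) hμ y
  have h2 := S.abs_b_le y
  have h3 := Real.sqrt_pos.2 hμ
  have := S.bM_pos
  rw [rootDeriv, norm_div, norm_mul, norm_mul, norm_mul, Complex.norm_I, one_mul, Complex.norm_real,
    Complex.norm_real, Complex.norm_ofNat, Real.norm_eq_abs, Real.norm_eq_abs]
  gcongr

lemma norm_root_zero_sq (hμ : 0 < lam.re) : ‖S.root k lam 0‖ ^ 2 = ‖lam‖ := by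
  rw [← norm_pow, root_sq hμ, z_zero]

/-! ### The boundary layer -/

/-- The Riccati equation has a solution close to the square root of the symbol. -/
theorem exists_riccati (h576 : 576 ≤ lam.re)
    (hε : |k| * S.bM / (2 * Real.sqrt lam.re) ≤ lam.re / 16) :
    ∃ (q : ℝ → ℂ) (A : ℝ), Riccati (S.z k lam) q (Real.sqrt lam.re / 2) A ∧ 0 ≤ A ∧
      ∀ y, ‖q y - S.root k lam y‖ ≤ Real.sqrt lam.re / 16 := by
  have hμ : 0 < lam.re := by linarith
  set m := Real.sqrt lam.re with hm
  have hm0 : 0 < m := Real.sqrt_pos.2 hμ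
  have hmsq : m ^ 2 = lam.re := Real.sq_sqrt hμ.le
  -- Since `576 = 24²`, the rate `c = m/2` reaches the value `12` required by the weighted estimate
  -- for `fwdSol`.
  have hm24 : 24 ≤ m := by rw [hm]; exact Real.le_sqrt_of_sq_le (by linarith)
  set β := |k| * S.bM / (2 * m) with hβ
  have hb := S.bM_pos
  have hβ0 : 0 ≤ β := by positivity
  obtain ⟨r, hr, hrb⟩ := exists_riccati_correction (continuous_root (S := S) (k := k) hμ)
    (continuous_rootDeriv (S := S) (k := k) hμ) hm0 (sqrt_le_root_re hμ) (norm_rootDeriv_le hμ)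
    (by rw [hmsq]; linarith)
  have hrb' : ∀ y, ‖r y‖ ≤ m / 16 := fun y => (hrb y).trans (by
    rw [div_le_iff₀ hm0]; nlinarith)
  have hv : ∀ y, 0 ≤ y → |S.v y| ≤ S.bM * y := by
    intro y hy
    have := Convex.norm_image_sub_le_of_norm_hasDerivWithin_le (f := S.v) (s := univ)
      (fun x _ => (S.hasDerivAt_v x).hasDerivWithinAt) (fun x _ => S.abs_b_le x) convex_univ
      (mem_univ 0) (mem_univ y)
    simpa [S.v_zero, abs_of_nonneg hy] using this
  refine ⟨fun y => S.root k lam y + r y, 1 + ‖lam‖ + |k| * S.bM + m / 16, ⟨S.continuous_z k lam,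
    fun y => ?_, fun y => ?_, by linarith, fun y => by rw [re_z]; exact hμ.le, fun y hy => ?_⟩,
    by positivity, fun y => by simpa using hrb' y⟩
  · convert! (hasDerivAt_root hμ y).add (hr y) using 1
    rw [← root_sq hμ]; ring
  · have h1 := (Complex.abs_re_le_norm (r y)).trans (hrb' y)
    have h2 := sqrt_le_root_re (S := S) (k := k) hμ y
    have h3 := (abs_le.1 h1).1
    rw [Complex.add_re]
    linarith
  · have h1 : ‖S.root k lam y‖ ≤ 1 + ‖S.z k lam y‖ := by
      rw [← root_sq hμ, norm_pow]
      nlinarith [sq_nonneg (‖S.root k lam y‖ - 1)]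
    have h2 : ‖S.z k lam y‖ ≤ ‖lam‖ + |k| * (S.bM * y) := by
      refine (norm_add_le _ _).trans ?_
      rw [norm_mul, norm_mul, Complex.norm_I, one_mul, Complex.norm_real, Complex.norm_real, Real.norm_eq_abs,
        Real.norm_eq_abs]
      have := hv y hy
      gcongr
    have h3 := norm_add_le (S.root k lam y) (r y)
    have h4 := hrb' y
    have h5 : 0 ≤ (1 + ‖lam‖ + m / 16) * y := by positivity
    have h6 : 0 ≤ |k| * S.bM := by positivity
    linarith

end ShearData

/-- The decaying solution `exp(-∫_0^y q)` of the local equation. -/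
def layer (q : ℝ → ℂ) (y : ℝ) : ℂ := (intFac q y)⁻¹

section Layer

variable {z q : ℝ → ℂ} {c A : ℝ}

@[simp] lemma layer_zero : layer q 0 = 1 := by simp [layer]

lemma Riccati.hasTwoDerivs_layer (h : Riccati z q c A) :
    HasTwoDerivs (layer q) (fun y => -q y * layer q y) (fun y => z y * layer q y) := by
  have hd : ∀ y, HasDerivAt (layer q) (-q y * layer q y) y := hasDerivAt_intFac_inv h.continuous
  have hc : Continuous (layer q) := continuous_intFac_inv h.continuous
  have hd2 : ∀ y, HasDerivAt (fun y => -q y * layer q y) (z y * layer q y) y := fun y => by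
    convert! (h.hasDerivAt y).neg.mul (hd y) using 1
    simp only [Pi.neg_apply]; ring
  have hi : ∀ y, IntervalIntegrable (fun y => z y * layer q y) volume 0 y := fun y =>
    (h.continuous_z.mul hc).intervalIntegrable _ _
  exact ⟨fun y _ => (hd y).hasDerivWithinAt, fun y _ => hi y, fun y _ => by
    rw [intervalIntegral.integral_eq_sub_of_hasDerivAt (fun t _ => hd2 t) (hi y)]; ring⟩

lemma Riccati.weightedL2_layer (h : Riccati z q c A) : WeightedL2 (layer q) := by
  have h0 : WeightedL2 fun _ => 0 := by
    unfold WeightedL2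
    simp
  have := (h0.fwdSol h.continuous h.le_re h.le_c continuous_const 1).1
  convert! this using 1
  funext y
  simp [layer, fwdSol]

lemma hasDerivAt_norm_layer (hq : Continuous q) (y : ℝ) :
    HasDerivAt (fun y => ‖layer q y‖) (-((q y).re * ‖layer q y‖)) y := by
  have h1 : ∀ y, ‖layer q y‖ = Real.exp (-(∫ t in (0:ℝ)..y, q t).re) := fun y => by
    rw [layer, intFac, ← Complex.exp_neg, Complex.norm_exp, Complex.neg_re]
  have h2 := Complex.reCLM.hasFDerivAt.comp_hasDerivAt y
    (intervalIntegral.integral_hasDerivAt_right (hq.intervalIntegrable 0 y)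
    (hq.stronglyMeasurableAtFilter _ _) hq.continuousAt)
  have h3 := h2.neg.exp
  simp only [h1]
  convert! h3 using 1
  simp [mul_comm]

end Layer

namespace ShearData

variable {S : ShearData} {k : ℝ} {lam : ℂ} {q : ℝ → ℂ} {c A : ℝ}

/-- Bounds for the boundary layer profile. -/
theorem layer_bounds (hμ : 0 < lam.re)
    (hε : |k| * S.bM / (2 * Real.sqrt lam.re) ≤ lam.re / 16) (h : Riccati (S.z k lam) q c A)
    (hq : ∀ y, ‖q y - S.root k lam y‖ ≤ Real.sqrt lam.re / 16) :
    (∀ y, 0 ≤ y → ‖calVy (layer q) y‖ ≤ 8 / ‖lam‖) ∧ |calV fun y => ‖layer q y‖| ≤ 8 / ‖lam‖ ∧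
      1 / (2 * Real.sqrt ‖lam‖) ≤ ‖calU (layer q)‖ := by
  set m := Real.sqrt lam.re with hm
  have hm0 : 0 < m := Real.sqrt_pos.2 hμ
  have hmsq : m ^ 2 = lam.re := Real.sq_sqrt hμ.le
  set Q := S.root k lam with hQ
  set R : ℝ → ℝ := fun y => (Q y).re with hR
  have hRm : ∀ y, m ≤ R y := fun y => sqrt_le_root_re hμ y
  have hR0 : ∀ y, 0 < R y := fun y => hm0.trans_le (hRm y)
  have hRd : ∀ y, HasDerivAt R (S.rootDeriv k lam y).re y := fun y =>
    Complex.reCLM.hasFDerivAt.comp_hasDerivAt y (hasDerivAt_root hμ y)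
  have hRc : Continuous R := continuous_iff_continuousAt.2 fun y => (hRd y).continuousAt
  have hQ'm : ∀ y, ‖S.rootDeriv k lam y‖ ≤ m ^ 2 / 16 := fun y => by
    rw [hmsq]; exact (norm_rootDeriv_le hμ y).trans hε
  have hR' : ∀ y, -(R y ^ 2 / 16) ≤ (S.rootDeriv k lam y).re := fun y => by
    have h1 := (abs_le.1 ((Complex.abs_re_le_norm _).trans (hQ'm y))).1
    have h2 : m ^ 2 ≤ R y ^ 2 := by have := hRm y; gcongr
    linarith
  have hqR : ∀ y, 15 / 16 * R y ≤ (q y).re := fun y => by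
    have h1 := (abs_le.1 ((Complex.abs_re_le_norm _).trans (hq y))).1
    rw [Complex.sub_re] at h1
    have h2 := hRm y
    have h3 : (Q y).re = R y := rfl
    linarith
  set u : ℝ → ℝ := fun y => ‖layer q y‖ with hu
  have hu0 : ∀ y, 0 ≤ u y := fun y => norm_nonneg _
  have hud : ∀ y, HasDerivAt u (-((q y).re * u y)) y := hasDerivAt_norm_layer h.continuous
  have huc : Continuous u := (continuous_intFac_inv h.continuous).norm
  have hu00 : u 0 = 1 := by simp [hu]
  -- The comparison functions `u/R` and `u/R²` decrease at least at the rates `u/2` and `u/(2R)`,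
  -- because `Re q ≥ (15/16) R` and `R' ≥ -R²/16`. Two applications bound the double integral of `u`
  -- by the value of `1/R²` at the wall.
  have hF1 : ∀ y, HasDerivAt (fun y => u y / R y)
      ((-((q y).re * u y) * R y - u y * (S.rootDeriv k lam y).re) / R y ^ 2) y := fun y =>
    (hud y).div (hRd y) (hR0 y).ne'
  have hF2 : ∀ y, HasDerivAt (fun y => u y / R y ^ 2)
      ((-((q y).re * u y) * R y ^ 2 - u y * (2 * R y * (S.rootDeriv k lam y).re)) / (R y ^ 2) ^ 2) y :=
    fun y => by
      convert! (hud y).div ((hRd y).pow 2) (pow_ne_zero 2 (hR0 y).ne') using 1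
      simp
  have htail : ∀ y, 0 ≤ y → IntegrableOn u (Ioi y) ∧ ∫ t in Ioi y, u t ≤ 2 * (u y / R y) :=
    fun y hy => integral_Ioi_le_of_deriv_le huc hu0 hF1
      (fun y => div_nonneg (hu0 y) (hR0 y).le) (fun y _ => by
        rw [div_le_iff₀ (pow_pos (hR0 y) 2)]
        have h1 := mul_le_mul_of_nonneg_left (hqR y) (mul_nonneg (hu0 y) (hR0 y).le)
        have h2 := mul_le_mul_of_nonneg_left (hR' y) (hu0 y)
        have h3 : 0 ≤ u y * R y ^ 2 := mul_nonneg (hu0 y) (sq_nonneg _)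
        nlinarith) hy
  have hT2 := integral_Ioi_le_of_deriv_le (u := fun y => u y / R y)
    (huc.div hRc fun y => (hR0 y).ne') (fun y => div_nonneg (hu0 y) (hR0 y).le) hF2
    (fun y => div_nonneg (hu0 y) (sq_nonneg _)) (fun y _ => by
      have hRp := hR0 y
      have h1 := mul_le_mul_of_nonneg_left (hqR y) (mul_nonneg (hu0 y) (sq_nonneg (R y)))
      have h2 := mul_le_mul_of_nonneg_left (hR' y) (mul_nonneg (hu0 y) (hR0 y).le)
      have h3 : 0 ≤ u y * R y ^ 3 := mul_nonneg (hu0 y) (by positivity)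
      rw [div_le_iff₀ (by positivity)]
      have e : -(u y / R y / 2) * (R y ^ 2) ^ 2 = -(u y * R y ^ 3 / 2) := by field_simp
      rw [e]
      nlinarith) le_rfl
  -- At the wall `Q(0)² = λ`, so the layer is governed by the full modulus of `λ` and not only by
  -- its real part.
  have hR0sq : ‖lam‖ ≤ 2 * R 0 ^ 2 := by
    rw [← norm_root_zero_sq (S := S) (k := k) hμ]
    exact norm_root_sq_le hμ 0
  have hlam : 0 < ‖lam‖ := hμ.trans_le (Complex.re_le_norm lam)
  have hTint : IntegrableOn (fun y => 2 * (u y / R y)) (Ioi 0) := hT2.1.const_mul 2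
  have hTB : ∫ y in Ioi 0, 2 * (u y / R y) ≤ 8 / ‖lam‖ := by
    rw [integral_const_mul]
    refine (mul_le_mul_of_nonneg_left hT2.2 zero_le_two).trans ?_
    have hRp := hR0 0
    simp only [hu00]
    rw [le_div_iff₀ hlam]
    calc 2 * (2 * (1 / R 0 ^ 2)) * ‖lam‖ ≤ 2 * (2 * (1 / R 0 ^ 2)) * (2 * R 0 ^ 2) := by gcongr
      _ = 8 := by field_simp; norm_num
  refine ⟨fun y hy => norm_calVy_le_of_tail hTint
    (fun y _ => mul_nonneg zero_le_two (div_nonneg (hu0 y) (hR0 y).le)) hTB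
    (fun y hy => (norm_integral_le_integral_norm _).trans (htail y hy.le).2) hy,
    abs_calV_norm_le_of_tail hTint hTB (fun y hy => (htail y hy.le).2), ?_⟩
  have hψd : ∀ y, HasDerivAt (layer q) (-q y * layer q y) y := hasDerivAt_intFac_inv h.continuous
  have hψc : Continuous (layer q) := continuous_intFac_inv h.continuous
  -- For the layer `ψ`, `(ψ/Q)' = -(1 + δ)ψ`. Integration gives `1/Q(0) = U[ψ] + ∫ δψ`, so smallness
  -- of `δ` excludes cancellation in the oscillating mean.
  set δ : ℝ → ℂ := fun y => (q y - Q y) / Q y + S.rootDeriv k lam y / Q y ^ 2 with hδ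
  have hQ0 : ∀ y, Q y ≠ 0 := fun y => root_ne_zero y
  have hQc : Continuous Q := continuous_root hμ
  have hQd : ∀ y, HasDerivAt Q (S.rootDeriv k lam y) y := hasDerivAt_root hμ
  have hδc : Continuous δ := ((h.continuous.sub hQc).div hQc hQ0).add
    ((continuous_rootDeriv hμ).div (hQc.pow 2) fun y => pow_ne_zero 2 (hQ0 y))
  have hδb : ∀ y, ‖δ y‖ ≤ 1 / 8 := by
    intro y
    have h1 : m ≤ ‖Q y‖ := sqrt_le_norm_root hμ y
    have hQp : 0 < ‖Q y‖ := hm0.trans_le h1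
    have h2 : ‖(q y - Q y) / Q y‖ ≤ 1 / 16 := by
      rw [norm_div, div_le_iff₀ hQp]
      linarith [hq y]
    have h3 : ‖S.rootDeriv k lam y / Q y ^ 2‖ ≤ 1 / 16 := by
      rw [norm_div, norm_pow, div_le_iff₀ (by positivity)]
      have : m ^ 2 ≤ ‖Q y‖ ^ 2 := by gcongr
      linarith [hQ'm y]
    refine (norm_add_le _ _).trans ?_
    linarith
  have hψi : IntegrableOn (layer q) (Ioi 0) := h.weightedL2_layer.integrableOn_Ioi
  have hδi : IntegrableOn (fun y => δ y * layer q y) (Ioi 0) := by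
    refine (hψi.norm.const_mul (1 / 8)).mono' (hδc.mul hψc).aestronglyMeasurable
      (Eventually.of_forall fun y => ?_)
    rw [norm_mul]
    exact mul_le_mul_of_nonneg_right (hδb y) (norm_nonneg _)
  have hlim : Tendsto (fun y => layer q y / Q y) atTop (𝓝 0) := by
    have hexp : Tendsto (fun y : ℝ => Real.exp (-(c * y)) * m⁻¹) atTop (𝓝 0) := by
      have h1 : Tendsto (fun y : ℝ => -(c * y)) atTop atBot :=
        tendsto_neg_atTop_atBot.comp (tendsto_id.const_mul_atTop h.c_pos)
      simpa using (Real.tendsto_exp_atBot.comp h1).mul_const m⁻¹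
    refine squeeze_zero_norm' ?_ hexp
    filter_upwards [eventually_ge_atTop 0] with y hy
    have h1 : m ≤ ‖Q y‖ := sqrt_le_norm_root hμ y
    rw [norm_div, div_eq_mul_inv]
    have h2 := norm_intFac_inv_le h.continuous h.le_re hy
    have h3 : ‖layer q y‖ ≤ Real.exp (-(c * y)) := h2
    gcongr
  have hFTC := integral_Ioi_of_hasDerivAt_of_tendsto' (a := 0) (f := fun y => layer q y / Q y)
    (f' := fun y => -(layer q y + δ y * layer q y)) (fun y _ => by
      convert! (hψd y).div (hQd y) (hQ0 y) using 1
      simp only [hδ]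
      have := hQ0 y
      field_simp
      ring) (hψi.add hδi).neg hlim
  rw [integral_neg, integral_add hψi hδi] at hFTC
  have hn0 : ‖Q 0‖ = Real.sqrt ‖lam‖ := by
    rw [← norm_root_zero_sq (S := S) (k := k) hμ, Real.sqrt_sq (norm_nonneg _)]
  have hsl : 0 < Real.sqrt ‖lam‖ := Real.sqrt_pos.2 hlam
  have hmain : 1 / Q 0 = calU (layer q) + ∫ y in Ioi 0, δ y * layer q y := by
    rw [calU]
    simp only [layer_zero] at hFTC
    linear_combination hFTC
  have herr : ‖∫ y in Ioi 0, δ y * layer q y‖ ≤ 1 / 8 * (3 / Real.sqrt ‖lam‖) := by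
    have h1 : ∫ t in Ioi 0, u t ≤ 3 / Real.sqrt ‖lam‖ := by
      refine (htail 0 le_rfl).2.trans ?_
      rw [hu00, ← hn0]
      -- Here `√2 ≤ 3/2`. The error is then at most `3/8` of `1/√|λ|`, which leaves more than one
      -- half for the mean.
      have h2 : ‖Q 0‖ ≤ 3 / 2 * R 0 := by
        have h3 := norm_root_sq_le (S := S) (k := k) hμ 0
        have hRp := hR0 0
        refine le_of_sq_le_sq (h3.trans ?_) (by positivity)
        show 2 * R 0 ^ 2 ≤ _
        nlinarith
      have hRp := hR0 0
      rw [le_div_iff₀ (by rw [hn0]; exact hsl)]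
      calc 2 * (1 / R 0) * ‖Q 0‖ ≤ 2 * (1 / R 0) * (3 / 2 * R 0) := by gcongr
        _ = 3 := by field_simp
    refine (norm_integral_le_of_norm_le ((htail 0 le_rfl).1.const_mul (1 / 8))
      (Eventually.of_forall fun y => ?_)).trans ?_
    · rw [norm_mul]
      exact mul_le_mul_of_nonneg_right (hδb y) (norm_nonneg _)
    · rw [integral_const_mul]
      gcongr
  have h1 : ‖(1 / Q 0 : ℂ)‖ ≤ ‖calU (layer q)‖ + ‖∫ y in Ioi 0, δ y * layer q y‖ := by
    rw [hmain]; exact norm_add_le _ _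
  rw [norm_div, norm_one, hn0] at h1
  have e1 : 1 / (2 * Real.sqrt ‖lam‖) = 1 / 2 * (1 / Real.sqrt ‖lam‖) := by field_simp
  have e2 : 1 / 8 * (3 / Real.sqrt ‖lam‖) = 3 / 8 * (1 / Real.sqrt ‖lam‖) := by ring
  have e3 : 0 < 1 / Real.sqrt ‖lam‖ := by positivity
  rw [e1]
  rw [e2] at herr
  linarith

end ShearData

/-! ### The integral `∫_0^∞ ∫_y^∞ |f|` -/

section CalV

variable {f g : ℝ → ℂ}

lemma WeightedL2.integrableOn_tail_norm (hf : WeightedL2 f) :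
    IntegrableOn (fun y => ∫ z in Ioi y, ‖f z‖) (Ioi 0) := by
  have hi : IntegrableOn (fun z => ((‖f z‖ : ℝ) : ℂ)) (Ioi 0) := hf.integrableOn_Ioi.norm.ofReal
  have hc : ContinuousOn (fun y => ∫ z in Ioi y, ‖f z‖) (Ici 0) := by
    refine (Complex.continuous_re.comp_continuousOn (continuousOn_tailInt hi)).congr fun y _ => ?_
    simp only [Function.comp_apply, tailInt, integral_complex_ofReal, Complex.ofReal_re]
  refine (integrableOn_inv_one_add_sq.const_mul (Real.sqrt (wsq f))).mono'
    ((hc.mono Ioi_subset_Ici_self).aestronglyMeasurable measurableSet_Ioi) ?_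
  filter_upwards [ae_restrict_mem measurableSet_Ioi] with y hy
  rw [Real.norm_of_nonneg (integral_nonneg fun z => norm_nonneg _)]
  exact (hf.tail (Real.sqrt_nonneg _) (Real.sq_sqrt (wsq_nonneg f)).ge (le_of_lt hy)).2

lemma abs_calV_norm (f : ℝ → ℂ) :
    |calV fun y => ‖f y‖| = ∫ y in Ioi (0:ℝ), ∫ z in Ioi y, ‖f z‖ := by
  rw [calV, integral_neg, abs_neg, abs_of_nonneg]
  exact integral_nonneg fun y => integral_nonneg fun z => norm_nonneg _

lemma abs_calV_norm_add_le (hf : WeightedL2 f) (hg : WeightedL2 g) :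
    |calV fun y => ‖f y + g y‖| ≤ |calV fun y => ‖f y‖| + |calV fun y => ‖g y‖| := by
  rw [abs_calV_norm f, abs_calV_norm g,
    ← integral_add hf.integrableOn_tail_norm hg.integrableOn_tail_norm]
  refine abs_calV_norm_le_of_tail (hf.integrableOn_tail_norm.add hg.integrableOn_tail_norm) le_rfl
    fun y hy => ?_
  have h1 := (hf.integrableOn_Ioi.mono_set (Ioi_subset_Ioi hy.le)).norm
  have h2 := (hg.integrableOn_Ioi.mono_set (Ioi_subset_Ioi hy.le)).norm
  simp only [Pi.add_apply]
  rw [← integral_add h1 h2]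
  exact integral_mono_of_nonneg (Eventually.of_forall fun z => norm_nonneg _) (h1.add h2)
    (Eventually.of_forall fun z => norm_add_le _ _)

lemma abs_calV_norm_const_mul (f : ℝ → ℂ) (a : ℂ) :
    |calV fun y => ‖a * f y‖| = ‖a‖ * |calV fun y => ‖f y‖| := by
  rw [abs_calV_norm (fun y => a * f y), abs_calV_norm, ← integral_const_mul]
  simp only [norm_mul, integral_const_mul]

end CalV

/-! ### Solutions with prescribed slope at the origin -/

/-- Solutions of the vorticity equation in the weighted space with slope `s` at the origin. -/
def SlopeSol (S : ShearData) (k : ℝ) (lam : ℂ) (w f : ℝ → ℂ) (s : ℂ) : Prop :=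
  WeightedL2 f ∧ ∃ f1 : ℝ → ℂ,
    HasTwoDerivs f f1 (fun y => S.z k lam y * f y - (w y + S.src k (calVy f) y)) ∧ f1 0 = s

section Slope

variable {S : ShearData} {k : ℝ} {lam : ℂ} {w w' f f' : ℝ → ℂ} {s s' : ℂ}

lemma vorticitySol_iff : VorticitySol S k lam w f ↔ SlopeSol S k lam w f 0 := Iff.rfl

lemma SlopeSol.add (h : SlopeSol S k lam w f s) (h' : SlopeSol S k lam w' f' s') :
    SlopeSol S k lam (fun y => w y + w' y) (fun y => f y + f' y) (s + s') := by
  obtain ⟨hL, f1, h1, h10⟩ := h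
  obtain ⟨hL', f1', h1', h10'⟩ := h'
  refine ⟨hL.add hL', _, (h1.add h1').congr_ae ?_, by simp only [h10, h10']⟩
  filter_upwards [ShearData.src_congr (S := S) (k := k) (fun y hy => calVy_add hL.integrableOn_Ioi
    hL'.integrableOn_Ioi hy)] with y hy
  rw [hy, ShearData.src, ShearData.src, ShearData.src]
  ring

lemma SlopeSol.const_mul (h : SlopeSol S k lam w f s) (a : ℂ) :
    SlopeSol S k lam (fun y => a * w y) (fun y => a * f y) (a * s) := by
  obtain ⟨hL, f1, h1, h10⟩ := h
  refine ⟨hL.const_mul a, _, (h1.const_mul a).congr_ae (Eventually.of_forall fun y => ?_),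
    by simp only [h10]⟩
  simp only [ShearData.src, calVy_const_mul]
  ring

lemma SlopeSol.congr_source (h : SlopeSol S k lam w f s)
    (hw : ∀ᵐ y ∂volume.restrict (Ioi 0), w y = w' y) : SlopeSol S k lam w' f s := by
  obtain ⟨hL, f1, h1, h10⟩ := h
  refine ⟨hL, f1, h1.congr_ae ?_, h10⟩
  filter_upwards [hw] with y hy
  rw [hy]

end Slope

/-! ### Translation of the problems -/

section Translation

variable {Us : ℝ → ℝ} {S : ShearData} {k : ℝ} {lam : ℂ} {R f : ℝ → ℂ}

lemma z_eq (hv : ∀ y, 0 ≤ y → S.v y = y + Us y) {y : ℝ} (hy : 0 ≤ y) :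
    lam + Complex.I * (k : ℂ) * ((y + Us y : ℝ) : ℂ) = S.z k lam y := by
  rw [ShearData.z, hv y hy]

lemma src_eq (hd : ∀ y, 0 ≤ y → D2 Us y = -S.d y) (p : ℝ → ℂ) {y : ℝ} (hy : 0 ≤ y) :
    Complex.I * (k : ℂ) * (D2 Us y : ℂ) * p y = S.src k p y := by
  rw [ShearData.src, hd y hy]
  push_cast; ring

lemma exists_slopeSol_of_solvesVorticity (hv : ∀ y, 0 ≤ y → S.v y = y + Us y)
    (hd : ∀ y, 0 ≤ y → D2 Us y = -S.d y) (h : WeightedL2 f) {f1 f2 : ℝ → ℂ}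
    (h2 : HasTwoDerivs f f1 f2) (heq : ∀ᵐ y ∂(volume.restrict (Ioi (0 : ℝ))),
      (lam + Complex.I * (k : ℂ) * ((y + Us y : ℝ) : ℂ)) * f y
        - Complex.I * (k : ℂ) * (D2 Us y : ℂ) * calVy f y - f2 y = R y) :
    SlopeSol S k lam R f (f1 0) := by
  refine ⟨h, f1, h2.congr_ae ?_, rfl⟩
  filter_upwards [heq, ae_restrict_mem measurableSet_Ioi] with y hy hy0
  rw [z_eq hv (le_of_lt hy0), src_eq hd _ (le_of_lt hy0)] at hy
  linear_combination -hy

lemma SlopeSol.solvesVorticity (hv : ∀ y, 0 ≤ y → S.v y = y + Us y)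
    (hd : ∀ y, 0 ≤ y → D2 Us y = -S.d y) {s : ℂ} (h : SlopeSol S k lam R f s) :
    SolvesVorticity Us k lam R f := by
  obtain ⟨hL, f1, h1, -⟩ := h
  refine ⟨hL, f1, _, h1, ?_⟩
  filter_upwards [ae_restrict_mem measurableSet_Ioi] with y hy0
  rw [z_eq hv (le_of_lt hy0), src_eq hd _ (le_of_lt hy0)]
  ring

lemma solvesVorticity_iff (hv : ∀ y, 0 ≤ y → S.v y = y + Us y)
    (hd : ∀ y, 0 ≤ y → D2 Us y = -S.d y) :
    SolvesVorticity Us k lam R f ↔ ∃ s, SlopeSol S k lam R f s :=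
  ⟨fun ⟨hL, _, _, h2, heq⟩ => ⟨_, exists_slopeSol_of_solvesVorticity hv hd hL h2 heq⟩,
    fun ⟨_, h⟩ => h.solvesVorticity hv hd⟩

lemma hydroProblem_iff (hv : ∀ y, 0 ≤ y → S.v y = y + Us y)
    (hd : ∀ y, 0 ≤ y → D2 Us y = -S.d y) :
    HydroProblem Us k lam R f ↔ SlopeSol S k lam R f 0 := by
  constructor
  · rintro ⟨⟨hL, f1, f2, h2, heq⟩, h0⟩
    have h := exists_slopeSol_of_solvesVorticity hv hd hL h2 heq
    -- One-sided derivatives at the wall are unique, so the slope carried by the strong solution is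
    -- the prescribed one.
    have : f1 0 = 0 := (uniqueDiffOn_Ici 0 0 (mem_Ici.2 le_rfl)).eq_deriv _ (h2.first 0 le_rfl) h0
    rwa [this] at h
  · intro h
    refine ⟨h.solvesVorticity hv hd, ?_⟩
    obtain ⟨hL, f1, h1, h10⟩ := h
    have := h1.first 0 le_rfl
    rwa [h10] at this

lemma blProblem_iff (hv : ∀ y, 0 ≤ y → S.v y = y + Us y) {m : ℂ} :
    BLProblem Us k lam m f ↔
      (WeightedL2 f ∧ ∃ f1, HasTwoDerivs f f1 fun y => S.z k lam y * f y) ∧ calU f = m := by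
  refine and_congr_left fun _ => and_congr_right fun _ => ⟨?_, ?_⟩
  · rintro ⟨f1, f2, h2, heq⟩
    refine ⟨f1, h2.congr_ae ?_⟩
    filter_upwards [heq, ae_restrict_mem measurableSet_Ioi] with y hy hy0
    rw [z_eq hv (le_of_lt hy0)] at hy
    linear_combination -hy
  · rintro ⟨f1, h1⟩
    refine ⟨f1, _, h1, ?_⟩
    filter_upwards [ae_restrict_mem measurableSet_Ioi] with y hy0
    rw [z_eq hv (le_of_lt hy0)]
    ring

end Translation

/-- Square integrable solutions of the local equation are multiples of the layer profile. -/
lemma Riccati.eq_const_mul_layer {z q : ℝ → ℂ} {c A : ℝ} (h : Riccati z q c A) {f f1 : ℝ → ℂ}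
    (hL : WeightedL2 f) (hf : HasTwoDerivs f f1 fun y => z y * f y) {y : ℝ} (hy : 0 ≤ y) :
    f y = f 0 * layer q y := by
  -- Subtracting `f 0` times the layer makes the difference vanish at the wall, which is the
  -- boundary condition needed for uniqueness.
  have h1 := (hf.add (h.hasTwoDerivs_layer.const_mul (-f 0))).congr_ae
    (g2 := fun y => z y * (f y + -f 0 * layer q y))
    (Eventually.of_forall fun y => by ring)
  have := HasTwoDerivs.eq_zero h.continuous_z h.re_z_nonneg h1
    (hL.add (h.weightedL2_layer.const_mul (-f 0))).integrableOn_sq (by simp) hy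
  linear_combination this

/-! ### The parameter range -/

section Parameters

variable {S : ShearData} {k : ℝ} {lam : ℂ}

/-- The constant `K_*`. -/
def ShearData.threshold (S : ShearData) : ℝ := 576 + (2 * S.κ + 4) ^ 2 + 8 * S.bM + 64 * S.M

lemma ShearData.le_threshold (S : ShearData) : 576 ≤ S.threshold := by
  have := S.bM_pos
  have := S.M_pos
  rw [threshold]; nlinarith [sq_nonneg (2 * S.κ + 4)]

/-- With `a = |k|^(1/3)`, the hypothesis gives `Re λ ≥ K a²` and `√(Re λ) ≥ a`; the product is `(Re
λ)^(3/2) ≥ K|k|`, the form in which the exponent `2/3` is used. -/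
lemma parameter_bounds {K : ℝ} (hK : 1 ≤ K) (hk : 1 ≤ |k|)
    (hμ : K * |k| ^ (2 / 3 : ℝ) ≤ lam.re) :
    K ≤ lam.re ∧ |k| * K ≤ lam.re * Real.sqrt lam.re ∧ |k| / lam.re ≤ |k| ^ (1 / 3 : ℝ) ∧
      1 ≤ |k| ^ (1 / 3 : ℝ) := by
  set a := |k| ^ (1 / 3 : ℝ) with ha
  have ha1 : 1 ≤ a := Real.one_le_rpow hk (by norm_num)
  have ha2 : |k| ^ (2 / 3 : ℝ) = a ^ 2 := by
    rw [ha, ← Real.rpow_natCast, ← Real.rpow_mul (abs_nonneg k)]; norm_num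
  have ha3 : |k| = a ^ 3 := by
    rw [ha, ← Real.rpow_natCast, ← Real.rpow_mul (abs_nonneg k)]; norm_num
  rw [ha2] at hμ
  have hμK : K ≤ lam.re := le_trans (le_mul_of_one_le_right (by linarith) (one_le_pow₀ ha1)) hμ
  have haμ : a ^ 2 ≤ lam.re := le_trans (le_mul_of_one_le_left (by positivity) hK) hμ
  have has : a ≤ Real.sqrt lam.re := Real.le_sqrt_of_sq_le haμ
  refine ⟨hμK, ?_, ?_, ha1⟩
  · calc |k| * K = (K * a ^ 2) * a := by rw [ha3]; ring
      _ ≤ lam.re * Real.sqrt lam.re := mul_le_mul hμ has (by positivity) (by linarith)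
  · rw [div_le_iff₀ (by linarith), ha3]
    calc a ^ 3 = a * a ^ 2 := by ring
      _ ≤ _ := by gcongr

end Parameters

/-! ### Boundary layer, hydrostatic profile and corrector -/

section Profiles

variable {S : ShearData} {k : ℝ} {lam : ℂ} {q : ℝ → ℂ} {c A : ℝ}

/-- The boundary layer profile, the first hydrostatic profile, and the hydrostatic corrector of the
boundary layer, with their bounds. -/
structure IsProfiles (S : ShearData) (k : ℝ) (lam : ℂ) (Ω H h : ℝ → ℂ) : Prop where
  layer_mem : WeightedL2 Ω
  layer_eq : ∃ f1, HasTwoDerivs Ω f1 fun y => S.z k lam y * Ω y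
  calU_layer : calU Ω = 1
  layer_unique : ∀ f f1 : ℝ → ℂ, WeightedL2 f → HasTwoDerivs f f1 (fun y => S.z k lam y * f y) →
    calU f = 1 → EqOn f Ω (Ici 0)
  calV_layer : |calV fun y => ‖Ω y‖| ≤ 16 / Real.sqrt ‖lam‖
  hydro : SlopeSol S k lam (S.src k fun y => (y : ℂ)) H 0
  wsq_hydro : wsq H ≤ (2 * S.M * (|k| / lam.re)) ^ 2
  corrector : SlopeSol S k lam (S.src k (calVy Ω)) h 0
  wsq_corrector : wsq h ≤ (32 * S.M * (|k| / (lam.re * Real.sqrt ‖lam‖))) ^ 2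
  combined : ∃ s, s ≠ 0 ∧ SlopeSol S k lam (fun _ => 0) (fun y => Ω y + h y) s

theorem ShearData.exists_profiles (hk : 1 ≤ |k|)
    (hμ : S.threshold * |k| ^ (2 / 3 : ℝ) ≤ lam.re) :
    ∃ (q : ℝ → ℂ) (A : ℝ) (Ω H h : ℝ → ℂ),
      S.Admissible k lam q (Real.sqrt lam.re / 2) A ∧ IsProfiles S k lam Ω H h := by
  have hT := S.le_threshold
  have hM := S.M_pos
  have hb := S.bM_pos
  have hκ := S.κ_nonneg
  obtain ⟨hK, hkμ, -, -⟩ := parameter_bounds (by linarith) hk hμ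
  have hre : 0 < lam.re := by linarith
  set m := Real.sqrt lam.re with hm
  have hm0 : 0 < m := Real.sqrt_pos.2 hre
  have hmsq : m ^ 2 = lam.re := Real.sq_sqrt hre.le
  -- The summand `8 bM` of the threshold makes the derivative of the root small enough for the
  -- Riccati contraction.
  have hε : |k| * S.bM / (2 * m) ≤ lam.re / 16 := by
    have h1 : |k| * (8 * S.bM) ≤ lam.re * m := by
      refine le_trans ?_ hkμ
      gcongr
      rw [threshold]; nlinarith [sq_nonneg (2 * S.κ + 4)]
    rw [div_le_iff₀ (by positivity)]
    linarith
  obtain ⟨q, A, hq, hA, hqQ⟩ := exists_riccati (S := S) (k := k) (by linarith) hε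
  obtain ⟨hVy, hV, hU⟩ := layer_bounds hre hε hq hqQ
  -- The summand `(2κ + 4)²` gives `√(Re λ) ≥ 2κ + 4`, hence both `κ + 2 ≤ c` and `κ² ≤ Re λ`.
  have had : S.Admissible k lam q (m / 2) A := by
    refine ⟨hq, hA, ?_, hre, ?_⟩
    · have h1 : 2 * S.κ + 4 ≤ m := Real.le_sqrt_of_sq_le (by
        rw [threshold] at hK; linarith)
      linarith
    · rw [threshold] at hK; nlinarith
  have hlam : 0 < ‖lam‖ := hre.trans_le (Complex.re_le_norm lam)
  set σ := Real.sqrt ‖lam‖ with hσ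
  have hσ0 : 0 < σ := Real.sqrt_pos.2 hlam
  have hσsq : σ ^ 2 = ‖lam‖ := Real.sq_sqrt hlam.le
  set I := calU (layer q)
  have hI : 0 < ‖I‖ := lt_of_lt_of_le (by positivity) hU
  have hI0 : I ≠ 0 := norm_pos_iff.1 hI
  have hIinv : ‖I⁻¹‖ ≤ 2 * σ := by
    rw [norm_inv]
    exact inv_le_of_inv_le₀ (by positivity) (by rwa [← one_div])
  have h16 : 2 * σ * (8 / ‖lam‖) = 16 / σ := by
    rw [← hσsq]; field_simp; norm_num
  set Ω : ℝ → ℂ := fun y => I⁻¹ * layer q y with hΩ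
  have hΩL : WeightedL2 Ω := hq.weightedL2_layer.const_mul _
  have hΩd : HasTwoDerivs Ω (fun y => I⁻¹ * (-q y * layer q y)) fun y => S.z k lam y * Ω y :=
    (hq.hasTwoDerivs_layer.const_mul I⁻¹).congr_ae (Eventually.of_forall fun y => by
      simp only [hΩ]; ring)
  have hΩVy : ∀ y, 0 ≤ y → ‖calVy Ω y‖ ≤ 16 / σ := fun y hy => by
    rw [hΩ, calVy_const_mul, norm_mul, ← h16]
    exact mul_le_mul hIinv (hVy y hy) (norm_nonneg _) (by positivity)
  obtain ⟨H, hH, hHw⟩ := had.exists_sol_src (p0 := fun y => (y : ℂ)) (C0 := 1)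
    Complex.continuous_ofReal (fun y hy => by
      rw [Complex.norm_real, Real.norm_of_nonneg hy]; linarith)
  obtain ⟨h, hh, hhw⟩ := had.exists_sol_src (p0 := fun y => calVy Ω (max y 0)) (C0 := 16 / σ)
    (ContinuousOn.comp_max_zero (continuousOn_calVy hΩL.integrableOn_Ioi)) (fun y hy => by
      rw [max_eq_left hy]
      exact (hΩVy y hy).trans (le_mul_of_one_le_right (by positivity) (by linarith)))
  have hh' : SlopeSol S k lam (S.src k (calVy Ω)) h 0 :=
    SlopeSol.congr_source hh (src_congr fun y hy => by rw [max_eq_left hy])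
  -- Seen from the full operator, the layer has source `-ikU_s'' V_y[Ω]`, which the corrector `h`
  -- cancels; the slope of the sum is that of `Ω`, namely `-q(0)/I`, which is nonzero.
  have hΩs : SlopeSol S k lam (fun y => -S.src k (calVy Ω) y) Ω (-(I⁻¹ * q 0)) :=
    ⟨hΩL, _, hΩd.congr_ae (Eventually.of_forall fun y => by ring), by simp⟩
  refine ⟨q, A, Ω, H, h, had, ⟨hΩL, ⟨_, hΩd⟩, ?_, fun f f1 hf hf1 hfU => ?_, ?_, hH, ?_, hh', ?_,
    _, ?_, (hΩs.add hh').congr_source (Eventually.of_forall fun y => by simp)⟩⟩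
  · rw [hΩ, calU_const_mul, inv_mul_cancel₀ hI0]
  · have h1 : EqOn f (fun y => f 0 * layer q y) (Ici 0) := fun y hy =>
      hq.eq_const_mul_layer hf hf1 hy
    have h2 := calU_congr (h1.mono Ioi_subset_Ici_self)
    rw [hfU, calU_const_mul] at h2
    have h3 : f 0 = I⁻¹ := eq_inv_of_mul_eq_one_left h2.symm
    intro y hy
    rw [h1 hy, h3]
  · rw [hΩ, abs_calV_norm_const_mul, ← h16]
    exact mul_le_mul hIinv hV (abs_nonneg _) (by positivity)
  · exact hHw.trans (le_of_eq (by ring))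
  · exact hhw.trans (le_of_eq (by field_simp; ring))
  · rw [add_zero, neg_ne_zero]
    exact mul_ne_zero (inv_ne_zero hI0) (hq.ne_zero 0)

/-- Uniqueness for the vorticity equation with mean constraint. -/
lemma ShearData.Admissible.eqOn_of_calU_eq (had : S.Admissible k lam q c A) {Φ : ℝ → ℂ} {σ : ℂ}
    (hσ : σ ≠ 0) (hΦ : SlopeSol S k lam (fun _ => 0) Φ σ) (hΦU : calU Φ ≠ 0) {w f g : ℝ → ℂ}
    {s s' : ℂ} (hf : SlopeSol S k lam w f s) (hg : SlopeSol S k lam w g s')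
    (hU : calU f = calU g) : EqOn f g (Ici 0) := by
  have hD := hf.add (hg.const_mul (-1))
  -- This multiple of `Φ` cancels the slope of the difference, which then equals `bΦ` by Neumann
  -- uniqueness; equal means force `b = 0`.
  set b := (s + -1 * s') / σ with hb
  have hE := hD.add (hΦ.const_mul (-b))
  rw [show s + -1 * s' + -b * σ = 0 by rw [hb]; field_simp; ring] at hE
  have h0 : ∀ y, 0 ≤ y → f y + -1 * g y + -b * Φ y = 0 := fun y hy =>
    had.eq_zero (vorticitySol_iff.2 hE) (Eventually.of_forall fun y => by simp) hy
  have h1 : EqOn (fun y => f y + -1 * g y) (fun y => b * Φ y) (Ici 0) := fun y hy => by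
    have := h0 y hy
    simp only
    linear_combination this
  have h2 := calU_congr (h1.mono Ioi_subset_Ici_self)
  rw [calU_add hf.1.integrableOn_Ioi (hg.1.const_mul _).integrableOn_Ioi, calU_const_mul,
    calU_const_mul, hU] at h2
  have h3 : b = 0 := by
    have : b * calU Φ = 0 := by rw [← h2]; ring
    exact (mul_eq_zero.1 this).resolve_right hΦU
  intro y hy
  have := h0 y hy
  rw [h3] at this
  linear_combination this

end Profiles

end TripleDeck
end

/-! ### Summation of the iteration and the decomposition -/

theorem proposition2p4 (Us : ℝ → ℝ) (hUs : TripleDeck.ConcaveShear Us) :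
    ∃ k0 K C : ℝ, 0 < k0 ∧ 0 < K ∧ 0 < C ∧
      ∀ (k : ℝ) (lam : ℂ), k0 ≤ |k| → K * |k| ^ (2 / 3 : ℝ) ≤ lam.re →
        ∃ (lamStar : ℂ) (OmegaBL wHtail : ℝ → ℂ) (wH wBL : ℕ → ℝ → ℂ),
          -- the objects of the decomposition that depend on `k` and `lam` only
          TripleDeck.IsTheSolution (TripleDeck.BLProblem Us k lam 1) OmegaBL ∧
          TripleDeck.IsTheSolution
            (TripleDeck.HydroProblem Us k lam (TripleDeck.shearForcing Us k)) (wH 0) ∧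
          TripleDeck.IsIteration Us k lam wH wBL ∧
          TripleDeck.WeightedL2 wHtail ∧
          (∀ y : ℝ, 0 ≤ y → HasSum (fun j : ℕ => wH (j + 1) y) (wHtail y)) ∧
          HasSum (TripleDeck.lamSeq wH) lamStar ∧
          (∀ y : ℝ, 0 ≤ y → HasSum (fun j : ℕ => wBL j y) (lamStar * OmegaBL y)) ∧
          -- their bounds
          ‖lamStar‖ ≤ C * (1 + |k| / lam.re) ∧
          |TripleDeck.calV (fun y => ‖OmegaBL y‖)| ≤ C * (1 / ‖lam‖ ^ (1 / 2 : ℝ)) ∧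
          |TripleDeck.calV (fun y => ‖wH 0 y‖)| ≤ C * (|k| / lam.re) ∧
          |TripleDeck.calV (fun y => ‖wHtail y‖)| ≤
            C * (|k| / (lam.re * ‖lam‖ ^ (1 / 2 : ℝ)) * (1 + |k| / lam.re)) ∧
          -- the inhomogeneous part, and the solution for every constant `A`
          ∀ wInit : ℝ → ℂ, TripleDeck.WeightedL2 wInit →
            ∃ wInhom : ℝ → ℂ,
              TripleDeck.IsTheSolution (TripleDeck.MeanProblem Us k lam wInit 0) wInhom ∧
              |TripleDeck.calV (fun y => ‖wInhom y‖)| ≤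
                C * (1 / lam.re * |k| ^ (1 / 3 : ℝ) * TripleDeck.weightedNorm wInit) ∧
              ∀ A : ℂ,
                TripleDeck.IsTheSolution
                  (TripleDeck.MeanProblem Us k lam
                    (fun y => TripleDeck.shearForcing Us k y * A + wInit y) A)
                  (fun y => A * lamStar * OmegaBL y + A * wH 0 y + A * wHtail y + wInhom y) := by
  open TripleDeck in
  obtain ⟨S, hv, hd⟩ := hUs.exists_shearData
  have hT := S.le_threshold
  have hM := S.M_pos
  -- The constant dominates those of the five bounds: `2 + 4M` for `λ_*`, `16` for the layer, `2M`
  -- for the hydrostatic profile, `32M(2 + 4M)` for the tail, and `4(8 + 16M)` for the inhomogeneous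
  -- part.
  refine ⟨1, S.threshold, 32 + 32 * S.M * (2 + 4 * S.M) + 64 * S.M, one_pos, by linarith,
    by positivity, fun k lam hk hμ => ?_⟩
  obtain ⟨hK, hkμ, hk3, h1k3⟩ := parameter_bounds (by linarith) hk hμ
  obtain ⟨q, A, Ω, H, h, had, hp⟩ := S.exists_profiles hk hμ
  have hre : 0 < lam.re := by linarith
  have hrel : lam.re ≤ ‖lam‖ := Complex.re_le_norm lam
  have hlam : 0 < ‖lam‖ := hre.trans_le hrel
  rw [← Real.sqrt_eq_rpow]
  set σ := Real.sqrt ‖lam‖ with hσ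
  have hσ0 : 0 < σ := Real.sqrt_pos.2 hlam
  have hσm : Real.sqrt lam.re ≤ σ := Real.sqrt_le_sqrt hrel
  have hx0 : 0 ≤ |k| / lam.re := by positivity
  have hNh0 : 0 ≤ 32 * S.M * (|k| / (lam.re * σ)) := by positivity
  -- The summand `64 M` of the threshold is chosen for this bound, which makes the ratio of the
  -- iteration at most one half.
  have hNh : 32 * S.M * (|k| / (lam.re * σ)) ≤ 1 / 2 := by
    have h1 : |k| * (64 * S.M) ≤ lam.re * σ := by
      calc |k| * (64 * S.M) ≤ |k| * S.threshold := by
            gcongr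
            rw [ShearData.threshold]
            nlinarith [sq_nonneg (2 * S.κ + 4), S.bM_pos]
        _ ≤ lam.re * Real.sqrt lam.re := hkμ
        _ ≤ _ := by gcongr
    rw [← mul_div_assoc, div_le_iff₀ (by positivity)]
    linarith
  have hhL := hp.corrector.1
  have hHL := hp.hydro.1
  have hΩL := hp.layer_mem
  -- One round of the iteration, from layer to corrector and back to the next layer, multiplies the
  -- amplitude by `ρ`.
  set ρ := -calU h with hρ
  have hρ2 : ‖ρ‖ ≤ 1 / 2 := by
    rw [hρ, norm_neg]
    exact (norm_calU_le hhL hNh0 hp.wsq_corrector).trans hNh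
  have hρ1 : ‖ρ‖ < 1 := by linarith
  have h1ρ : 1 / 2 ≤ ‖1 - ρ‖ := by
    have := norm_sub_norm_le (1 : ℂ) ρ
    rw [norm_one] at this
    linarith
  have h1ρ0 : 1 - ρ ≠ 0 := norm_pos_iff.1 (by linarith)
  have hinv : ‖(1 - ρ)⁻¹‖ ≤ 2 := by
    rw [norm_inv]
    exact inv_le_of_inv_le₀ (by norm_num) (by linarith)
  have hHx : 0 ≤ 2 * S.M * (|k| / lam.re) := by positivity
  set l0 := 1 - calU H with hl0
  have hl0b : ‖l0‖ ≤ 1 + 2 * S.M * (|k| / lam.re) := by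
    refine (norm_sub_le _ _).trans ?_
    rw [norm_one]
    gcongr
    exact norm_calU_le hHL hHx hp.wsq_hydro
  set ls := l0 * (1 - ρ)⁻¹ with hls
  have hlsb : ‖ls‖ ≤ (2 + 4 * S.M) * (1 + |k| / lam.re) := by
    rw [hls, norm_mul]
    calc _ ≤ (1 + 2 * S.M * (|k| / lam.re)) * 2 :=
          mul_le_mul hl0b hinv (norm_nonneg _) (by positivity)
      _ ≤ _ := by nlinarith
  have hgeo : HasSum (fun j : ℕ => l0 * ρ ^ j) ls := (hasSum_geometric_of_norm_lt_one hρ1).mul_left l0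
  obtain ⟨s, hs0, hΦ⟩ := hp.combined
  have hΦU : calU (fun y => Ω y + h y) = 1 - ρ := by
    rw [calU_add hΩL.integrableOn_Ioi hhL.integrableOn_Ioi, hp.calU_layer, hρ]; ring
  have hshear : ∀ y, 0 ≤ y → shearForcing Us k y = S.src k (fun y => (y : ℂ)) y := fun y hy =>
    src_eq hd (fun y => (y : ℂ)) hy
  have hshear_ae : ∀ᵐ y ∂volume.restrict (Ioi 0),
      shearForcing Us k y = S.src k (fun y => (y : ℂ)) y := by
    filter_upwards [ae_restrict_mem measurableSet_Ioi] with y hy using hshear y (le_of_lt hy)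
  have hshear_ae' : ∀ᵐ y ∂volume.restrict (Ioi 0),
      S.src k (fun y => (y : ℂ)) y = shearForcing Us k y := by
    filter_upwards [hshear_ae] with y hy using hy.symm
  set wH : ℕ → ℝ → ℂ := fun j => match j with
    | 0 => H
    | j + 1 => fun y => l0 * ρ ^ j * h y with hwH
  set wBL : ℕ → ℝ → ℂ := fun j y => l0 * ρ ^ j * Ω y with hwBL
  have hUsucc : ∀ j, -calU (wH (j + 1)) = l0 * ρ ^ (j + 1) := fun j => by
    show -calU (fun y => l0 * ρ ^ j * h y) = _
    rw [calU_const_mul, pow_succ]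
    simp only [hρ]; ring
  have hBL : ∀ j, BLProblem Us k lam (l0 * ρ ^ j) (wBL j) := fun j => by
    obtain ⟨f1, hf1⟩ := hp.layer_eq
    refine (blProblem_iff hv).2 ⟨⟨hΩL.const_mul _, _, (hf1.const_mul (l0 * ρ ^ j)).congr_ae
      (Eventually.of_forall fun y => by simp only [hwBL]; ring)⟩, ?_⟩
    rw [hwBL, calU_const_mul, hp.calU_layer, mul_one]
  have hBL1 : BLProblem Us k lam 1 Ω := (blProblem_iff hv).2 ⟨⟨hΩL, hp.layer_eq⟩, hp.calU_layer⟩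
  have hhydro : HydroProblem Us k lam (shearForcing Us k) H :=
    (hydroProblem_iff hv hd).2 (hp.hydro.congr_source hshear_ae')
  refine ⟨ls, Ω, fun y => ls * h y, wH, wBL, ⟨hBL1, fun g hg => ?_⟩, ⟨hhydro, fun g hg => ?_⟩,
    ⟨hhydro, ?_, fun j => ?_, fun j => ?_⟩, hhL.const_mul ls, fun y _ => ?_, ?_, fun y _ => ?_,
    ?_, ?_, ?_, ?_, fun wInit hw => ?_⟩
  · obtain ⟨⟨hgL, f1, hf1⟩, hgU⟩ := (blProblem_iff hv).1 hg
    exact hp.layer_unique g f1 hgL hf1 hgU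
  · exact had.eqOn (vorticitySol_iff.2 ((hydroProblem_iff hv hd).1 hg))
      (vorticitySol_iff.2 hp.hydro) hshear_ae
  · have := hBL 0
    rwa [pow_zero, mul_one] at this
  · refine (hydroProblem_iff hv hd).2 ((hp.corrector.const_mul (l0 * ρ ^ j)).congr_source ?_
      |> fun h => by rwa [mul_zero] at h)
    filter_upwards [ae_restrict_mem measurableSet_Ioi] with y hy
    rw [src_eq hd (calVy (wBL j)) (le_of_lt hy), ShearData.src, ShearData.src, hwBL,
      calVy_const_mul]
    ring
  · rw [hUsucc]
    exact hBL (j + 1)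
  · exact hgeo.mul_right (h y)
  · convert! hgeo using 1
    funext j
    rcases j with _ | j
    · simp [lamSeq, hwH, hl0]
    · rw [lamSeq, if_neg (Nat.succ_ne_zero j), hUsucc]
  · exact hgeo.mul_right (Ω y)
  · exact hlsb.trans (mul_le_mul_of_nonneg_right (by nlinarith) (by positivity))
  · refine hp.calV_layer.trans ?_
    rw [div_eq_mul_one_div]
    gcongr
    nlinarith
  · refine (abs_calV_norm_le hHL hHx hp.wsq_hydro).trans ?_
    gcongr
    nlinarith
  · rw [abs_calV_norm_const_mul]
    have h1 := abs_calV_norm_le hhL hNh0 hp.wsq_corrector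
    calc _ ≤ ((2 + 4 * S.M) * (1 + |k| / lam.re)) * (32 * S.M * (|k| / (lam.re * σ))) :=
          mul_le_mul hlsb h1 (abs_nonneg _) (by positivity)
      _ = (32 * S.M * (2 + 4 * S.M)) * (|k| / (lam.re * σ) * (1 + |k| / lam.re)) := by ring
      _ ≤ _ := by
          gcongr
          linarith
  · obtain ⟨f, g, hfg, hfL, hgL, hfw, hgw⟩ := had.exists_sol hw
    have hW := weightedNorm_nonneg wInit
    set W := weightedNorm wInit
    -- The decay rate is `c = √(Re λ)/2`.
    have hc2 : 2 / (Real.sqrt lam.re / 2) ^ 2 = 8 / lam.re := by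
      rw [div_pow, Real.sq_sqrt hre.le]; field_simp; norm_num
    rw [hc2] at hfw hgw
    have hNf0 : 0 ≤ 8 / lam.re * W := by positivity
    have hNg0 : 0 ≤ 2 * S.M * (8 / lam.re * W) * (|k| / lam.re) := by positivity
    set N := 8 / lam.re * W + 2 * S.M * (8 / lam.re * W) * (|k| / lam.re) with hN
    have hN0 : 0 ≤ N := add_nonneg hNf0 hNg0
    have hNb : N ≤ (8 + 16 * S.M) * (1 / lam.re * |k| ^ (1 / 3 : ℝ) * W) := by
      calc N ≤ 8 / lam.re * W * |k| ^ (1 / 3 : ℝ) +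
            2 * S.M * (8 / lam.re * W) * |k| ^ (1 / 3 : ℝ) := by
            have := le_mul_of_one_le_right hNf0 h1k3
            rw [hN]; gcongr
        _ = _ := by ring
    have hFL : WeightedL2 fun y => f y + g y := hfL.add hgL
    set m := calU fun y => f y + g y with hm
    have hmb : ‖m‖ ≤ N := by
      rw [hm, calU_add hfL.integrableOn_Ioi hgL.integrableOn_Ioi]
      exact (norm_add_le _ _).trans
        (add_le_add (norm_calU_le hfL hNf0 hfw) (norm_calU_le hgL hNg0 hgw))
    have hFV : |calV fun y => ‖f y + g y‖| ≤ N :=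
      (abs_calV_norm_add_le hfL hgL).trans
        (add_le_add (abs_calV_norm_le hfL hNf0 hfw) (abs_calV_norm_le hgL hNg0 hgw))
    have hΦV : |calV fun y => ‖Ω y + h y‖| ≤ 3 / 2 := by
      have h1 : 16 / σ ≤ 1 := by
        rw [div_le_one hσ0]
        exact (Real.le_sqrt_of_sq_le (by linarith)).trans hσm
      have := abs_calV_norm_add_le hΩL hhL
      have := hp.calV_layer
      have := abs_calV_norm_le hhL hNh0 hp.wsq_corrector
      linarith
    -- The homogeneous solution `Ω + h` has mean `1 - ρ`, so this multiple of it removes the mean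
    -- `m` of the Neumann solution.
    set b := -(m * (1 - ρ)⁻¹) with hb
    have hbb : ‖b‖ ≤ N * 2 := by
      rw [hb, norm_neg, norm_mul]
      exact mul_le_mul hmb hinv (norm_nonneg _) hN0
    set u : ℝ → ℂ := fun y => f y + g y + b * (Ω y + h y) with hu
    have huS : SlopeSol S k lam wInit u (0 + b * s) :=
      ((vorticitySol_iff.1 hfg).add (hΦ.const_mul b)).congr_source
        (Eventually.of_forall fun y => by simp)
    have huU : calU u = 0 := by
      rw [hu, calU_add hFL.integrableOn_Ioi (hΦ.1.const_mul b).integrableOn_Ioi, calU_const_mul,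
        hΦU, ← hm, hb]
      field_simp; ring
    have huniq : ∀ (w' f' g' : ℝ → ℂ) (s' : ℂ) (m' : ℂ), SlopeSol S k lam w' f' s' →
        calU f' = m' → MeanProblem Us k lam w' m' g' → EqOn g' f' (Ici 0) := by
      rintro w' f' g' s' m' hf' hfU ⟨hg', hgU⟩
      obtain ⟨s'', hg'⟩ := (solvesVorticity_iff hv hd).1 hg'
      exact had.eqOn_of_calU_eq hs0 hΦ (by rw [hΦU]; exact h1ρ0) hg' hf' (hgU.trans hfU.symm)
    refine ⟨u, ⟨⟨huS.solvesVorticity hv hd, huU⟩, fun g' hg' => huniq _ _ _ _ _ huS huU hg'⟩, ?_,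
      fun a => ?_⟩
    · have h1 := abs_calV_norm_add_le hFL (hΦ.1.const_mul b)
      rw [abs_calV_norm_const_mul] at h1
      have h2 : ‖b‖ * |calV fun y => ‖Ω y + h y‖| ≤ N * 2 * (3 / 2) :=
        mul_le_mul hbb hΦV (abs_nonneg _) (by positivity)
      have h3 : 0 ≤ 32 * S.M * (2 + 4 * S.M) * (1 / lam.re * |k| ^ (1 / 3 : ℝ) * W) := by
        positivity
      linarith
    · have hsol := ((hΦ.const_mul (a * ls)).add (hp.hydro.const_mul a)).add huS
      have heq : (fun y => a * ls * Ω y + a * wH 0 y + a * (ls * h y) + u y) =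
          fun y => a * ls * (Ω y + h y) + a * H y + u y := by
        funext y
        show a * ls * Ω y + a * H y + a * (ls * h y) + u y = _
        ring
      rw [heq]
      have hsol' : SlopeSol S k lam (fun y => shearForcing Us k y * a + wInit y)
          (fun y => a * ls * (Ω y + h y) + a * H y + u y) _ := hsol.congr_source (by
        filter_upwards [hshear_ae] with y hy
        rw [hy]; ring)
      -- The mean is `a λ_*(1 - ρ) + a U[H] + 0`, and `λ_*(1 - ρ) = 1 - U[H]`.
      have hUtot : calU (fun y => a * ls * (Ω y + h y) + a * H y + u y) = a := by
        rw [calU_add ((hΦ.1.const_mul (a * ls)).add (hHL.const_mul a)).integrableOn_Ioi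
          huS.1.integrableOn_Ioi, calU_add (hΦ.1.const_mul (a * ls)).integrableOn_Ioi
          (hHL.const_mul a).integrableOn_Ioi, calU_const_mul, calU_const_mul, hΦU, huU, hls, hl0]
        field_simp; ring
      exact ⟨⟨hsol'.solvesVorticity hv hd, hUtot⟩,
        fun g' hg' => huniq _ _ _ _ _ hsol' hUtot hg'⟩
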